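/- **Structure theorem for limits of strips.** Conventions. Fix $L>0$, let $S=\{x+iy : |y|<L\}$ and $T(z)=z-1$. Let $f$ be a rational map of the Riemann sphere $\mathbb P^1$. An *invariant strip* of $f$ is an open simply connected set $A\subset\mathbb P^1$ such that $f|_A$ is holomorphically conjugate to $T|_S$; its *central line* is the unique geodesic of the hyperbolic metric of $A$ that is stabilized by $f$. Its *forward end* is the point $a=\lim_{m\to\infty} f^{\circ m}(z)$ and its *backward end* is $u=\lim_{m\to\infty}(f|_A)^{-m}(z)$, for any $z\in A$. A fixed point is *attracting*, *repelling* or *parabolic* if its multiplier has modulus $<1$, has modulus $>1$, or is a root of unity, respectively. A *fixed parabolic basin* of $g$ is a component $\Omega$ of the Fatou set of $g$ with $g(\Omega)=\Omega$ on which the iterates of $g$ converge locally uniformly to a parabolic fixed point in $\partial\Omega$. Theorem. Let $f_n$ ($n\in\mathbb N$) and $g$ be rational maps with $\deg g\ge 2$ and $f_n\to g$ uniformly on $\mathbb P^1$ for the spherical metric. Let $A_n$ be an invariant strip of $f_n$ (with the same $L$ for all $n$), with central line $\gamma_n$, forward end $a_n$ and backward end $u_n$. Suppose that $\overline{\gamma_n}\to\Gamma$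 in the Hausdorff topology on non-empty compact subsets of $\mathbb P^1$, that $a_n\to a_\infty$, and that $u_n\to u_\infty$. Then $\Gamma$ is the underlying set of a connected directed graph $(V,E)$ embedded in $\mathbb P^1$ (with at most countably many edges; loops, multiple edges and infinite valence are allowed), whose edges are open arcs $\gamma_e$, $e\in E$, running in the direction of the dynamics of $g$, such that: 1. $V=\Gamma\cap\mathrm{Fix}(g)$ is non-empty and finite and contains $a_\infty$ and $u_\infty$. 2. $\Gamma\setminus V=\bigcup_{e\in E}\gamma_e$, and each $\gamma_e$ is the central line of an invariant strip $S_e$ of $g$ (with the same $L$), whose backward and forward ends are the source and the target of $e$; the strips $S_e$ are pairwise disjoint. 3. The edges are isolated: $S_e\cap\Gamma=\gamma_e$ for every $e\in E$. 4. If $\Gamma$ is not a single point, every vertex is an end of at least one edge. 5. $a_\infty$ is an attracting or a parabolic fixed point of $g$. If it is attracting, then $u_\infty\ne a_\infty$, exactly one edge points to $a_\infty$, and no edge points out of $a_\infty$. Symmetrically, $u_\infty$ is a repelling or a parabolic fixed point of $g$; if it is repelling, then $u_\infty\neq a_\infty$, exactly one edge points out of $u_\infty$, and no edge points to $u_\infty$.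 6. If the forward end of an edge $\gamma_e$ is not $a_\infty$, then $S_e$ and $\gamma_e$ are contained in a fixed parabolic basin of $g$. -/

import Mathlib

open Set Filter Topology

open scoped UpperHalfPlane

namespace InvariantStrips

noncomputable section

/-! ### The Riemann sphere with its chordal metric -/

/-- The Riemann sphere, i.e. the complex projective line. -/
abbrev Sphere : Type := OnePoint ℂ

/-- The affine coordinate `z` of a point of the sphere (with the junk value `0` at `∞`). -/
def coord (p : Sphere) : ℂ := p.elim 0 id

open Classical in
/-- The involution `z ↦ 1 / z` of the sphere; it exchanges `0` and `∞`. -/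
def inversion (p : Sphere) : Sphere :=
  if p = OnePoint.infty then ((0 : ℂ) : Sphere)
  else if coord p = 0 then OnePoint.infty else (((coord p)⁻¹ : ℂ) : Sphere)

/-- Inverse stereographic projection of the plane,
`z ↦ (2 z / (1 + |z|²), (|z|² - 1) / (1 + |z|²))`, onto the unit sphere of `ℂ × ℝ = ℝ³`
minus the north pole. -/
def stereoPlane (z : ℂ) : WithLp 2 (ℂ × ℝ) :=
  WithLp.toLp 2 (((2 / (1 + ‖z‖ ^ 2) : ℝ) : ℂ) * z, 1 - 2 / (1 + ‖z‖ ^ 2))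

/-- Inverse stereographic projection, with `∞` sent to the north pole. -/
def stereo (p : Sphere) : WithLp 2 (ℂ × ℝ) :=
  p.elim (WithLp.toLp 2 ((0 : ℂ), (1 : ℝ))) stereoPlane

@[simp] theorem stereo_infty :
    stereo OnePoint.infty = WithLp.toLp 2 ((0 : ℂ), (1 : ℝ)) := rfl

@[simp] theorem stereo_coe (z : ℂ) : stereo (z : Sphere) = stereoPlane z := rfl

theorem continuous_stereoPlane : Continuous stereoPlane := by
  have h : ∀ z : ℂ, (1 + ‖z‖ ^ 2) ≠ 0 := fun z => by positivity
  unfold stereoPlane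
  refine (WithLp.prod_continuous_toLp 2 ℂ ℝ).comp ?_
  refine Continuous.prodMk ?_ ?_
  · refine Continuous.mul (Complex.continuous_ofReal.comp ?_) continuous_id
    exact continuous_const.div (by fun_prop) h
  · exact continuous_const.sub (continuous_const.div (by fun_prop) h)

theorem tendsto_stereoPlane :
    Tendsto stereoPlane (cocompact ℂ) (𝓝 (WithLp.toLp 2 ((0 : ℂ), (1 : ℝ)))) := by
  have hn : Tendsto (fun z : ℂ => ‖z‖) (cocompact ℂ) atTop := tendsto_norm_cocompact_atTop
  have h1 : Tendsto (fun z : ℂ => 2 / (1 + ‖z‖ ^ 2)) (cocompact ℂ) (𝓝 0) := by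
    refine Tendsto.div_atTop tendsto_const_nhds ?_
    exact tendsto_atTop_add_const_left _ _ ((tendsto_pow_atTop two_ne_zero).comp hn)
  have h2 : Tendsto (fun z : ℂ => ((2 / (1 + ‖z‖ ^ 2) : ℝ) : ℂ) * z) (cocompact ℂ) (𝓝 0) := by
    have h3 : Tendsto (fun z : ℂ => 2 / ‖z‖) (cocompact ℂ) (𝓝 0) :=
      Tendsto.div_atTop tendsto_const_nhds hn
    refine squeeze_zero_norm (fun z => ?_) h3
    rw [norm_mul, Complex.norm_real, Real.norm_of_nonneg (by positivity)]
    rcases eq_or_ne z 0 with rfl | hz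
    · simp
    · have : 0 < ‖z‖ := norm_pos_iff.mpr hz
      rw [div_mul_eq_mul_div, div_le_div_iff₀ (by positivity) this]
      nlinarith
  refine ((WithLp.prod_continuous_toLp 2 ℂ ℝ).tendsto _).comp ?_
  refine Tendsto.prodMk_nhds h2 ?_
  simpa using tendsto_const_nhds.sub h1

theorem continuous_stereo : Continuous stereo := by
  rw [OnePoint.continuous_iff]
  refine ⟨?_, continuous_stereoPlane⟩
  have := tendsto_stereoPlane
  rw [← Filter.coclosedCompact_eq_cocompact] at this
  exact this

theorem injective_stereo : Function.Injective stereo := by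
  have key : ∀ z : ℂ, (1 : ℝ) - 2 / (1 + ‖z‖ ^ 2) ≠ 1 := by
    intro z h
    have : (0 : ℝ) < 2 / (1 + ‖z‖ ^ 2) := by positivity
    linarith
  intro p q h
  induction p using OnePoint.rec with
  | infty =>
    induction q using OnePoint.rec with
    | infty => rfl
    | coe w =>
      have := congrArg (fun x : WithLp 2 (ℂ × ℝ) => x.snd) h
      simp only [stereo_infty, stereo_coe, stereoPlane] at this
      exact absurd this.symm (key w)
  | coe z =>
    induction q using OnePoint.rec with
    | infty =>
      have := congrArg (fun x : WithLp 2 (ℂ × ℝ) => x.snd) h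
      simp only [stereo_infty, stereo_coe, stereoPlane] at this
      exact absurd this (key z)
    | coe w =>
      have h1 := congrArg (fun x : WithLp 2 (ℂ × ℝ) => x.fst) h
      have h2 := congrArg (fun x : WithLp 2 (ℂ × ℝ) => x.snd) h
      simp only [stereo_coe, stereoPlane] at h1 h2
      change (1 : ℝ) - 2 / (1 + ‖z‖ ^ 2) = 1 - 2 / (1 + ‖w‖ ^ 2) at h2
      change ((2 / (1 + ‖z‖ ^ 2) : ℝ) : ℂ) * z = ((2 / (1 + ‖w‖ ^ 2) : ℝ) : ℂ) * w at h1
      have h3 : 2 / (1 + ‖z‖ ^ 2) = 2 / (1 + ‖w‖ ^ 2) := by linarith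
      rw [h3] at h1
      have h4 : ((2 / (1 + ‖w‖ ^ 2) : ℝ) : ℂ) ≠ 0 := by
        have : (2 / (1 + ‖w‖ ^ 2) : ℝ) ≠ 0 := by positivity
        exact_mod_cast this
      rw [mul_left_cancel₀ h4 h1]

theorem isEmbedding_stereo : IsEmbedding stereo :=
  (continuous_stereo.isClosedEmbedding injective_stereo).isEmbedding

/-- The chordal metric: the Euclidean distance in `ℝ³` between stereographic images. It induces
the usual topology of the sphere. -/
instance : MetricSpace Sphere := isEmbedding_stereo.comapMetricSpace stereo

/-! ### Rational maps -/

/-- The degree of a rational function, as a self-map of the sphere. -/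
def ratDegree (r : RatFunc ℂ) : ℕ := max r.num.natDegree r.denom.natDegree

open Classical in
/-- The value of a rational function `r = P / Q` (in lowest terms) at a finite point is
`P z / Q z`, read as `∞` at a zero of `Q`; its value at `∞` is the quotient of the coefficients of
degree `ratDegree r`, read in the same way. -/
def ratMap (r : RatFunc ℂ) (p : Sphere) : Sphere :=
  p.elim
    (if r.denom.coeff (ratDegree r) = 0 then OnePoint.infty
      else ((r.num.coeff (ratDegree r) / r.denom.coeff (ratDegree r) : ℂ) : Sphere))
    (fun z => if r.denom.eval z = 0 then OnePoint.infty
      else ((r.num.eval z / r.denom.eval z : ℂ) : Sphere))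

open Classical in
/-- The derivative of `f` at a fixed point `a`, computed in the coordinate `z` if `a` is finite
and in the coordinate `1 / z` if `a = ∞`. -/
def multiplier (f : Sphere → Sphere) (a : Sphere) : ℂ :=
  if a = OnePoint.infty then
    deriv (fun w : ℂ => coord (inversion (f (inversion (w : Sphere))))) 0
  else deriv (fun w : ℂ => coord (f (w : Sphere))) (coord a)

def IsAttractingFixed (f : Sphere → Sphere) (a : Sphere) : Prop :=
  f a = a ∧ ‖multiplier f a‖ < 1

def IsRepellingFixed (f : Sphere → Sphere) (a : Sphere) : Prop :=
  f a = a ∧ 1 < ‖multiplier f a‖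

/-- A parabolic fixed point: the multiplier is a root of unity. -/
def IsParabolicFixed (f : Sphere → Sphere) (a : Sphere) : Prop :=
  f a = a ∧ ∃ k : ℕ, 0 < k ∧ multiplier f a ^ k = 1

/-- The Fatou set: the points near which the iterates form an equicontinuous family for the
chordal metric. -/
def fatouSet (f : Sphere → Sphere) : Set Sphere :=
  {z | ∃ U ∈ 𝓝 z, EquicontinuousOn (fun m : ℕ => f^[m]) U}

/-- A fixed parabolic basin: a connected component of the Fatou set which is mapped onto itself
and on which the iterates converge locally uniformly to a parabolic fixed point on its boundary. -/
structure IsFixedParabolicBasin (f : Sphere → Sphere) (Ω : Set Sphere) : Prop where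
  component : ∃ z ∈ fatouSet f, Ω = connectedComponentIn (fatouSet f) z
  fixed : f '' Ω = Ω
  converges : ∃ w, IsParabolicFixed f w ∧ w ∈ frontier Ω ∧
    TendstoLocallyUniformlyOn (fun m : ℕ => f^[m]) (fun _ => w) atTop Ω

/-! ### Invariant strips -/

/-- `φ : U → Sphere` is holomorphic on the open set `U ⊆ ℂ`: it is continuous, and complex
differentiable in each of the coordinates `z`, `1 / z` wherever that coordinate is finite. -/
def HolomorphicOn (φ : ℂ → Sphere) (U : Set ℂ) : Prop :=
  ContinuousOn φ U ∧ ∀ z ∈ U,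
    (φ z ≠ OnePoint.infty → DifferentiableAt ℂ (fun w => coord (φ w)) z) ∧
    (φ z ≠ ((0 : ℂ) : Sphere) → DifferentiableAt ℂ (fun w => coord (inversion (φ w))) z)

/-- `φ` restricts to a conformal isomorphism from the plane domain `U` onto `A`. -/
def IsConformalIso (φ : ℂ → Sphere) (U : Set ℂ) (A : Set Sphere) : Prop :=
  HolomorphicOn φ U ∧ BijOn φ U A

/-- The standard strip `|Im z| < L`. -/
def standardStrip (L : ℝ) : Set ℂ := {z | |z.im| < L}

/-- An invariant strip of `f`: an open simply connected set on which `f` is holomorphically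
conjugate to the translation `z ↦ z - 1` of the standard strip. -/
structure IsInvariantStrip (L : ℝ) (f : Sphere → Sphere) (A : Set Sphere) : Prop where
  isOpen : IsOpen A
  simplyConnected : SimplyConnectedSpace A
  conjugate : ∃ h : ℂ → Sphere, IsConformalIso h (standardStrip L) A ∧
    ∀ z ∈ standardStrip L, f (h z) = h (z - 1)

/-- A complete geodesic of the hyperbolic metric of `A`: the image of a geodesic line of the upper
half-plane, with its hyperbolic metric, under a conformal isomorphism onto `A`. -/
def IsHyperbolicGeodesic (A γ : Set Sphere) : Prop :=
  ∃ φ : ℂ → Sphere, IsConformalIso φ {z | 0 < z.im} A ∧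
    ∃ c : ℝ → ℍ, Isometry c ∧ γ = range (fun t => φ (c t : ℂ))

/-- The central line of an invariant strip `A` of `f`: the hyperbolic geodesic of `A` which is
stabilized by `f`. -/
def IsCentralLine (f : Sphere → Sphere) (A γ : Set Sphere) : Prop :=
  IsHyperbolicGeodesic A γ ∧ f '' γ = γ

/-- `a` is the forward end of the strip `A`: every forward orbit in `A` converges to `a`. -/
def IsForwardEnd (f : Sphere → Sphere) (A : Set Sphere) (a : Sphere) : Prop :=
  ∀ z ∈ A, Tendsto (fun m : ℕ => f^[m] z) atTop (𝓝 a)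

/-- `u` is the backward end of the strip `A`: every backward orbit in `A` converges to `u`. -/
def IsBackwardEnd (f : Sphere → Sphere) (A : Set Sphere) (u : Sphere) : Prop :=
  ∀ z : ℕ → Sphere, (∀ m, z m ∈ A) → (∀ m, f (z (m + 1)) = z m) → Tendsto z atTop (𝓝 u)

/-! ### Directed graphs in the sphere -/

/-- `Γ` carries the structure of a connected directed graph embedded in the sphere, with vertex set
`V` and with (open) edges `edge e` from `src e` to `tgt e`, which point in the direction of the
dynamics of `g`. Loops, multiple edges and vertices of infinite valence are allowed. -/
structure IsConnectedDirectedGraph (g : Sphere → Sphere) (Γ V : Set Sphere) {E : Type}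
    (edge : E → Set Sphere) (src tgt : E → Sphere) : Prop where
  src_mem : ∀ e, src e ∈ V
  tgt_mem : ∀ e, tgt e ∈ V
  union_eq : Γ = V ∪ ⋃ e, edge e
  disjoint_vertices : ∀ e, Disjoint (edge e) V
  disjoint_edges : Pairwise fun e e' => Disjoint (edge e) (edge e')
  /-- Each edge is an open arc running from its source to its target, and `g` moves the points of
  the edge in that direction. -/
  arc : ∀ e, ∃ c : ℝ → Sphere, IsEmbedding c ∧ range c = edge e ∧
    Tendsto c atBot (𝓝 (src e)) ∧ Tendsto c atTop (𝓝 (tgt e)) ∧ ∀ t, g (c t) = c (t + 1)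
  /-- Connectedness as a subset of the sphere. -/
  connected : IsConnected Γ
  /-- Connectedness of the graph: any two vertices are joined by a chain of edges. -/
  joined : ∀ v ∈ V, ∀ w ∈ V, Relation.EqvGen (fun x y => ∃ e, src e = x ∧ tgt e = y) v w

end

end InvariantStrips

open InvariantStrips

namespace InvariantStrips

noncomputable section

/-! ### The sphere: inversion, homogeneous coordinates and charts -/

/-! Let `h n` conjugate the translation of the standard strip to `f n` on `A n`, and consider the
maps `z ↦ h n (z + t n)` for arbitrary real centres `t n`. They are injective and miss every `x`
with `f n (f n x) = f n x`, because a translation has no fixed point. Two such points with distinct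
limits always exist: the ends `a n` and `u n` if their limits differ, and otherwise `a n` together
with one of its preimages under `f n`. In the second case the common limit has non-zero multiplier,
so by degree at least two it has another preimage under `g`, and Hurwitz moves that preimage to `f
n`. Injective maps omitting two values are normal (`tendsto_of_omits`, which rests on a Bloch-type
estimate). Hence along a fixed ultrafilter every choice of centres has a locally uniform limit
`limMap`. By Hurwitz this limit is either constant at a fixed point of `g` or again a strip of `g`
(`StripFamily.isStripMap_or_eq`).

The set of all values `limMap 𝒰 h t 0` is exactly `Γ`, so every non-fixed point of `Γ` lies on the
central line of a limiting strip. If points of the strips converge to a point of a limiting strip,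
then their parameters converge as well (`StripFamily.tendsto_sub`). Disjointness and isolation of
the edges both follow from this: two strips with a common point differ by a real translation, and a
limit of real parameters is real.

Pushing a strip of `g` along itself towards infinity can only give constants at fixed points. There
are finitely many of those, so each strip has two ends. Vertices are studied by
`StripFamily.exists_crossing`: follow the central lines from a vertex until they leave a small
neighbourhood. The travel time tends to infinity, so re-centring at the exit gives a limiting strip
with one whole half in the closure of the neighbourhood, which must end at the vertex. Chain
connectedness of the graph also needs that a strip passing close enough to an end of a strip of `g`
ends there itself (`IsEnd.exists_nhds`). Near attracting and repelling points this is a trapping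
argument, near multiplier `1` a petal argument in the coordinate `b / w ^ n`.

The multiplier at a limit of forward ends has modulus at most `1`, at a limit of backward ends at
least `1`. If the modulus is `1`, then in a Möbius coordinate with zero at the moving fixed point
the normalised strips have a limit that multiplies by the multiplier under each step, and recurrence
on the unit circle makes this limit constant; so the multiplier is `1` (`StripFamily.rescale`). Near
an attracting or repelling point a trap shared by all `f n` leaves room for only one edge. A trap at
an attracting target also captures `a n`, so every edge with another target than the limit of the `a
n` ends at multiplier `1`, and the iterates of `g` on its strip lead to a parabolic basin
(`exists_parabolic_basin`). -/

@[simp] theorem coord_coe (z : ℂ) : coord (z : Sphere) = z := rfl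

@[simp] theorem inversion_infty : inversion OnePoint.infty = ((0 : ℂ) : Sphere) := by
  simp [inversion]

@[simp] theorem inversion_zero : inversion ((0 : ℂ) : Sphere) = OnePoint.infty := by
  simp [inversion]

theorem inversion_coe {z : ℂ} (hz : z ≠ 0) : inversion (z : Sphere) = ((z⁻¹ : ℂ) : Sphere) := by
  simp [inversion, hz]

@[simp] theorem inversion_inversion (p : Sphere) : inversion (inversion p) = p := by
  induction p using OnePoint.rec with
  | infty => simp
  | coe z =>
    rcases eq_or_ne z 0 with rfl | hz
    · simp
    · rw [inversion_coe hz, inversion_coe (inv_ne_zero hz), inv_inv]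

theorem inversion_injective : Function.Injective inversion :=
  Function.LeftInverse.injective inversion_inversion

theorem coe_coord {p : Sphere} (hp : p ≠ OnePoint.infty) : ((coord p : ℂ) : Sphere) = p := by
  induction p using OnePoint.rec with
  | infty => exact absurd rfl hp
  | coe z => rfl

theorem tendsto_inv_coe_infty :
    Tendsto (fun z : ℂ => ((z⁻¹ : ℂ) : Sphere)) (𝓝[≠] 0) (𝓝 OnePoint.infty) := by
  have h := OnePoint.tendsto_coe_infty (X := ℂ)
  rw [Filter.coclosedCompact_eq_cocompact, ← Metric.cobounded_eq_cocompact] at h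
  exact h.comp Filter.tendsto_inv₀_nhdsNE_zero

theorem continuous_inversion : Continuous inversion := by
  rw [continuous_iff_continuousAt]
  intro p
  induction p using OnePoint.rec with
  | infty =>
    rw [OnePoint.continuousAt_infty', inversion_infty, Filter.coclosedCompact_eq_cocompact,
      ← Metric.cobounded_eq_cocompact]
    have h : Tendsto (fun z : ℂ => ((z⁻¹ : ℂ) : Sphere)) (Bornology.cobounded ℂ)
        (𝓝 ((0 : ℂ) : Sphere)) :=
      (OnePoint.continuous_coe.tendsto 0).comp Filter.tendsto_inv₀_cobounded
    refine h.congr' ?_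
    filter_upwards [Bornology.eventually_ne_cobounded (0 : ℂ)] with z hz
    exact (inversion_coe hz).symm
  | coe z =>
    rw [OnePoint.continuousAt_coe]
    rcases eq_or_ne z 0 with rfl | hz
    · rw [ContinuousAt, Function.comp_apply, inversion_zero, ← nhdsNE_sup_pure (0 : ℂ)]
      refine Tendsto.sup ?_ ?_
      · refine tendsto_inv_coe_infty.congr' ?_
        filter_upwards [self_mem_nhdsWithin] with z hz
        exact (inversion_coe hz).symm
      · rw [tendsto_pure_left]
        intro s hs
        simpa using mem_of_mem_nhds hs
    · have h : ContinuousAt (fun z : ℂ => ((z⁻¹ : ℂ) : Sphere)) z :=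
        OnePoint.continuous_coe.continuousAt.comp (continuousAt_inv₀ hz)
      refine h.congr ?_
      filter_upwards [isOpen_ne.mem_nhds hz] with w hw
      exact (inversion_coe hw).symm

theorem eventually_ne_infty {p : Sphere} (hp : p ≠ OnePoint.infty) :
    ∀ᶠ x in 𝓝 p, x ≠ OnePoint.infty := isOpen_ne.mem_nhds hp

open Classical in
/-- The point of the sphere with homogeneous coordinates `[a : b]`. -/
def hmk (a b : ℂ) : Sphere := if b = 0 then OnePoint.infty else ((a / b : ℂ) : Sphere)

theorem hmk_zero (a : ℂ) : hmk a 0 = OnePoint.infty := by simp [hmk]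

theorem hmk_of_ne {a b : ℂ} (hb : b ≠ 0) : hmk a b = ((a / b : ℂ) : Sphere) := by simp [hmk, hb]

@[simp] theorem hmk_one (a : ℂ) : hmk a 1 = (a : Sphere) := by simp [hmk]

theorem hmk_mul {a b c : ℂ} (hc : c ≠ 0) : hmk (c * a) (c * b) = hmk a b := by
  rcases eq_or_ne b 0 with rfl | hb
  · simp [hmk_zero]
  · rw [hmk_of_ne hb, hmk_of_ne (mul_ne_zero hc hb), mul_div_mul_left _ _ hc]

theorem inversion_hmk {a b : ℂ} (h : a ≠ 0 ∨ b ≠ 0) : inversion (hmk a b) = hmk b a := by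
  rcases eq_or_ne b 0 with rfl | hb
  · have ha : a ≠ 0 := by simpa using h
    simp [hmk_zero, hmk_of_ne ha]
  · rcases eq_or_ne a 0 with rfl | ha
    · simp [hmk_zero, hmk_of_ne hb]
    · rw [hmk_of_ne hb, hmk_of_ne ha, inversion_coe (div_ne_zero ha hb), inv_div]

theorem hmk_eq_iff {a b c d : ℂ} (h : a ≠ 0 ∨ b ≠ 0) (h' : c ≠ 0 ∨ d ≠ 0) :
    hmk a b = hmk c d ↔ a * d = b * c := by
  rcases eq_or_ne b 0 with rfl | hb
  · have ha : a ≠ 0 := by simpa using h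
    rcases eq_or_ne d 0 with rfl | hd
    · simp [hmk_zero]
    · simp [hmk_zero, hmk_of_ne hd, ha, hd]
  · rcases eq_or_ne d 0 with rfl | hd
    · have hc : c ≠ 0 := by simpa using h'
      simp [hmk_zero, hmk_of_ne hb, hc, hb]
    · rw [hmk_of_ne hb, hmk_of_ne hd, OnePoint.coe_eq_coe, div_eq_div_iff hb hd, mul_comm c b]

theorem tendsto_hmk {α : Type*} {l : Filter α} {u v : α → ℂ} {a b : ℂ} (hu : Tendsto u l (𝓝 a))
    (hv : Tendsto v l (𝓝 b)) (h : a ≠ 0 ∨ b ≠ 0) :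
    Tendsto (fun x => hmk (u x) (v x)) l (𝓝 (hmk a b)) := by
  have key : ∀ {u v : α → ℂ} {a b : ℂ}, Tendsto u l (𝓝 a) → Tendsto v l (𝓝 b) → b ≠ 0 →
      Tendsto (fun x => hmk (u x) (v x)) l (𝓝 (hmk a b)) := by
    intro u v a b hu hv hb
    rw [hmk_of_ne hb]
    refine ((OnePoint.continuous_coe.tendsto _).comp (hu.div hv hb)).congr' ?_
    filter_upwards [hv.eventually_ne hb] with x hx
    exact (hmk_of_ne hx).symm
  rcases eq_or_ne b 0 with rfl | hb
  · have ha : a ≠ 0 := by simpa using h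
    have := (continuous_inversion.tendsto _).comp (key hv hu ha)
    rw [inversion_hmk (Or.inr ha)] at this
    refine this.congr' ?_
    filter_upwards [hu.eventually_ne ha] with x hx
    exact inversion_hmk (Or.inr hx)
  · exact key hu hv hb

open Classical in
/-- The affine coordinate centred at `p`: `z - p` if `p` is finite and `1 / z` if `p = ∞`. -/
def chart (p x : Sphere) : ℂ :=
  if p = OnePoint.infty then coord (inversion x) else coord x - coord p

open Classical in
/-- The inverse of `chart p`. -/
def param (p : Sphere) (w : ℂ) : Sphere :=
  if p = OnePoint.infty then inversion (w : Sphere) else ((w + coord p : ℂ) : Sphere)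

@[simp] theorem chart_param (p : Sphere) (w : ℂ) : chart p (param p w) = w := by
  unfold chart param
  split_ifs <;> simp

@[simp] theorem param_zero (p : Sphere) : param p 0 = p := by
  unfold param
  split_ifs with h
  · simp [h]
  · simp [coe_coord h]

@[simp] theorem chart_self (p : Sphere) : chart p p = 0 := by
  conv_lhs => arg 2; rw [← param_zero p]
  exact chart_param p 0

theorem param_injective (p : Sphere) : Function.Injective (param p) :=
  Function.LeftInverse.injective (chart_param p)

theorem continuous_param (p : Sphere) : Continuous (param p) := by
  unfold param
  split_ifs
  · exact continuous_inversion.comp OnePoint.continuous_coe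
  · exact OnePoint.continuous_coe.comp (by fun_prop)

theorem isOpenMap_param (p : Sphere) : IsOpenMap (param p) := by
  unfold param
  split_ifs
  · have : IsOpenMap inversion := by
      intro U hU
      rw [image_eq_preimage_of_inverse inversion_inversion inversion_inversion]
      exact hU.preimage continuous_inversion
    exact this.comp OnePoint.isOpenMap_coe
  · exact OnePoint.isOpenMap_coe.comp (isOpenMap_add_right _)

theorem isOpenEmbedding_param (p : Sphere) : IsOpenEmbedding (param p) :=
  .of_continuous_injective_isOpenMap (continuous_param p) (param_injective p) (isOpenMap_param p)

theorem map_param_nhds (p : Sphere) (w : ℂ) : map (param p) (𝓝 w) = 𝓝 (param p w) :=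
  (isOpenEmbedding_param p).map_nhds_eq w

theorem continuousAt_chart_param (p : Sphere) (w : ℂ) : ContinuousAt (chart p) (param p w) := by
  rw [ContinuousAt, ← map_param_nhds, tendsto_map'_iff, chart_param]
  simp only [Function.comp_def, chart_param]
  exact tendsto_id

theorem continuousAt_chart (p : Sphere) : ContinuousAt (chart p) p := by
  simpa using continuousAt_chart_param p 0

theorem tendsto_chart (p : Sphere) : Tendsto (chart p) (𝓝 p) (𝓝 0) := by
  simpa using (continuousAt_chart p).tendsto

theorem param_chart_of_mem {p x : Sphere} (hx : x ∈ range (param p)) :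
    param p (chart p x) = x := by
  obtain ⟨w, rfl⟩ := hx
  simp

theorem range_param_mem_nhds (p : Sphere) (w : ℂ) : range (param p) ∈ 𝓝 (param p w) :=
  (isOpenEmbedding_param p).isOpen_range.mem_nhds ⟨w, rfl⟩

theorem eventually_param_chart (p : Sphere) : ∀ᶠ x in 𝓝 p, param p (chart p x) = x := by
  filter_upwards [by simpa using range_param_mem_nhds p 0] with x hx
  exact param_chart_of_mem hx

/-- Shifting the target coordinate by a constant does not affect the derivative. From here on finite
fixed points and `∞` are treated alike, in the chart centred at the point. -/
theorem multiplier_eq (f : Sphere → Sphere) (p : Sphere) :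
    multiplier f p = deriv (fun w => chart p (f (param p w))) 0 := by
  unfold multiplier chart param
  split_ifs with h
  · rfl
  · rw [deriv_sub_const, deriv_comp_add_const (fun w : ℂ => coord (f (w : Sphere)))]
    simp

/-! ### Holomorphic maps to the sphere -/

theorem HolomorphicOn.mono {φ : ℂ → Sphere} {U V : Set ℂ} (h : HolomorphicOn φ U) (hV : V ⊆ U) :
    HolomorphicOn φ V :=
  ⟨h.1.mono hV, fun z hz => h.2 z (hV hz)⟩

theorem HolomorphicOn.differentiableAt_chart {φ : ℂ → Sphere} {U : Set ℂ} (h : HolomorphicOn φ U)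
    {z : ℂ} (hz : z ∈ U) {p : Sphere} (hp : φ z ∈ range (param p)) :
    DifferentiableAt ℂ (fun w => chart p (φ w)) z := by
  obtain ⟨w, hw⟩ := hp
  unfold param at hw
  unfold chart
  split_ifs with h'
  · refine (h.2 z hz).2 ?_
    rw [← hw, if_pos h', ← inversion_infty]
    exact fun h => by simpa using inversion_injective h
  · refine ((h.2 z hz).1 ?_).sub_const _
    rw [← hw, if_neg h']
    simp

/-- One chart at each point suffices: away from `0` and `∞` the coordinates `z` and `1 / z` are
inverse to each other, and the centred chart is one of them up to a constant. -/
theorem HolomorphicOn.of_chart {φ : ℂ → Sphere} {U : Set ℂ} (hU : IsOpen U)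
    (hc : ContinuousOn φ U)
    (h : ∀ z ∈ U, DifferentiableAt ℂ (fun w => chart (φ z) (φ w)) z) : HolomorphicOn φ U := by
  refine ⟨hc, fun z hz => ?_⟩
  have h1 : φ z ≠ OnePoint.infty → DifferentiableAt ℂ (fun w => coord (φ w)) z := by
    intro h1
    simpa [chart, h1] using (h z hz).add_const (coord (φ z))
  refine ⟨h1, fun h0 => ?_⟩
  by_cases h2 : φ z = OnePoint.infty
  · simpa [chart, h2] using h z hz
  · have h3 : coord (φ z) ≠ 0 := fun h3 => h0 (by rw [← h3, coe_coord h2])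
    refine ((h1 h2).inv h3).congr_of_eventuallyEq ?_
    have hcz := hc.continuousAt (hU.mem_nhds hz)
    filter_upwards [hcz.eventually (eventually_ne_infty h2), (h1 h2).continuousAt.eventually_ne h3]
      with w hw hw'
    conv_lhs => rw [← coe_coord hw, inversion_coe hw']
    rfl

theorem holomorphicOn_hmk {A B : ℂ → ℂ} {U : Set ℂ} (hU : IsOpen U) (hA : DifferentiableOn ℂ A U)
    (hB : DifferentiableOn ℂ B U) (hAB : ∀ z ∈ U, A z ≠ 0 ∨ B z ≠ 0) :
    HolomorphicOn (fun z => hmk (A z) (B z)) U := by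
  have dA := fun z hz => hA.differentiableAt (x := z) (hU.mem_nhds hz)
  have dB := fun z hz => hB.differentiableAt (x := z) (hU.mem_nhds hz)
  refine ⟨fun z hz => ?_, fun z hz => ⟨fun h => ?_, fun h => ?_⟩⟩
  · exact (tendsto_hmk (dA z hz).continuousAt (dB z hz).continuousAt (hAB z hz)).mono_left
      nhdsWithin_le_nhds
  · have hb : B z ≠ 0 := fun hb => h (by simp only [hb, hmk_zero])
    refine ((dA z hz).div (dB z hz) hb).congr_of_eventuallyEq ?_
    filter_upwards [(dB z hz).continuousAt.eventually_ne hb] with w hw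
    simp [hmk_of_ne hw]
  · have ha : A z ≠ 0 := fun ha => by
      rcases hAB z hz with h' | h'
      · exact h' ha
      · exact h (by simp [ha, hmk_of_ne h'])
    refine ((dB z hz).div (dA z hz) ha).congr_of_eventuallyEq ?_
    filter_upwards [(dA z hz).continuousAt.eventually_ne ha] with w hw
    simp [inversion_hmk (Or.inl hw), hmk_of_ne hw]

theorem hmk_one_left (w : ℂ) : hmk 1 w = inversion (w : Sphere) := by
  rw [← hmk_one w, inversion_hmk (Or.inr one_ne_zero)]

theorem holomorphicOn_param {k : ℂ → ℂ} {U : Set ℂ} (hU : IsOpen U) (hk : DifferentiableOn ℂ k U)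
    (p : Sphere) : HolomorphicOn (fun z => param p (k z)) U := by
  unfold param
  split_ifs
  · simpa only [hmk_one_left] using
      holomorphicOn_hmk hU (differentiableOn_const 1) hk fun _ _ => Or.inl one_ne_zero
  · simpa only [hmk_one] using
      holomorphicOn_hmk hU (hk.add_const (coord p)) (differentiableOn_const 1)
        fun _ _ => Or.inr one_ne_zero

theorem HolomorphicOn.comp_differentiableOn {φ : ℂ → Sphere} {U V : Set ℂ} {k : ℂ → ℂ}
    (h : HolomorphicOn φ U) (hV : IsOpen V) (hk : DifferentiableOn ℂ k V) (hkV : MapsTo k V U) :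
    HolomorphicOn (fun z => φ (k z)) V := by
  refine ⟨h.1.comp hk.continuousOn hkV, fun z hz => ⟨fun h' => ?_, fun h' => ?_⟩⟩
  · exact ((h.2 (k z) (hkV hz)).1 h').comp z (hk.differentiableAt (hV.mem_nhds hz))
  · exact ((h.2 (k z) (hkV hz)).2 h').comp z (hk.differentiableAt (hV.mem_nhds hz))

/-- Identity theorem for maps to the sphere. -/
theorem HolomorphicOn.eqOn_const {φ : ℂ → Sphere} {U : Set ℂ} (hU : IsOpen U)
    (hUc : IsPreconnected U) (h : HolomorphicOn φ U) {z₀ : ℂ} (hz₀ : z₀ ∈ U) {c : Sphere}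
    (hc : ∀ᶠ z in 𝓝 z₀, φ z = c) : ∀ z ∈ U, φ z = c := by
  have hO : IsOpen {z | ∀ᶠ w in 𝓝 z, φ w = c} := isOpen_setOfPred_eventually_nhds
  have hsub : U ⊆ {z | ∀ᶠ w in 𝓝 z, φ w = c} := by
    -- The set where `φ` is locally equal to `c` is open. It is closed in `U` since at a limit point
    -- the analytic function `chart c ∘ φ` has a non-isolated zero.
    refine hUc.subset_of_closure_inter_subset hO ⟨z₀, hz₀, hc⟩ ?_
    rintro z ⟨hzcl, hzU⟩
    have hzf : ∃ᶠ w in 𝓝 z, φ w = c := by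
      rw [mem_closure_iff_frequently] at hzcl
      exact hzcl.mono fun w hw => hw.self_of_nhds
    have hcz := h.1.continuousAt (hU.mem_nhds hzU)
    have hz : φ z = c := by
      by_contra hne
      exact hzf (hcz.eventually_ne hne)
    have hr : ∀ᶠ w in 𝓝 z, w ∈ U ∧ φ w ∈ range (param c) := by
      have h1 : range (param c) ∈ 𝓝 (φ z) := by
        rw [hz]
        simpa using range_param_mem_nhds c 0
      filter_upwards [hU.mem_nhds hzU, hcz h1] with w hw hw'
      exact ⟨hw, hw'⟩
    have han : AnalyticAt ℂ (fun w => chart c (φ w)) z := by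
      rw [Complex.analyticAt_iff_eventually_differentiableAt]
      filter_upwards [hr] with w hw
      exact h.differentiableAt_chart hw.1 hw.2
    rcases han.eventually_eq_zero_or_eventually_ne_zero with h0 | h0
    · change ∀ᶠ w in 𝓝 z, φ w = c
      filter_upwards [h0, hr] with w hw hw'
      rw [← param_chart_of_mem hw'.2, hw, param_zero]
    · exfalso
      by_cases hzo : ∀ᶠ w in 𝓝 z, φ w = c
      · have h1 : ∀ᶠ w in 𝓝[≠] z, φ w = c := hzo.filter_mono nhdsWithin_le_nhds
        obtain ⟨w, hw, hw'⟩ := (h1.and h0).exists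
        exact hw' (by simp [hw])
      · have hne : z ∉ {z | ∀ᶠ w in 𝓝 z, φ w = c} := hzo
        have h2 : ∃ᶠ w in 𝓝[≠] z, w ∈ {z | ∀ᶠ w in 𝓝 z, φ w = c} := by
          rw [mem_closure_iff_frequently] at hzcl
          rw [frequently_nhdsWithin_iff]
          refine hzcl.mono fun w hw => ⟨hw, fun h => ?_⟩
          rw [mem_singleton_iff] at h
          exact hne (h ▸ hw)
        obtain ⟨w, hw, hw'⟩ := (h2.and_eventually h0).exists
        have h3 : ∀ᶠ v in 𝓝 w, φ v = c := hw
        exact hw' (by rw [h3.self_of_nhds, chart_self])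
  exact fun z hz => (hsub hz).self_of_nhds

/-! ### Continuous convergence -/

/-- `φ i` converges continuously to `Φ` at `y` along the filter `𝒰`: `φ i y'` tends to `Φ y` as
`(i, y')` tends to `𝒰 × y`. -/
def CConvAt {ι Y X : Type*} [TopologicalSpace Y] [TopologicalSpace X] (𝒰 : Filter ι)
    (φ : ι → Y → X) (Φ : Y → X) (y : Y) : Prop :=
  Tendsto (fun q : ι × Y => φ q.1 q.2) (𝒰 ×ˢ 𝓝 y) (𝓝 (Φ y))

section CConv

variable {ι Y X Z : Type*} [TopologicalSpace Y] [TopologicalSpace X] [TopologicalSpace Z]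
  {𝒰 : Filter ι} {φ : ι → Y → X} {Φ : Y → X} {y : Y}

theorem CConvAt.tendsto_comp (h : CConvAt 𝒰 φ Φ y) {u : ι → Y} (hu : Tendsto u 𝒰 (𝓝 y)) :
    Tendsto (fun i => φ i (u i)) 𝒰 (𝓝 (Φ y)) :=
  Tendsto.comp h (tendsto_id.prodMk hu)

theorem CConvAt.tendsto (h : CConvAt 𝒰 φ Φ y) : Tendsto (fun i => φ i y) 𝒰 (𝓝 (Φ y)) :=
  h.tendsto_comp tendsto_const_nhds

theorem CConvAt.comp {ψ : ι → X → Z} {Ψ : X → Z} (hψ : CConvAt 𝒰 ψ Ψ (Φ y))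
    (h : CConvAt 𝒰 φ Φ y) : CConvAt 𝒰 (fun i z => ψ i (φ i z)) (fun z => Ψ (Φ z)) y :=
  Tendsto.comp hψ (tendsto_fst.prodMk h)

theorem cconvAt_const (h : ContinuousAt Φ y) : CConvAt 𝒰 (fun _ => Φ) Φ y :=
  h.tendsto.comp tendsto_snd

/-- For `z` near `y` the values `φ i z` eventually lie in a prescribed closed neighbourhood of `Φ
y`, and so does their limit `Φ z`. Regularity of the target supplies enough closed neighbourhoods.
-/
theorem CConvAt.continuousAt [RegularSpace X] [𝒰.NeBot] (h : CConvAt 𝒰 φ Φ y)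
    (h' : ∀ᶠ z in 𝓝 y, Tendsto (fun i => φ i z) 𝒰 (𝓝 (Φ z))) : ContinuousAt Φ y := by
  refine (closed_nhds_basis (Φ y)).tendsto_right_iff.2 fun N hN => ?_
  obtain ⟨V, hV, W, hW, hVW⟩ := mem_prod_iff.1 (h hN.1)
  filter_upwards [hW, h'] with z hz hz'
  refine hN.2.mem_of_tendsto hz' ?_
  filter_upwards [hV] with i hi
  exact hVW (mk_mem_prod hi hz)

theorem CConvAt.eventually_forall_mem {K : Set Y} (hK : IsCompact K) {O : Set X} (hO : IsOpen O)
    (h : ∀ z ∈ K, CConvAt 𝒰 φ Φ z) (hKO : ∀ z ∈ K, Φ z ∈ O) : ∀ᶠ i in 𝒰, ∀ z ∈ K, φ i z ∈ O := by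
  refine hK.induction_on (p := fun s => ∀ᶠ i in 𝒰, ∀ z ∈ s, φ i z ∈ O) (by simp) ?_ ?_ ?_
  · exact fun s t hst ht => ht.mono fun i hi z hz => hi z (hst hz)
  · intro s t hs ht
    filter_upwards [hs, ht] with i hi hi' z hz
    exact hz.elim (hi z) (hi' z)
  · intro z hz
    obtain ⟨V, hV, W, hW, hVW⟩ := mem_prod_iff.1 (h z hz (hO.mem_nhds (hKO z hz)))
    refine ⟨W, mem_nhdsWithin_of_mem_nhds hW, ?_⟩
    filter_upwards [hV] with i hi z' hz'
    exact hVW (mk_mem_prod hi hz')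

/-- This gives access to the Weierstrass theorems on locally uniform limits and their derivatives.
-/
theorem CConvAt.tendstoLocallyUniformlyOn {X : Type*} [UniformSpace X] {φ : ι → Y → X} {Φ : Y → X}
    [𝒰.NeBot] {U : Set Y} (hU : IsOpen U) (h : ∀ z ∈ U, CConvAt 𝒰 φ Φ z) :
    TendstoLocallyUniformlyOn φ Φ 𝒰 U := by
  intro u hu z hz
  have hc : ContinuousAt Φ z := (h z hz).continuousAt (by
    filter_upwards [hU.mem_nhds hz] with w hw using (h w hw).tendsto)
  obtain ⟨v, hv, hvs, hvu⟩ := comp_symm_mem_uniformity_sets hu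
  obtain ⟨V, hV, W, hW, hVW⟩ := mem_prod_iff.1 (h z hz (UniformSpace.ball_mem_nhds (Φ z) hv))
  refine ⟨W ∩ Φ ⁻¹' UniformSpace.ball (Φ z) v, mem_nhdsWithin_of_mem_nhds
    (inter_mem hW (hc (UniformSpace.ball_mem_nhds (Φ z) hv))), ?_⟩
  filter_upwards [hV] with i hi w hw
  have h1 : (Φ z, φ i w) ∈ v := hVW (mk_mem_prod hi hw.1)
  have h2 : (Φ z, Φ w) ∈ v := hw.2
  have h3 : (Φ w, Φ z) ∈ v := SetRel.symm v h2
  exact hvu ⟨Φ z, h3, h1⟩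

end CConv

/-! ### Limits of holomorphic maps to the sphere: Weierstrass and Hurwitz -/

section Limits

variable {ι : Type*} {𝒰 : Filter ι} [𝒰.NeBot] {φ : ι → ℂ → Sphere} {Φ : ℂ → Sphere}
  {U : Set ℂ} {z₀ : ℂ}

theorem CConvAt.continuousOn (hU : IsOpen U) (h : ∀ z ∈ U, CConvAt 𝒰 φ Φ z) :
    ContinuousOn Φ U := fun z hz =>
  ((h z hz).continuousAt (by
    filter_upwards [hU.mem_nhds hz] with w hw using (h w hw).tendsto)).continuousWithinAt

/-- Around a point of continuous convergence, the maps can be read in the chart at the limit. -/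
theorem exists_ball_chart (hU : IsOpen U) (hz₀ : z₀ ∈ U) (hφ : ∀ᶠ i in 𝒰, HolomorphicOn (φ i) U)
    (h : ∀ z ∈ U, CConvAt 𝒰 φ Φ z) :
    ∃ r > 0, Metric.ball z₀ r ⊆ U ∧ (∀ z ∈ Metric.ball z₀ r, Φ z ∈ range (param (Φ z₀))) ∧
      (∀ᶠ i in 𝒰, ∀ z ∈ Metric.ball z₀ r, φ i z ∈ range (param (Φ z₀))) ∧
      (∀ᶠ i in 𝒰, DifferentiableOn ℂ (fun z => chart (Φ z₀) (φ i z)) (Metric.ball z₀ r)) ∧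
      ∀ z ∈ Metric.ball z₀ r,
        CConvAt 𝒰 (fun i z => chart (Φ z₀) (φ i z)) (fun z => chart (Φ z₀) (Φ z)) z := by
  have hp : range (param (Φ z₀)) ∈ 𝓝 (Φ z₀) := by simpa using range_param_mem_nhds (Φ z₀) 0
  obtain ⟨V, hV, W, hW, hVW⟩ := mem_prod_iff.1 (h z₀ hz₀ hp)
  have hc := (CConvAt.continuousOn hU h).continuousAt (hU.mem_nhds hz₀)
  obtain ⟨r, hr, hrs⟩ := Metric.mem_nhds_iff.1
    (inter_mem (hU.mem_nhds hz₀) (inter_mem hW (hc hp)))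
  have hV' : ∀ᶠ i in 𝒰, ∀ z ∈ Metric.ball z₀ r, φ i z ∈ range (param (Φ z₀)) := by
    filter_upwards [hV] with i hi z hz
    exact hVW (mk_mem_prod hi (hrs hz).2.1)
  refine ⟨r, hr, fun z hz => (hrs hz).1, fun z hz => (hrs hz).2.2, hV', ?_, fun z hz => ?_⟩
  · filter_upwards [hV', hφ] with i hi hi' z hz
    exact (hi'.differentiableAt_chart (hrs hz).1 (hi z hz)).differentiableWithinAt
  · obtain ⟨w, hw⟩ := (hrs hz).2.2
    refine CConvAt.comp (ψ := fun _ => chart (Φ z₀)) (cconvAt_const ?_) (h z (hrs hz).1)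
    rw [← hw]
    exact continuousAt_chart_param _ _

theorem CConvAt.differentiableOn {k : ι → ℂ → ℂ} {K : ℂ → ℂ} (hU : IsOpen U)
    (hk : ∀ᶠ i in 𝒰, DifferentiableOn ℂ (k i) U) (h : ∀ z ∈ U, CConvAt 𝒰 k K z) :
    DifferentiableOn ℂ K U :=
  (CConvAt.tendstoLocallyUniformlyOn hU h).differentiableOn hk hU

theorem CConvAt.holomorphicOn (hU : IsOpen U) (hφ : ∀ᶠ i in 𝒰, HolomorphicOn (φ i) U)
    (h : ∀ z ∈ U, CConvAt 𝒰 φ Φ z) : HolomorphicOn Φ U := by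
  refine HolomorphicOn.of_chart hU (CConvAt.continuousOn hU h) fun z hz => ?_
  obtain ⟨r, hr, -, -, -, h1, h2⟩ := exists_ball_chart hU hz hφ h
  exact (CConvAt.differentiableOn Metric.isOpen_ball h1 h2).differentiableAt
    (Metric.ball_mem_nhds z hr)

/-- The open mapping estimate requires that `f` is not locally constant at the centre. The lower
bound on the circle already ensures this, since otherwise the identity theorem would make `f` equal
to `f z₀` up to the circle. -/
theorem ball_subset_image_closedBall_of_le {f : ℂ → ℂ} {z₀ : ℂ} {r ε : ℝ} (hr : 0 < r)
    (hε : 0 < ε) (h : DiffContOnCl ℂ f (Metric.ball z₀ r))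
    (hf : ∀ z ∈ Metric.sphere z₀ r, ε ≤ ‖f z - f z₀‖) :
    Metric.ball (f z₀) (ε / 2) ⊆ f '' Metric.closedBall z₀ r := by
  refine h.ball_subset_image_closedBall hr hf fun hcon => ?_
  simp only [not_not] at hcon
  have h1 : EqOn f (fun _ => f z₀) (Metric.ball z₀ r) :=
    (h.differentiableOn.analyticOnNhd Metric.isOpen_ball).eqOn_of_preconnected_of_eventuallyEq
      analyticOnNhd_const (convex_ball z₀ r).isPreconnected (Metric.mem_ball_self hr) hcon
  have h2 : EqOn f (fun _ => f z₀) (closure (Metric.ball z₀ r)) :=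
    h1.of_subset_closure h.continuousOn continuousOn_const subset_closure subset_rfl
  obtain ⟨z, hz⟩ := NormedSpace.sphere_nonempty (x := z₀) (E := ℂ).2 hr.le
  have h3 := hf z hz
  rw [h2 (by rw [closure_ball _ hr.ne']; exact Metric.sphere_subset_closedBall hz)] at h3
  simp only [sub_self, norm_zero] at h3
  linarith

/-- Hurwitz: near a point where the limit is not locally constant, the approximating maps take
every value close to the limiting one. -/
theorem CConvAt.eventually_exists_eq (hU : IsOpen U) (hz₀ : z₀ ∈ U)
    (hφ : ∀ᶠ i in 𝒰, HolomorphicOn (φ i) U) (h : ∀ z ∈ U, CConvAt 𝒰 φ Φ z)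
    (hΦ : ¬ ∀ᶠ z in 𝓝 z₀, Φ z = Φ z₀) {y : ι → Sphere} (hy : Tendsto y 𝒰 (𝓝 (Φ z₀)))
    {r : ℝ} (hr : 0 < r) : ∀ᶠ i in 𝒰, ∃ z ∈ Metric.ball z₀ r, z ∈ U ∧ φ i z = y i := by
  obtain ⟨R, hR, hRU, hRΦ, hRφ, hd, hcc⟩ := exists_ball_chart hU hz₀ hφ h
  set p := Φ z₀ with hp
  set K : ℂ → ℂ := fun z => chart p (Φ z) with hK
  have hKd : DifferentiableOn ℂ K (Metric.ball z₀ R) :=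
    CConvAt.differentiableOn Metric.isOpen_ball hd hcc
  have hK0 : K z₀ = 0 := by simp [hK, ← hp]
  have han : AnalyticAt ℂ K z₀ := hKd.analyticAt (Metric.ball_mem_nhds z₀ hR)
  have hne : ∀ᶠ z in 𝓝[≠] z₀, K z ≠ 0 := by
    refine han.eventually_eq_zero_or_eventually_ne_zero.resolve_left fun h0 => hΦ ?_
    filter_upwards [h0, Metric.ball_mem_nhds z₀ hR] with z hz hz'
    rw [← param_chart_of_mem (hRΦ z hz')]
    change param p (K z) = p
    rw [hz, param_zero]
  obtain ⟨s, hs, hsne⟩ := Metric.mem_nhdsWithin_iff.1 hne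
  -- The circle of radius `t` avoids the zeros of `K`, so `‖K‖` has a positive minimum `ε` on it.
  set t := min (min r R) s / 2 with ht
  have ht0 : 0 < t := by positivity
  have htr : t < r := by
    have : min (min r R) s ≤ r := (min_le_left _ _).trans (min_le_left _ _)
    have := lt_min (lt_min hr hR) hs
    linarith
  have htR : t < R := by
    have : min (min r R) s ≤ R := (min_le_left _ _).trans (min_le_right _ _)
    have := lt_min (lt_min hr hR) hs
    linarith
  have hts : t < s := by
    have : min (min r R) s ≤ s := min_le_right _ _
    have := lt_min (lt_min hr hR) hs
    linarith
  have hsub : Metric.closedBall z₀ t ⊆ Metric.ball z₀ R := Metric.closedBall_subset_ball htR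
  have hKc : ContinuousOn K (Metric.closedBall z₀ t) := hKd.continuousOn.mono hsub
  obtain ⟨ε, hε, hεK⟩ : ∃ ε > 0, ∀ z ∈ Metric.sphere z₀ t, ε ≤ ‖K z‖ := by
    obtain ⟨x, hx, hxm⟩ := (isCompact_sphere z₀ t).exists_isMinOn
      (NormedSpace.sphere_nonempty.2 ht0.le)
      (hKc.mono Metric.sphere_subset_closedBall).norm
    refine ⟨‖K x‖, norm_pos_iff.2 (hsne ⟨?_, ?_⟩), fun z hz => hxm hz⟩
    · rw [Metric.mem_ball, Metric.mem_sphere.1 hx]; exact hts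
    · rintro rfl
      rw [Metric.mem_sphere, dist_self] at hx
      exact ht0.ne hx
  -- Budget: with errors below `ε / 8` the approximating map keeps distance at least `ε / 2` from
  -- its central value on the circle, hence covers the disk of radius `ε / 4` about that value. The
  -- target `y i` is closer than `ε / 8 + ε / 8`.
  have hunif : ∀ᶠ i in 𝒰, ∀ z ∈ Metric.closedBall z₀ t, dist (K z) (chart p (φ i z)) < ε / 8 :=
    Metric.tendstoUniformlyOn_iff.1
      ((tendstoLocallyUniformlyOn_iff_tendstoUniformlyOn_of_compact
        (isCompact_closedBall z₀ t)).1
        ((CConvAt.tendstoLocallyUniformlyOn Metric.isOpen_ball hcc).mono hsub)) _ (by positivity)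
  have hy1 : ∀ᶠ i in 𝒰, y i ∈ range (param p) :=
    hy (by simpa using range_param_mem_nhds p 0)
  have hy2 : ∀ᶠ i in 𝒰, dist (chart p (y i)) 0 < ε / 8 :=
    ((tendsto_chart p).comp hy).eventually (Metric.ball_mem_nhds 0 (by positivity))
  filter_upwards [hunif, hy1, hy2, hd, hRφ] with i h1 h2 h3 h4 h5
  have h0 := h1 z₀ (Metric.mem_closedBall_self ht0.le)
  rw [hK0] at h0
  have hball := ball_subset_image_closedBall_of_le (f := fun z => chart p (φ i z)) (ε := ε / 2)
    ht0 (by positivity)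
    (by
      refine DifferentiableOn.diffContOnCl ?_
      rw [closure_ball _ ht0.ne']
      exact h4.mono hsub) (by
      intro z hz
      have := h1 z (Metric.sphere_subset_closedBall hz)
      have h6 := hεK z hz
      rw [dist_eq_norm] at this
      rw [dist_comm, dist_zero_right] at h0
      have h7 : ‖K z‖ ≤ ‖K z - chart p (φ i z)‖ + (‖chart p (φ i z) - chart p (φ i z₀)‖
          + ‖chart p (φ i z₀)‖) := by
        calc ‖K z‖ = ‖(K z - chart p (φ i z)) + ((chart p (φ i z) - chart p (φ i z₀))
          + chart p (φ i z₀))‖ := by congr 1; ring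
          _ ≤ _ := (norm_add_le _ _).trans (by gcongr; exact norm_add_le _ _)
      linarith)
  have hmem : chart p (y i) ∈ Metric.ball (chart p (φ i z₀)) (ε / 2 / 2) := by
    rw [Metric.mem_ball]
    calc dist (chart p (y i)) (chart p (φ i z₀))
        ≤ dist (chart p (y i)) 0 + dist 0 (chart p (φ i z₀)) := dist_triangle _ _ _
      _ < ε / 8 + ε / 8 := add_lt_add h3 h0
      _ = ε / 2 / 2 := by ring
  obtain ⟨z, hz, hzy⟩ := hball hmem
  refine ⟨z, Metric.closedBall_subset_ball htr hz, hRU (hsub hz), ?_⟩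
  rw [← param_chart_of_mem (h5 z (hsub hz)), ← param_chart_of_mem h2]
  exact congrArg (param p) hzy

/-- A limit of injective holomorphic maps is injective or constant. -/
theorem CConvAt.injOn_or_eq_const (hU : IsOpen U) (hUc : IsPreconnected U)
    (hφ : ∀ᶠ i in 𝒰, HolomorphicOn (φ i) U) (hinj : ∀ᶠ i in 𝒰, InjOn (φ i) U)
    (h : ∀ z ∈ U, CConvAt 𝒰 φ Φ z) : InjOn Φ U ∨ ∃ c, ∀ z ∈ U, Φ z = c := by
  by_cases hc : ∃ z ∈ U, ∀ᶠ w in 𝓝 z, Φ w = Φ z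
  · obtain ⟨z, hz, hzc⟩ := hc
    exact Or.inr ⟨_, (CConvAt.holomorphicOn hU hφ h).eqOn_const hU hUc hz hzc⟩
  · push Not at hc
    left
    intro z hz w hw hzw
    by_contra hne
    have hpos : 0 < dist z w / 2 := by
      have := dist_pos.2 hne
      positivity
    -- By Hurwitz the value `Φ z` is taken by `φ i` in two disjoint balls, around `z` and around
    -- `w`.
    have h1 := CConvAt.eventually_exists_eq hU hz hφ h (not_eventually.2 (hc z hz))
      (tendsto_const_nhds (x := Φ z)) hpos
    have h2 := CConvAt.eventually_exists_eq hU hw hφ h (not_eventually.2 (hc w hw))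
      (y := fun _ => Φ z) (by rw [hzw]; exact tendsto_const_nhds) hpos
    obtain ⟨i, ⟨z', hz', hzU, hz1⟩, ⟨w', hw', hwU, hw1⟩, hi⟩ := (h1.and (h2.and hinj)).exists
    have := hi hzU hwU (hz1.trans hw1.symm)
    subst this
    have h3 := dist_triangle_right z w z'
    rw [Metric.mem_ball, dist_comm] at hz' hw'
    linarith

theorem InjOn.not_eventually_eq {X : Type*} {Φ : ℂ → X} {U : Set ℂ} {z₀ : ℂ} (hU : IsOpen U)
    (hz₀ : z₀ ∈ U) (h : InjOn Φ U) : ¬ ∀ᶠ z in 𝓝 z₀, Φ z = Φ z₀ := by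
  intro hc
  have h1 : ∀ᶠ z in 𝓝[≠] z₀, z = z₀ := by
    filter_upwards [(hc.and (hU.mem_nhds hz₀)).filter_mono nhdsWithin_le_nhds] with z hz
    exact h hz.2 hz₀ hz.1
  obtain ⟨z, hz, hz'⟩ := (h1.and self_mem_nhdsWithin).exists
  exact hz' hz

end Limits

/-! ### Normality of injective maps omitting two values -/

/-- A Bloch-type estimate: a holomorphic function on a disk whose image is disjoint from its
translate by `2πi` has small derivative at the centre. -/
theorem norm_deriv_mul_le_of_ne_add {l : ℂ → ℂ} {c : ℂ} {r : ℝ} (hr : 0 < r)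
    (hl : DifferentiableOn ℂ l (Metric.ball c r))
    (h : ∀ z ∈ Metric.ball c r, ∀ w ∈ Metric.ball c r, l z ≠ l w + 2 * Real.pi * Complex.I) :
    ‖deriv l c‖ * r ≤ 256 * Real.pi := by
  set ρ := r / 2 with hρ
  have hρ0 : 0 < ρ := by positivity
  have hsub : Metric.closedBall c ρ ⊆ Metric.ball c r :=
    Metric.closedBall_subset_ball (by linarith)
  have hl' : DifferentiableOn ℂ (deriv l) (Metric.ball c r) := hl.deriv Metric.isOpen_ball
  -- Landau's trick: where the derivative weighted by the distance to the circle is maximal, the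
  -- derivative at most doubles on a ball of radius `s`. There `l` is nearly affine and covers a
  -- disk of size comparable to `s * A`.
  obtain ⟨z₀, hz₀, hmax⟩ := (isCompact_closedBall c ρ).exists_isMaxOn
    ⟨c, Metric.mem_closedBall_self hρ0.le⟩
    (f := fun z => (ρ - dist z c) * ‖deriv l z‖)
    ((continuousOn_const.sub (continuous_id.dist continuous_const).continuousOn).mul
      (hl'.continuousOn.mono hsub).norm)
  set A := ‖deriv l z₀‖ with hA
  have hmax' : ∀ z ∈ Metric.closedBall c ρ, (ρ - dist z c) * ‖deriv l z‖
      ≤ (ρ - dist z₀ c) * A := fun z hz => hmax hz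
  have hc := hmax' c (Metric.mem_closedBall_self hρ0.le)
  rw [dist_self, sub_zero] at hc
  -- The disk covered below has radius `(ρ - dist z₀ c) * A / 64`; it contains a translate by `2πi`
  -- as soon as this exceeds `2π`. The choice `ρ = r / 2` doubles the constant in the conclusion.
  suffices hM : (ρ - dist z₀ c) * A ≤ 128 * Real.pi by
    have : ρ * ‖deriv l c‖ ≤ 128 * Real.pi := hc.trans hM
    rw [hρ] at this
    linarith
  by_contra! hM
  have hMpos : 0 < (ρ - dist z₀ c) * A := lt_trans (by positivity) hM
  have hApos : 0 < A := by
    refine lt_of_le_of_ne (norm_nonneg _) fun h0 => ?_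
    rw [← h0, mul_zero] at hMpos
    exact lt_irrefl _ hMpos
  have hd : 0 < ρ - dist z₀ c := pos_of_mul_pos_left hMpos hApos.le
  set s := (ρ - dist z₀ c) / 2 with hs
  have hs0 : 0 < s := by positivity
  have hball : ∀ z ∈ Metric.ball z₀ s, z ∈ Metric.closedBall c ρ ∧ s ≤ ρ - dist z c := by
    intro z hz
    have h1 := dist_triangle z z₀ c
    rw [Metric.mem_ball] at hz
    have h2 : dist z c ≤ ρ - s := by rw [hs] at hz ⊢; linarith
    exact ⟨Metric.mem_closedBall.2 (by linarith), by linarith⟩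
  have hbound : ∀ z ∈ Metric.ball z₀ s, ‖deriv l z‖ ≤ 2 * A := by
    intro z hz
    have h1 := hmax' z (hball z hz).1
    have h2 : s * ‖deriv l z‖ ≤ (ρ - dist z c) * ‖deriv l z‖ :=
      mul_le_mul_of_nonneg_right (hball z hz).2 (norm_nonneg _)
    have h3 : s * ‖deriv l z‖ ≤ s * (2 * A) := by
      refine (h2.trans h1).trans_eq ?_
      rw [hs]; ring
    exact le_of_mul_le_mul_left h3 hs0
  have hsubs : Metric.ball z₀ s ⊆ Metric.ball c r := fun z hz => hsub (hball z hz).1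
  have hschwarz : ∀ z ∈ Metric.ball z₀ s, ‖deriv l z - deriv l z₀‖ ≤ 4 * A / s * dist z z₀ := by
    intro z hz
    have := Complex.dist_le_div_mul_dist_of_mapsTo_ball (hl'.mono hsubs) (R₂ := 4 * A) (by
      intro w hw
      rw [Metric.mem_closedBall, dist_eq_norm]
      have := norm_sub_le (deriv l w) (deriv l z₀)
      have := hbound w hw
      linarith) hz
    rwa [dist_eq_norm] at this
  -- By the Schwarz lemma the derivative then differs from its central value by at most `A / 2`,
  -- which keeps the image of the circle of radius `t` at distance at least `A / 2 * t` from `l z₀`.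
  set t := s / 8 with ht
  have ht0 : 0 < t := by positivity
  have hts : Metric.closedBall z₀ t ⊆ Metric.ball z₀ s :=
    Metric.closedBall_subset_ball (by linarith)
  have hlin : ∀ z ∈ Metric.closedBall z₀ t,
      ‖(l z - deriv l z₀ * z) - (l z₀ - deriv l z₀ * z₀)‖ ≤ A / 2 * ‖z - z₀‖ := by
    intro z hz
    refine (convex_closedBall z₀ t).norm_image_sub_le_of_norm_hasDerivWithin_le
      (f := fun z => l z - deriv l z₀ * z) (f' := fun z => deriv l z - deriv l z₀)
      (fun w hw => ?_) (fun w hw => ?_) (Metric.mem_closedBall_self ht0.le) hz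
    · have h1 : HasDerivAt l (deriv l w) w :=
        (hl.differentiableAt (Metric.isOpen_ball.mem_nhds (hsubs (hts hw)))).hasDerivAt
      have h2 := h1.sub ((hasDerivAt_id w).const_mul (deriv l z₀))
      rw [mul_one] at h2
      exact h2.hasDerivWithinAt
    · refine (hschwarz w (hts hw)).trans ?_
      rw [Metric.mem_closedBall] at hw
      calc 4 * A / s * dist w z₀ ≤ 4 * A / s * t := by gcongr
        _ = A / 2 := by rw [ht]; field_simp; norm_num
  have hcover := ball_subset_image_closedBall_of_le (f := l) (z₀ := z₀) (ε := A / 2 * t) ht0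
    (by positivity) (by
      refine DifferentiableOn.diffContOnCl ?_
      rw [closure_ball _ ht0.ne']
      exact hl.mono (hts.trans hsubs)) (by
      intro z hz
      have h1 := hlin z (Metric.sphere_subset_closedBall hz)
      have h2 : ‖z - z₀‖ = t := by rw [← dist_eq_norm]; exact hz
      have h3 : ‖deriv l z₀ * (z - z₀)‖ = A * t := by rw [norm_mul, h2]
      have h4 : ‖deriv l z₀ * (z - z₀)‖ ≤ ‖l z - l z₀‖
          + ‖(l z - deriv l z₀ * z) - (l z₀ - deriv l z₀ * z₀)‖ := by
        calc ‖deriv l z₀ * (z - z₀)‖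
            = ‖(l z - l z₀) - ((l z - deriv l z₀ * z) - (l z₀ - deriv l z₀ * z₀))‖ := by
              congr 1; ring
          _ ≤ _ := norm_sub_le _ _
      rw [h2] at h1
      linarith)
  have hmem : l z₀ + 2 * Real.pi * Complex.I ∈ Metric.ball (l z₀) (A / 2 * t / 2) := by
    rw [Metric.mem_ball, dist_eq_norm, add_sub_cancel_left]
    have : ‖(2 * Real.pi * Complex.I : ℂ)‖ = 2 * Real.pi := by
      simp [abs_of_pos Real.pi_pos]
    rw [this, ht, hs]
    linarith
  obtain ⟨z, hz, hzl⟩ := hcover hmem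
  exact h z (hsubs (hts hz)) z₀ (hsubs (Metric.mem_ball_self hs0)) hzl

/-- A primitive of `k' / k` exists on the disk; normalised at the centre it makes `k * exp (-l)` the
constant `1`. -/
theorem exists_log_ball {k : ℂ → ℂ} {c : ℂ} {r : ℝ} (hr : 0 < r)
    (hk : DifferentiableOn ℂ k (Metric.ball c r)) (h0 : ∀ z ∈ Metric.ball c r, k z ≠ 0) :
    ∃ l : ℂ → ℂ, DifferentiableOn ℂ l (Metric.ball c r) ∧
      ∀ z ∈ Metric.ball c r, Complex.exp (l z) = k z := by
  have hq : DifferentiableOn ℂ (fun z => deriv k z / k z) (Metric.ball c r) :=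
    (hk.deriv Metric.isOpen_ball).div hk h0
  obtain ⟨l, hlc, hl⟩ := hq.isExactOn_ball.with_val_at c (Complex.log (k c))
  have hld : DifferentiableOn ℂ l (Metric.ball c r) := fun z hz =>
    (hl z hz).differentiableAt.differentiableWithinAt
  refine ⟨l, hld, fun z hz => ?_⟩
  have hconst : ∀ w ∈ Metric.ball c r, HasDerivAt (fun z => k z * Complex.exp (-l z)) 0 w := by
    intro w hw
    have h1 : HasDerivAt k (deriv k w) w :=
      (hk.differentiableAt (Metric.isOpen_ball.mem_nhds hw)).hasDerivAt
    have h2 := h1.mul (hl w hw).neg.cexp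
    refine h2.congr_deriv ?_
    have h3 : k w * (deriv k w / k w) = deriv k w := mul_div_cancel₀ _ (h0 w hw)
    linear_combination -Complex.exp (-l w) * h3
  have hdiff : DifferentiableOn ℂ (fun z => k z * Complex.exp (-l z)) (Metric.ball c r) :=
    fun w hw => (hconst w hw).differentiableAt.differentiableWithinAt
  have := Metric.isOpen_ball.is_const_of_deriv_eq_zero (convex_ball c r).isPreconnected hdiff
    (fun w hw => (hconst w hw).deriv) hz (Metric.mem_ball_self hr)
  simp only [hlc] at this
  rw [Complex.exp_neg, Complex.exp_neg, Complex.exp_log (h0 c (Metric.mem_ball_self hr)),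
    mul_inv_cancel₀ (h0 c (Metric.mem_ball_self hr))] at this
  have h3 := Complex.exp_ne_zero (l z)
  field_simp at this
  exact this.symm

/-- Distortion of injective nonvanishing functions near the centre of a disk. -/
theorem exists_radius_ratio {r ε : ℝ} (hr : 0 < r) (hε : 0 < ε) :
    ∃ ρ > 0, ∀ (c : ℂ) (k : ℂ → ℂ), DifferentiableOn ℂ k (Metric.ball c r) →
      InjOn k (Metric.ball c r) → (∀ z ∈ Metric.ball c r, k z ≠ 0) →
      ∀ z ∈ Metric.ball c ρ, ‖k z / k c - 1‖ < ε := by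
  have hexp : ∀ᶠ x : ℂ in 𝓝 0, ‖Complex.exp x - 1‖ < ε := by
    have : Tendsto (fun x : ℂ => ‖Complex.exp x - 1‖) (𝓝 0) (𝓝 0) := by
      have h : Continuous fun x : ℂ => ‖Complex.exp x - 1‖ := by fun_prop
      simpa using h.tendsto 0
    exact this.eventually_lt_const hε
  obtain ⟨δ, hδ, hδε⟩ := Metric.eventually_nhds_iff_ball.1 hexp
  set C := 512 * Real.pi / r with hC
  have hC0 : 0 < C := by positivity
  refine ⟨min (r / 2) (δ / C), by positivity, fun c k hk hinj h0 z hz => ?_⟩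
  obtain ⟨l, hl, hlk⟩ := exists_log_ball hr hk h0
  have hhalf : ∀ w ∈ Metric.ball c (r / 2), Metric.ball w (r / 2) ⊆ Metric.ball c r := by
    intro w hw x hx
    rw [Metric.mem_ball] at *
    linarith [dist_triangle x w c]
  have hder : ∀ w ∈ Metric.ball c (r / 2), ‖deriv l w‖ ≤ C := by
    intro w hw
    -- If two values of `l` differed by `2πi`, then `k` would take the same value at both points,
    -- and injectivity would identify them. The constant `C` is `256π` divided by the radius `r /
    -- 2`.
    have := norm_deriv_mul_le_of_ne_add (l := l) (c := w) (r := r / 2) (by positivity)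
      (hl.mono (hhalf w hw)) (fun x hx y hy hxy => by
        have hx' := hhalf w hw hx
        have hy' := hhalf w hw hy
        have h1 : k x = k y := by
          rw [← hlk x hx', ← hlk y hy', hxy, Complex.exp_add, Complex.exp_two_pi_mul_I, mul_one]
        have h2 := hinj hx' hy' h1
        subst h2
        exact Complex.two_pi_I_ne_zero (left_eq_add.1 hxy))
    rw [hC, le_div_iff₀ hr]
    linarith
  have hz2 : z ∈ Metric.ball c (r / 2) := Metric.ball_subset_ball (min_le_left _ _) hz
  have hmv : ‖l z - l c‖ ≤ C * ‖z - c‖ :=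
    (convex_ball c (r / 2)).norm_image_sub_le_of_norm_deriv_le
      (fun w hw => hl.differentiableAt (Metric.isOpen_ball.mem_nhds
        (Metric.ball_subset_ball (by linarith) hw)))
      hder (Metric.mem_ball_self (by positivity)) hz2
  have hlt : ‖l z - l c‖ < δ := by
    refine hmv.trans_lt ?_
    have h1 : ‖z - c‖ < δ / C := by
      rw [← dist_eq_norm]
      exact lt_of_lt_of_le hz (min_le_right _ _)
    calc C * ‖z - c‖ < C * (δ / C) := by gcongr
      _ = δ := by field_simp
  have hzr : z ∈ Metric.ball c r := Metric.ball_subset_ball (by linarith) hz2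
  rw [← hlk z hzr, ← hlk c (Metric.mem_ball_self hr), ← Complex.exp_sub]
  exact hδε _ (by simpa using hlt)

/-! ### Möbius coordinates with prescribed zero and pole -/

/-- The determinant of two vectors of `ℂ²`. -/
def det2 (v w : ℂ × ℂ) : ℂ := v.1 * w.2 - v.2 * w.1

theorem prod_ne_zero_iff {v : ℂ × ℂ} : v ≠ 0 ↔ v.1 ≠ 0 ∨ v.2 ≠ 0 := by
  rw [Ne, Prod.ext_iff, not_and_or]; rfl

theorem det2_ne_zero_iff {v w : ℂ × ℂ} (hv : v ≠ 0) (hw : w ≠ 0) :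
    det2 v w ≠ 0 ↔ hmk v.1 v.2 ≠ hmk w.1 w.2 := by
  rw [Ne, Ne, hmk_eq_iff (prod_ne_zero_iff.1 hv) (prod_ne_zero_iff.1 hw), det2, sub_eq_zero]

open Classical in
/-- Homogeneous coordinates of `param p w`, depending continuously on `w`. -/
def homLift (p : Sphere) (w : ℂ) : ℂ × ℂ :=
  if p = OnePoint.infty then (1, w) else (w + coord p, 1)

theorem homLift_ne_zero (p : Sphere) (w : ℂ) : homLift p w ≠ 0 := by
  unfold homLift
  rw [prod_ne_zero_iff]
  split_ifs <;> simp

theorem hmk_homLift (p : Sphere) (w : ℂ) : hmk (homLift p w).1 (homLift p w).2 = param p w := by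
  unfold homLift param
  split_ifs
  · exact hmk_one_left w
  · exact hmk_one _

theorem continuous_homLift (p : Sphere) : Continuous (homLift p) := by
  unfold homLift
  split_ifs <;> fun_prop

theorem differentiable_homLift_fst (p : Sphere) : Differentiable ℂ fun w => (homLift p w).1 := by
  unfold homLift
  split_ifs <;> simp only <;> fun_prop

theorem differentiable_homLift_snd (p : Sphere) : Differentiable ℂ fun w => (homLift p w).2 := by
  unfold homLift
  split_ifs <;> simp only <;> fun_prop

theorem exists_det2_homLift (p : Sphere) :
    ∃ s : ℂ, s ≠ 0 ∧ ∀ a b, det2 (homLift p a) (homLift p b) = s * (a - b) := by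
  unfold homLift det2
  split_ifs
  · exact ⟨-1, by simp, fun a b => by ring⟩
  · exact ⟨1, by simp, fun a b => by ring⟩

/-- The Möbius coordinate with zero at `[P]` and pole at `[Q]`. -/
def mobius (P Q : ℂ × ℂ) (x : Sphere) : ℂ :=
  det2 P (homLift x 0) / det2 Q (homLift x 0)

/-- The coordinate is defined through one particular lift of the point; any other lift is a scalar
multiple of it, and the scalar cancels. -/
theorem mobius_hmk {P Q v : ℂ × ℂ} (hv : v ≠ 0) :
    mobius P Q (hmk v.1 v.2) = det2 P v / det2 Q v := by
  obtain ⟨c, hc, hcv⟩ : ∃ c : ℂ, c ≠ 0 ∧ homLift (hmk v.1 v.2) 0 = c • v := by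
    rw [prod_ne_zero_iff] at hv
    rcases eq_or_ne v.2 0 with h | h
    · have h1 : v.1 ≠ 0 := by simpa [h] using hv
      refine ⟨v.1⁻¹, inv_ne_zero h1, ?_⟩
      rw [h, hmk_zero]
      ext <;> simp [homLift, h1, h]
    · refine ⟨v.2⁻¹, inv_ne_zero h, ?_⟩
      rw [hmk_of_ne h]
      ext <;> simp [homLift, h, div_eq_inv_mul]
  have h1 : ∀ P, det2 P (c • v) = c * det2 P v := by
    intro P; simp only [det2, Prod.smul_fst, Prod.smul_snd, smul_eq_mul]; ring
  rw [mobius, hcv, h1, h1, mul_div_mul_left _ _ hc]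

theorem mobius_param {P Q : ℂ × ℂ} (p : Sphere) (w : ℂ) :
    mobius P Q (param p w) = det2 P (homLift p w) / det2 Q (homLift p w) := by
  rw [← hmk_homLift, mobius_hmk (homLift_ne_zero p w)]

theorem exists_eq_hmk (x : Sphere) : ∃ v : ℂ × ℂ, v ≠ 0 ∧ x = hmk v.1 v.2 :=
  ⟨homLift x 0, homLift_ne_zero x 0, by rw [hmk_homLift, param_zero]⟩

theorem mobius_ne_zero {P Q : ℂ × ℂ} (hP : P ≠ 0) (hQ : Q ≠ 0) {x : Sphere}
    (hxP : x ≠ hmk P.1 P.2) (hxQ : x ≠ hmk Q.1 Q.2) : mobius P Q x ≠ 0 := by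
  obtain ⟨v, hv, rfl⟩ := exists_eq_hmk x
  rw [mobius_hmk hv]
  exact div_ne_zero ((det2_ne_zero_iff hP hv).2 hxP.symm) ((det2_ne_zero_iff hQ hv).2 hxQ.symm)

/-- Plücker relation: `det2 P v * det2 Q w - det2 P w * det2 Q v = det2 P Q * det2 v w`. -/
theorem mobius_inj {P Q : ℂ × ℂ} (hQ : Q ≠ 0) (hPQ : det2 P Q ≠ 0)
    {x y : Sphere} (hx : x ≠ hmk Q.1 Q.2) (hy : y ≠ hmk Q.1 Q.2)
    (h : mobius P Q x = mobius P Q y) : x = y := by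
  obtain ⟨v, hv, rfl⟩ := exists_eq_hmk x
  obtain ⟨w, hw, rfl⟩ := exists_eq_hmk y
  rw [mobius_hmk hv, mobius_hmk hw, div_eq_div_iff ((det2_ne_zero_iff hQ hv).2 hx.symm)
    ((det2_ne_zero_iff hQ hw).2 hy.symm)] at h
  by_contra hne
  refine mul_ne_zero hPQ ((det2_ne_zero_iff hv hw).2 hne) ?_
  rw [← sub_eq_zero] at h
  rw [← h]
  unfold det2
  ring

theorem HolomorphicOn.mobius {φ : ℂ → Sphere} {U : Set ℂ} (hU : IsOpen U) (h : HolomorphicOn φ U)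
    {P Q : ℂ × ℂ} (hQ : Q ≠ 0) (hφ : ∀ z ∈ U, φ z ≠ hmk Q.1 Q.2) :
    DifferentiableOn ℂ (fun z => mobius P Q (φ z)) U := by
  intro z hz
  refine DifferentiableAt.differentiableWithinAt ?_
  have hr : range (param (φ z)) ∈ 𝓝 (φ z) := by simpa using range_param_mem_nhds (φ z) 0
  have hd : DifferentiableAt ℂ (fun w => chart (φ z) (φ w)) z :=
    h.differentiableAt_chart hz (mem_of_mem_nhds hr)
  have h1 := (differentiable_homLift_fst (φ z) _).comp z hd
  have h2 := (differentiable_homLift_snd (φ z) _).comp z hd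
  have hne : det2 Q (homLift (φ z) (chart (φ z) (φ z))) ≠ 0 := by
    rw [det2_ne_zero_iff hQ (homLift_ne_zero _ _), hmk_homLift, chart_self, param_zero]
    exact (hφ z hz).symm
  have h3 : DifferentiableAt ℂ (fun w => det2 P (homLift (φ z) (chart (φ z) (φ w)))
      / det2 Q (homLift (φ z) (chart (φ z) (φ w)))) z :=
    ((h2.const_mul P.1).sub (h1.const_mul P.2)).div ((h2.const_mul Q.1).sub (h1.const_mul Q.2)) hne
  refine h3.congr_of_eventuallyEq ?_
  filter_upwards [(h.1.continuousAt (hU.mem_nhds hz)) hr] with w hw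
  rw [← mobius_param, param_chart_of_mem hw]

section

variable {ι : Type*} {𝒰 : Filter ι} {c : ℂ} {r : ℝ}

theorem tendsto_ratio {k : ι → ℂ → ℂ} (hr : 0 < r)
    (hk : ∀ᶠ i in 𝒰, DifferentiableOn ℂ (k i) (Metric.ball c r))
    (hinj : ∀ᶠ i in 𝒰, InjOn (k i) (Metric.ball c r))
    (h0 : ∀ᶠ i in 𝒰, ∀ z ∈ Metric.ball c r, k i z ≠ 0) :
    Tendsto (fun q : ι × ℂ => k q.1 q.2 / k q.1 c) (𝒰 ×ˢ 𝓝 c) (𝓝 1) := by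
  rw [Metric.tendsto_nhds]
  intro ε hε
  obtain ⟨ρ, hρ, h⟩ := exists_radius_ratio hr hε
  filter_upwards [prod_mem_prod (hk.and (hinj.and h0)) (Metric.ball_mem_nhds c hρ)] with q hq
  rw [dist_eq_norm]
  exact h c (k q.1) hq.1.1 hq.1.2.1 hq.1.2.2 _ hq.2

/-- Injective holomorphic maps of a disk omitting two values that stay apart converge
continuously at the centre as soon as they converge there. -/
theorem tendsto_of_omits {φ : ι → ℂ → Sphere} (hr : 0 < r)
    (hφ : ∀ᶠ i in 𝒰, HolomorphicOn (φ i) (Metric.ball c r))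
    (hinj : ∀ᶠ i in 𝒰, InjOn (φ i) (Metric.ball c r)) {p q : ι → Sphere} {p₀ q₀ : Sphere}
    (hp : Tendsto p 𝒰 (𝓝 p₀)) (hq : Tendsto q 𝒰 (𝓝 q₀)) (hne : p₀ ≠ q₀)
    (homit : ∀ᶠ i in 𝒰, ∀ z ∈ Metric.ball c r, φ i z ≠ p i ∧ φ i z ≠ q i) {y : Sphere}
    (hy : Tendsto (fun i => φ i c) 𝒰 (𝓝 y)) :
    Tendsto (fun x : ι × ℂ => φ x.1 x.2) (𝒰 ×ˢ 𝓝 c) (𝓝 y) := by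
  set P : ι → ℂ × ℂ := fun i => homLift p₀ (chart p₀ (p i)) with hP
  set Q : ι → ℂ × ℂ := fun i => homLift q₀ (chart q₀ (q i)) with hQ
  set v : ι → ℂ × ℂ := fun i => homLift y (chart y (φ i c)) with hv
  have hPt : Tendsto P 𝒰 (𝓝 (homLift p₀ 0)) :=
    ((continuous_homLift p₀).tendsto 0).comp ((tendsto_chart p₀).comp hp)
  have hQt : Tendsto Q 𝒰 (𝓝 (homLift q₀ 0)) :=
    ((continuous_homLift q₀).tendsto 0).comp ((tendsto_chart q₀).comp hq)
  have hvt : Tendsto v 𝒰 (𝓝 (homLift y 0)) :=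
    ((continuous_homLift y).tendsto 0).comp ((tendsto_chart y).comp hy)
  have hPp : ∀ᶠ i in 𝒰, hmk (P i).1 (P i).2 = p i := by
    filter_upwards [hp.eventually (eventually_param_chart p₀)] with i hi
    rw [hP, hmk_homLift, hi]
  have hQq : ∀ᶠ i in 𝒰, hmk (Q i).1 (Q i).2 = q i := by
    filter_upwards [hq.eventually (eventually_param_chart q₀)] with i hi
    rw [hQ, hmk_homLift, hi]
  have hvc : ∀ᶠ i in 𝒰, hmk (v i).1 (v i).2 = φ i c := by
    filter_upwards [hy.eventually (eventually_param_chart y)] with i hi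
    rw [hv, hmk_homLift, hi]
  have hdet : Continuous fun x : (ℂ × ℂ) × ℂ × ℂ => det2 x.1 x.2 := by unfold det2; fun_prop
  have hdet0 : det2 (homLift p₀ 0) (homLift q₀ 0) ≠ 0 := by
    rw [det2_ne_zero_iff (homLift_ne_zero _ _) (homLift_ne_zero _ _), hmk_homLift, hmk_homLift,
      param_zero, param_zero]
    exact hne
  have hPQ : ∀ᶠ i in 𝒰, det2 (P i) (Q i) ≠ 0 :=
    ((hdet.tendsto _).comp (hPt.prodMk_nhds hQt)).eventually_ne hdet0
  have hgood : ∀ᶠ i in 𝒰, (∀ z ∈ Metric.ball c r, φ i z ≠ hmk (P i).1 (P i).2 ∧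
      φ i z ≠ hmk (Q i).1 (Q i).2) := by
    filter_upwards [homit, hPp, hQq] with i h1 h2 h3
    rw [h2, h3]
    exact h1
  have hratio : Tendsto (fun x : ι × ℂ => mobius (P x.1) (Q x.1) (φ x.1 x.2)
      / mobius (P x.1) (Q x.1) (φ x.1 c)) (𝒰 ×ˢ 𝓝 c) (𝓝 1) := by
    refine tendsto_ratio (k := fun i z => mobius (P i) (Q i) (φ i z)) hr ?_ ?_ ?_
    · filter_upwards [hφ, hgood] with i h1 h2
      exact h1.mobius Metric.isOpen_ball (homLift_ne_zero _ _) fun z hz => (h2 z hz).2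
    · filter_upwards [hinj, hgood, hPQ] with i h1 h2 h3 z hz w hw hzw
      exact h1 hz hw (mobius_inj (homLift_ne_zero _ _) h3 (h2 z hz).2 (h2 w hw).2 hzw)
    · filter_upwards [hgood] with i h2 z hz
      exact mobius_ne_zero (homLift_ne_zero _ _) (homLift_ne_zero _ _) (h2 z hz).1 (h2 z hz).2
  set ratio : ι × ℂ → ℂ := fun x => mobius (P x.1) (Q x.1) (φ x.1 x.2)
      / mobius (P x.1) (Q x.1) (φ x.1 c) with hratiodef
  -- Cramer's rule: `u x` is a homogeneous lift of `φ x.1 x.2`, recovered from its Möbius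
  -- coordinate, which is `ratio x` times that of the centre. It has no denominators depending on
  -- the limit point, so it still works when `y` is `p₀` or `q₀`.
  set u : ι × ℂ → ℂ × ℂ := fun x =>
    (-det2 (Q x.1) (v x.1)) • P x.1 + (det2 (P x.1) (v x.1) * ratio x) • Q x.1 with hu
  have hut : Tendsto u (𝒰 ×ˢ 𝓝 c)
      (𝓝 (det2 (homLift p₀ 0) (homLift q₀ 0) • homLift y 0)) := by
    have e1 : Tendsto (fun x : ι × ℂ => P x.1) (𝒰 ×ˢ 𝓝 c) (𝓝 (homLift p₀ 0)) :=
      hPt.comp tendsto_fst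
    have e2 : Tendsto (fun x : ι × ℂ => Q x.1) (𝒰 ×ˢ 𝓝 c) (𝓝 (homLift q₀ 0)) :=
      hQt.comp tendsto_fst
    have e3 : Tendsto (fun x : ι × ℂ => v x.1) (𝒰 ×ˢ 𝓝 c) (𝓝 (homLift y 0)) :=
      hvt.comp tendsto_fst
    have e4 := (hdet.tendsto _).comp (e2.prodMk_nhds e3)
    have e5 := (hdet.tendsto _).comp (e1.prodMk_nhds e3)
    have e6 := (e4.neg.smul e1).add ((e5.mul hratio).smul e2)
    have e7 : det2 (homLift p₀ 0) (homLift q₀ 0) • homLift y 0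
        = -det2 (homLift q₀ 0) (homLift y 0) • homLift p₀ 0
          + (det2 (homLift p₀ 0) (homLift y 0) * 1) • homLift q₀ 0 := by
      ext <;> simp [det2] <;> ring
    rw [e7]
    exact e6
  have hlim := tendsto_hmk ((continuous_fst.tendsto _).comp hut) ((continuous_snd.tendsto _).comp hut)
    (by
      rw [← prod_ne_zero_iff]
      exact smul_ne_zero hdet0 (homLift_ne_zero _ _))
  simp only [Prod.smul_fst, Prod.smul_snd, smul_eq_mul] at hlim
  rw [hmk_mul hdet0, hmk_homLift, param_zero] at hlim
  refine hlim.congr' ?_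
  filter_upwards [prod_mem_prod (hgood.and (hPQ.and hvc)) (Metric.ball_mem_nhds c hr)] with x hx
  obtain ⟨⟨hx1, hx2, hx3⟩, hx4⟩ := hx
  obtain ⟨w, hw, hφw⟩ := exists_eq_hmk (φ x.1 x.2)
  have hv0 : v x.1 ≠ 0 := homLift_ne_zero _ _
  have hP0 : P x.1 ≠ 0 := homLift_ne_zero _ _
  have hQ0 : Q x.1 ≠ 0 := homLift_ne_zero _ _
  have g1 := hx1 x.2 hx4
  have g2 := hx1 c (Metric.mem_ball_self hr)
  rw [hφw] at g1
  rw [← hx3] at g2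
  have d1 := (det2_ne_zero_iff hP0 hw).2 g1.1.symm
  have d2 := (det2_ne_zero_iff hQ0 hw).2 g1.2.symm
  have d3 := (det2_ne_zero_iff hP0 hv0).2 g2.1.symm
  have d4 := (det2_ne_zero_iff hQ0 hv0).2 g2.2.symm
  have hrx : ratio x = (det2 (P x.1) w / det2 (Q x.1) w)
      / (det2 (P x.1) (v x.1) / det2 (Q x.1) (v x.1)) := by
    simp only [hratiodef]
    rw [hφw, ← hx3, mobius_hmk hw, mobius_hmk hv0]
  have huw : u x = (det2 (Q x.1) (v x.1) / det2 (Q x.1) w * det2 (P x.1) (Q x.1)) • w := by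
    have e1 : det2 (P x.1) (v x.1) * ratio x
        = det2 (Q x.1) (v x.1) / det2 (Q x.1) w * det2 (P x.1) w := by
      rw [hrx]; field_simp
    have e2 : -det2 (Q x.1) (v x.1)
        = det2 (Q x.1) (v x.1) / det2 (Q x.1) w * (-det2 (Q x.1) w) := by field_simp
    simp only [hu]
    rw [e1, e2, mul_smul, mul_smul, mul_smul, ← smul_add]
    congr 1
    ext <;> simp [det2] <;> ring
  simp only [Function.comp_apply, huw, Prod.smul_fst, Prod.smul_snd, smul_eq_mul]
  rw [hmk_mul (mul_ne_zero (div_ne_zero d4 d2) hx2), hφw]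

end

/-! ### Holomorphic self-maps of the sphere -/

/-- A holomorphic self-map of the sphere. -/
structure IsHolSelf (f : Sphere → Sphere) : Prop where
  continuous : Continuous f
  holomorphicOn_param : ∀ p, HolomorphicOn (fun w => f (param p w)) univ

theorem IsHolSelf.comp_holomorphicOn {f : Sphere → Sphere} (hf : IsHolSelf f) {φ : ℂ → Sphere}
    {U : Set ℂ} (hU : IsOpen U) (hφ : HolomorphicOn φ U) : HolomorphicOn (fun z => f (φ z)) U := by
  refine HolomorphicOn.of_chart hU (hf.continuous.comp_continuousOn hφ.1) fun z hz => ?_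
  have hr : range (param (φ z)) ∈ 𝓝 (φ z) := by simpa using range_param_mem_nhds (φ z) 0
  have h1 : DifferentiableAt ℂ (fun w => chart (φ z) (φ w)) z :=
    hφ.differentiableAt_chart hz (mem_of_mem_nhds hr)
  have h2 : DifferentiableAt ℂ (fun w => chart (f (φ z)) (f (param (φ z) w)))
      (chart (φ z) (φ z)) := by
    refine (hf.holomorphicOn_param (φ z)).differentiableAt_chart (mem_univ _) ⟨0, ?_⟩
    rw [param_zero, chart_self, param_zero]
  refine (h2.comp z h1).congr_of_eventuallyEq ?_
  filter_upwards [(hφ.1.continuousAt (hU.mem_nhds hz)) hr] with w hw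
  simp only [Function.comp_apply, param_chart_of_mem hw]

theorem IsHolSelf.comp {f g : Sphere → Sphere} (hf : IsHolSelf f) (hg : IsHolSelf g) :
    IsHolSelf (fun x => f (g x)) :=
  ⟨hf.continuous.comp hg.continuous, fun p =>
    hf.comp_holomorphicOn isOpen_univ (hg.holomorphicOn_param p)⟩

theorem isHolSelf_id : IsHolSelf id :=
  ⟨continuous_id, fun p => holomorphicOn_param isOpen_univ differentiableOn_id p⟩

theorem IsHolSelf.iterate {f : Sphere → Sphere} (hf : IsHolSelf f) (m : ℕ) : IsHolSelf f^[m] := by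
  induction m with
  | zero => exact isHolSelf_id
  | succ m ih =>
    rw [Function.iterate_succ]
    exact ih.comp hf

/-- If `f i` converges to `g` continuously and `g` fixes `p`, then in the coordinate at `p` the
`f i` are uniformly strictly differentiable, with the multiplier of `g` as derivative. -/
theorem exists_ball_strict_diff {ι : Type*} {𝒰 : Filter ι} [𝒰.NeBot] {f : ι → Sphere → Sphere}
    {g : Sphere → Sphere} (hf : ∀ᶠ i in 𝒰, IsHolSelf (f i)) (hfg : ∀ x, CConvAt 𝒰 f g x)
    {p : Sphere} (hp : g p = p) {ε : ℝ} (hε : 0 < ε) :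
    ∃ ρ > 0, ∀ᶠ i in 𝒰, ∀ x ∈ Metric.ball (0 : ℂ) ρ, f i (param p x) ∈ range (param p) ∧
      ∀ y ∈ Metric.ball (0 : ℂ) ρ, ‖chart p (f i (param p x)) - chart p (f i (param p y))
        - multiplier g p * (x - y)‖ ≤ ε * ‖x - y‖ := by
  have hφ : ∀ᶠ i in 𝒰, HolomorphicOn (fun w => f i (param p w)) univ :=
    hf.mono fun i hi => hi.holomorphicOn_param p
  have hcc : ∀ z ∈ (univ : Set ℂ),
      CConvAt 𝒰 (fun i w => f i (param p w)) (fun w => g (param p w)) z := fun z _ =>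
    (hfg _).comp (φ := fun _ => param p) (cconvAt_const (continuous_param p).continuousAt)
  obtain ⟨R, hR, -, -, hran, hd, hk⟩ := exists_ball_chart isOpen_univ (mem_univ 0) hφ hcc
  simp only [param_zero, hp] at hran hd hk
  set K : ℂ → ℂ := fun w => chart p (g (param p w)) with hK
  have hlu := CConvAt.tendstoLocallyUniformlyOn Metric.isOpen_ball hk
  have hKd : DifferentiableOn ℂ K (Metric.ball 0 R) := hlu.differentiableOn hd Metric.isOpen_ball
  have hK' : ContinuousAt (deriv K) 0 := ((hKd.deriv Metric.isOpen_ball).differentiableAt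
    (Metric.ball_mem_nhds 0 hR)).continuousAt
  obtain ⟨s, hs, hsK⟩ := Metric.eventually_nhds_iff_ball.1
    (hK'.eventually (Metric.ball_mem_nhds _ (half_pos hε)))
  have hmul : deriv K 0 = multiplier g p := (multiplier_eq g p).symm
  set ρ := min s (R / 2) with hρ
  have hρ0 : 0 < ρ := by positivity
  have hρR : ρ ≤ R / 2 := min_le_right _ _
  have hsub : Metric.closedBall (0 : ℂ) ρ ⊆ Metric.ball 0 R :=
    Metric.closedBall_subset_ball (by linarith)
  have hunif := Metric.tendstoUniformlyOn_iff.1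
    ((tendstoLocallyUniformlyOn_iff_tendstoUniformlyOn_of_compact (isCompact_closedBall 0 ρ)).1
      ((hlu.deriv hd Metric.isOpen_ball).mono hsub)) _ (half_pos hε)
  refine ⟨ρ, hρ0, ?_⟩
  filter_upwards [hran, hd, hunif] with i h1 h2 h3 x hx
  refine ⟨h1 x (hsub (Metric.ball_subset_closedBall hx)), fun y hy => ?_⟩
  have hder : ∀ w ∈ Metric.ball (0 : ℂ) ρ,
      ‖deriv (fun w => chart p (f i (param p w))) w - multiplier g p‖ ≤ ε := by
    intro w hw
    have e1 := h3 w (Metric.ball_subset_closedBall hw)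
    have e2 := hsK w (Metric.ball_subset_ball (min_le_left _ _) hw)
    rw [hmul] at e2
    rw [← dist_eq_norm]
    refine (dist_triangle_left _ _ (deriv K w)).trans ?_
    change dist (deriv K w) (deriv (fun w => chart p (f i (param p w))) w) < ε / 2 at e1
    linarith
  have hmv := (convex_ball (0 : ℂ) ρ).norm_image_sub_le_of_norm_hasDerivWithin_le
    (f := fun w => chart p (f i (param p w)) - multiplier g p * w)
    (f' := fun w => deriv (fun w => chart p (f i (param p w))) w - multiplier g p) (C := ε)
    (fun w hw => by
      have e1 := (h2.differentiableAt (Metric.isOpen_ball.mem_nhds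
        (hsub (Metric.ball_subset_closedBall hw)))).hasDerivAt
      have e2 := e1.sub ((hasDerivAt_id w).const_mul (multiplier g p))
      rw [mul_one] at e2
      exact e2.hasDerivWithinAt) hder hy hx
  refine le_trans (le_of_eq ?_) hmv
  congr 1
  ring

/-! ### Rational maps -/

theorem ratMap_coe (r : RatFunc ℂ) (z : ℂ) :
    ratMap r (z : Sphere) = hmk (r.num.eval z) (r.denom.eval z) := rfl

theorem ratMap_infty (r : RatFunc ℂ) : ratMap r OnePoint.infty
    = hmk (r.num.coeff (ratDegree r)) (r.denom.coeff (ratDegree r)) := rfl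

theorem eval_reflect {N : ℕ} {P : Polynomial ℂ} (hP : P.natDegree ≤ N) {w : ℂ} (hw : w ≠ 0) :
    (P.reflect N).eval w = w ^ N * P.eval w⁻¹ := by
  have : Invertible (w⁻¹) := invertibleOfNonzero (inv_ne_zero hw)
  have h := Polynomial.eval₂_reflect_mul_pow (RingHom.id ℂ) w⁻¹ N P hP
  rw [invOf_eq_inv, inv_inv] at h
  rw [Polynomial.eval, Polynomial.eval, ← h, inv_pow]
  field_simp

theorem eval_reflect_zero (N : ℕ) (P : Polynomial ℂ) : (P.reflect N).eval 0 = P.coeff N := by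
  rw [← Polynomial.coeff_zero_eq_eval_zero, Polynomial.coeff_reflect, Polynomial.revAt_zero]

theorem natDegree_num_le (r : RatFunc ℂ) : r.num.natDegree ≤ ratDegree r := le_max_left _ _

theorem natDegree_denom_le (r : RatFunc ℂ) : r.denom.natDegree ≤ ratDegree r := le_max_right _ _

/-- Multiplying both polynomials by `w ^ ratDegree r` clears the denominators. The constant terms of
the reflected polynomials are the coefficients used for the value at `∞`. -/
theorem ratMap_inversion (r : RatFunc ℂ) (w : ℂ) : ratMap r (inversion (w : Sphere))
    = hmk ((r.num.reflect (ratDegree r)).eval w) ((r.denom.reflect (ratDegree r)).eval w) := by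
  rcases eq_or_ne w 0 with rfl | hw
  · rw [inversion_zero, ratMap_infty, eval_reflect_zero, eval_reflect_zero]
  · rw [inversion_coe hw, ratMap_coe, eval_reflect (natDegree_num_le r) hw,
      eval_reflect (natDegree_denom_le r) hw, hmk_mul (pow_ne_zero _ hw)]

theorem eval_num_or_eval_denom (r : RatFunc ℂ) (z : ℂ) :
    r.num.eval z ≠ 0 ∨ r.denom.eval z ≠ 0 := by
  by_contra! h
  obtain ⟨a, b, hab⟩ := r.isCoprime_num_denom
  have := congrArg (Polynomial.eval z) hab
  simp [h.1, h.2] at this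

theorem coeff_num_or_coeff_denom (r : RatFunc ℂ) :
    r.num.coeff (ratDegree r) ≠ 0 ∨ r.denom.coeff (ratDegree r) ≠ 0 := by
  rcases le_or_gt r.num.natDegree r.denom.natDegree with h | h
  · right
    rw [ratDegree, max_eq_right h, Polynomial.coeff_natDegree]
    exact Polynomial.leadingCoeff_ne_zero.2 r.denom_ne_zero
  · left
    rw [ratDegree, max_eq_left h.le, Polynomial.coeff_natDegree]
    refine Polynomial.leadingCoeff_ne_zero.2 fun h0 => ?_
    rw [h0] at h
    simp at h

theorem reflect_num_or_reflect_denom (r : RatFunc ℂ) (w : ℂ) :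
    (r.num.reflect (ratDegree r)).eval w ≠ 0 ∨ (r.denom.reflect (ratDegree r)).eval w ≠ 0 := by
  rcases eq_or_ne w 0 with rfl | hw
  · rw [eval_reflect_zero, eval_reflect_zero]
    exact coeff_num_or_coeff_denom r
  · rw [eval_reflect (natDegree_num_le r) hw, eval_reflect (natDegree_denom_le r) hw]
    exact (eval_num_or_eval_denom r w⁻¹).imp (mul_ne_zero (pow_ne_zero _ hw))
      (mul_ne_zero (pow_ne_zero _ hw))

theorem isHolSelf_ratMap (r : RatFunc ℂ) : IsHolSelf (ratMap r) := by
  have h0 : HolomorphicOn (fun z : ℂ => ratMap r (z : Sphere)) univ :=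
    holomorphicOn_hmk isOpen_univ r.num.differentiable.differentiableOn
      r.denom.differentiable.differentiableOn fun z _ => eval_num_or_eval_denom r z
  have h1 : HolomorphicOn (fun z : ℂ => ratMap r (inversion (z : Sphere))) univ := by
    simp only [ratMap_inversion]
    exact holomorphicOn_hmk isOpen_univ (Polynomial.differentiable _).differentiableOn
      (Polynomial.differentiable _).differentiableOn fun z _ => reflect_num_or_reflect_denom r z
  have hp : ∀ p, HolomorphicOn (fun w => ratMap r (param p w)) univ := by
    intro p
    unfold param
    split_ifs
    · exact h1
    · exact h0.comp_differentiableOn (k := fun w => w + coord p) isOpen_univ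
        (by fun_prop) (mapsTo_univ _ _)
  refine ⟨continuous_iff_continuousAt.2 fun p => ?_, hp⟩
  have h2 := (hp p).1.continuousAt (x := 0) univ_mem
  rw [ContinuousAt, ← param_zero p, ← map_param_nhds, tendsto_map'_iff]
  simpa [ContinuousAt, Function.comp_def] using h2

theorem denom_eq_one_of_dvd_num {r : RatFunc ℂ} (h : r.denom ∣ r.num) : r.denom = 1 :=
  r.monic_denom.eq_one_of_isUnit (r.isCoprime_num_denom.isUnit_of_dvd' h dvd_rfl)

theorem sphere_finite_of_coe {s : Set Sphere} {P : Polynomial ℂ} (hP : P ≠ 0)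
    (h : ∀ z : ℂ, (z : Sphere) ∈ s → P.eval z = 0) : s.Finite := by
  have hfin : ({OnePoint.infty} ∪ (fun z : ℂ => (z : Sphere)) '' {z | P.IsRoot z}).Finite :=
    (finite_singleton _).union ((Polynomial.finite_setOfPred_isRoot hP).image _)
  refine hfin.subset fun x hx => ?_
  induction x using OnePoint.rec with
  | infty => exact Or.inl rfl
  | coe z => exact Or.inr ⟨z, h z hx, rfl⟩

/-- A finite fixed point is a zero of `r.num - X * r.denom`. In lowest terms this polynomial
vanishes identically only for the identity map, which has degree one. -/
theorem finite_fixed_ratMap {r : RatFunc ℂ} (hr : 2 ≤ ratDegree r) :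
    {x | ratMap r x = x}.Finite := by
  refine sphere_finite_of_coe (P := r.num - Polynomial.X * r.denom) (fun h => ?_) fun z hz => ?_
  · rw [sub_eq_zero] at h
    have h1 := denom_eq_one_of_dvd_num ⟨Polynomial.X, h.trans (mul_comm _ _)⟩
    rw [ratDegree, h, h1] at hr
    simp at hr
  · have hz' : ratMap r (z : Sphere) = hmk z 1 := by rw [hmk_one]; exact hz
    rw [ratMap_coe, hmk_eq_iff (eval_num_or_eval_denom r z) (Or.inr one_ne_zero)] at hz'
    simp only [Polynomial.eval_sub, Polynomial.eval_mul, Polynomial.eval_X]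
    linear_combination hz'

theorem finite_fiber_ratMap {r : RatFunc ℂ} (hr : 1 ≤ ratDegree r) (c : Sphere) :
    {x | ratMap r x = c}.Finite := by
  obtain ⟨v, hv, rfl⟩ := exists_eq_hmk c
  have hv' := prod_ne_zero_iff.1 hv
  refine sphere_finite_of_coe (P := Polynomial.C v.2 * r.num - Polynomial.C v.1 * r.denom)
    (fun h => ?_) fun z hz => ?_
  · rw [sub_eq_zero] at h
    rcases eq_or_ne v.2 0 with h2 | h2
    · have h1 : v.1 ≠ 0 := by simpa [h2] using hv'
      rw [h2, Polynomial.C_0, zero_mul] at h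
      have := mul_ne_zero (Polynomial.C_ne_zero.2 h1) r.denom_ne_zero
      exact this h.symm
    · have hnum : r.num = r.denom * Polynomial.C (v.1 / v.2) := by
        have h3 : Polynomial.C v.2⁻¹ * Polynomial.C v.2 = 1 := by
          rw [← Polynomial.C_mul, inv_mul_cancel₀ h2, Polynomial.C_1]
        calc r.num = Polynomial.C v.2⁻¹ * (Polynomial.C v.2 * r.num) := by
              rw [← mul_assoc, h3, one_mul]
          _ = _ := by rw [h, div_eq_mul_inv, Polynomial.C_mul]; ring
      have h4 := denom_eq_one_of_dvd_num ⟨_, hnum⟩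
      rw [ratDegree, hnum, h4] at hr
      simp at hr
  · have hz' : ratMap r (z : Sphere) = hmk v.1 v.2 := hz
    rw [ratMap_coe, hmk_eq_iff (eval_num_or_eval_denom r z) hv'] at hz'
    simp only [Polynomial.eval_sub, Polynomial.eval_mul, Polynomial.eval_C]
    linear_combination hz'

theorem deriv_sq_mul {F T : ℂ → ℂ} {a b : ℂ} (hT : ContinuousAt T a)
    (hF : ∀ᶠ w in 𝓝 a, F w = b + (w - a) ^ 2 * T w) : deriv F a = 0 := by
  have h : HasDerivAt (fun w => b + (w - a) ^ 2 * T w) 0 a := by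
    rw [hasDerivAt_iff_tendsto_slope]
    have h1 : Tendsto (fun w => (w - a) * T w) (𝓝[≠] a) (𝓝 0) := by
      have : ContinuousAt (fun w => (w - a) * T w) a := by fun_prop
      simpa using this.tendsto.mono_left nhdsWithin_le_nhds
    refine h1.congr' ?_
    filter_upwards [self_mem_nhdsWithin] with w hw
    have hw' : w - a ≠ 0 := sub_ne_zero.2 hw
    simp only [slope_def_field]
    field_simp
    ring
  exact (h.congr_of_eventuallyEq hF).deriv

/-- A fixed point with non-zero multiplier has another preimage. -/
theorem exists_ne_ratMap_eq {r : RatFunc ℂ} (hr : 2 ≤ ratDegree r) {p : Sphere}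
    (hp : ratMap r p = p) (hmul : multiplier (ratMap r) p ≠ 0) : ∃ q ≠ p, ratMap r q = p := by
  -- A fixed point that is its own only preimage is totally ramified; as the degree is at least two,
  -- the derivative there vanishes.
  by_contra! hcon
  have honly : ∀ q, ratMap r q = p → q = p := fun q hq => by
    by_contra h
    exact hcon q h hq
  refine hmul ?_
  induction p using OnePoint.rec with
  | infty =>
    have hroot : ∀ z, r.denom.eval z ≠ 0 := fun z hz => by
      have := honly (z : Sphere) (by rw [ratMap_coe, hz, hmk_zero])
      simp at this
    have hden : r.denom = 1 := by
      have : r.denom.degree = 0 := by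
        by_contra hdeg
        obtain ⟨z, hz⟩ := IsAlgClosed.exists_root r.denom hdeg
        exact hroot z hz
      exact (Polynomial.Monic.natDegree_eq_zero r.monic_denom).1
        (Polynomial.natDegree_eq_of_degree_eq_some this)
    obtain ⟨d, hd⟩ : ∃ d, ratDegree r = d + 2 := ⟨ratDegree r - 2, by omega⟩
    set N := r.num.reflect (ratDegree r) with hN
    have hN0 : N.eval 0 ≠ 0 := by
      rw [hN, eval_reflect_zero]
      refine (coeff_num_or_coeff_denom r).resolve_right (not_not.2 ?_)
      rw [hden, hd, Polynomial.coeff_one]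
      simp
    rw [multiplier, if_pos rfl]
    refine deriv_sq_mul (b := 0) (T := fun w => w ^ d / N.eval w) ?_ ?_
    · exact ContinuousAt.div (by fun_prop) N.continuous.continuousAt hN0
    · filter_upwards [N.continuous.continuousAt.eventually_ne hN0] with w hw
      rw [ratMap_inversion, inversion_hmk (Or.inl hw), hmk_of_ne hw, coord_coe, hden,
        Polynomial.reflect_one, hd]
      simp only [Polynomial.eval_pow, Polynomial.eval_X]
      ring
  | coe a =>
    set R := r.num - Polynomial.C a * r.denom with hR
    have hden : r.denom.eval a ≠ 0 := fun h => by
      rw [ratMap_coe, h, hmk_zero] at hp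
      simp at hp
    have hroot : ∀ z, R.eval z = 0 → z = a := fun z hz => by
      rw [hR] at hz
      simp only [Polynomial.eval_sub, Polynomial.eval_mul, Polynomial.eval_C] at hz
      have := honly (z : Sphere) (by
        rw [ratMap_coe, ← hmk_one a, hmk_eq_iff (eval_num_or_eval_denom r z) (Or.inr one_ne_zero)]
        linear_combination hz)
      simpa using this
    have hRa : R.eval a = 0 := by
      have := hp
      rw [ratMap_coe, ← hmk_one a,
        hmk_eq_iff (eval_num_or_eval_denom r a) (Or.inr one_ne_zero)] at this
      rw [hR]
      simp only [Polynomial.eval_sub, Polynomial.eval_mul, Polynomial.eval_C]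
      linear_combination this
    -- Because `∞` is not a preimage, `R` keeps the full degree. Dividing by `X - a` thus leaves a
    -- non-constant `S`, whose root can only be `a` again.
    have hcoeff : R.coeff (ratDegree r) ≠ 0 := by
      rw [hR, Polynomial.coeff_sub, Polynomial.coeff_C_mul]
      intro h
      have := honly OnePoint.infty (by
        rw [ratMap_infty, ← hmk_one a,
          hmk_eq_iff (coeff_num_or_coeff_denom r) (Or.inr one_ne_zero)]
        linear_combination h)
      simp at this
    have hR0 : R ≠ 0 := fun h => hcoeff (by rw [h, Polynomial.coeff_zero])
    have hdeg : 2 ≤ R.natDegree := hr.trans (Polynomial.le_natDegree_of_ne_zero hcoeff)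
    obtain ⟨S, hS⟩ := Polynomial.dvd_iff_isRoot.2 hRa
    have hS0 : S ≠ 0 := fun h => hR0 (by rw [hS, h, mul_zero])
    have hSdeg : S.degree ≠ 0 := fun h => by
      rw [hS, Polynomial.natDegree_mul (Polynomial.X_sub_C_ne_zero a) hS0,
        Polynomial.natDegree_X_sub_C, Polynomial.natDegree_eq_zero_iff_degree_le_zero.2 h.le] at hdeg
      omega
    obtain ⟨b, hb⟩ := IsAlgClosed.exists_root S hSdeg
    have hba : b = a := hroot b (by rw [hS, Polynomial.eval_mul, hb.eq_zero, mul_zero])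
    rw [hba] at hb
    obtain ⟨T, hT⟩ := Polynomial.dvd_iff_isRoot.2 hb
    rw [multiplier, if_neg (OnePoint.coe_ne_infty a)]
    refine deriv_sq_mul (a := coord (a : Sphere)) (b := a)
      (T := fun w => T.eval w / r.denom.eval w) ?_ ?_
    · exact T.continuous.continuousAt.div r.denom.continuous.continuousAt hden
    · filter_upwards [r.denom.continuous.continuousAt.eventually_ne hden] with w hw
      rw [ratMap_coe, hmk_of_ne hw, coord_coe]
      have h1 : r.num.eval w - a * r.denom.eval w = (w - a) * ((w - a) * T.eval w) := by
        have := congrArg (Polynomial.eval w) (hS.trans (by rw [hT]))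
        rw [hR] at this
        simpa using this
      rw [coord_coe]
      field_simp
      linear_combination h1

/-! ### Strip maps and their limits -/

/-- `h` conjugates the translation of the standard strip to `f`. -/
structure IsStripMap (L : ℝ) (f : Sphere → Sphere) (h : ℂ → Sphere) : Prop where
  holomorphicOn : HolomorphicOn h (standardStrip L)
  injOn : InjOn h (standardStrip L)
  map_eq : ∀ z ∈ standardStrip L, f (h z) = h (z - 1)

section Strip

variable {L : ℝ}

theorem isOpen_strip : IsOpen (standardStrip L) :=
  isOpen_lt (by fun_prop) continuous_const

theorem convex_strip : Convex ℝ (standardStrip L) := by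
  have h : standardStrip L = Complex.im ⁻¹' Ioo (-L) L := by
    ext z
    simp only [standardStrip, mem_ofPred_eq, mem_preimage, mem_Ioo, abs_lt]
  rw [h]
  exact (convex_Ioo (-L) L).linear_preimage Complex.imLm

theorem isPreconnected_strip : IsPreconnected (standardStrip L) := convex_strip.isPreconnected

theorem add_real_mem_strip {z : ℂ} (hz : z ∈ standardStrip L) (x : ℝ) :
    z + x ∈ standardStrip L := by
  simpa [standardStrip] using hz

theorem sub_one_mem_strip {z : ℂ} (hz : z ∈ standardStrip L) : z - 1 ∈ standardStrip L := by
  simpa [standardStrip] using hz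

theorem real_mem_strip (hL : 0 < L) (x : ℝ) : (x : ℂ) ∈ standardStrip L := by
  simpa [standardStrip] using hL

theorem zero_mem_strip (hL : 0 < L) : (0 : ℂ) ∈ standardStrip L := by
  simpa [standardStrip] using hL

end Strip

namespace IsStripMap

variable {L : ℝ} {f : Sphere → Sphere} {h : ℂ → Sphere}

/-- The translation has no fixed point. Assuming only that the image of `x` is fixed also covers
preimages of fixed points, which serve as second omitted values when both ends have the same limit.
-/
theorem ne_of_map_map_eq (hh : IsStripMap L f h) {x : Sphere} (hx : f (f x) = f x) {z : ℂ}
    (hz : z ∈ standardStrip L) : h z ≠ x := by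
  rintro rfl
  rw [hh.map_eq z hz, hh.map_eq _ (sub_one_mem_strip hz)] at hx
  have := hh.injOn (sub_one_mem_strip (sub_one_mem_strip hz)) (sub_one_mem_strip hz) hx
  simp at this

theorem map_ne (hh : IsStripMap L f h) {z : ℂ} (hz : z ∈ standardStrip L) : f (h z) ≠ h z :=
  fun hx => hh.ne_of_map_map_eq (congrArg f hx) hz rfl

theorem iterate_eq (hh : IsStripMap L f h) (m : ℕ) {z : ℂ} (hz : z ∈ standardStrip L) :
    f^[m] (h z) = h (z - m) := by
  induction m generalizing z with
  | zero => simp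
  | succ m ih =>
    rw [Function.iterate_succ_apply, hh.map_eq z hz, ih (sub_one_mem_strip hz)]
    congr 1
    push_cast
    ring

theorem continuous_real (hh : IsStripMap L f h) (hL : 0 < L) : Continuous fun x : ℝ => h x :=
  hh.holomorphicOn.1.comp_continuous Complex.continuous_ofReal (real_mem_strip hL)

theorem comp_add (hh : IsStripMap L f h) (x : ℝ) : IsStripMap L f (fun z => h (z + x)) where
  holomorphicOn := hh.holomorphicOn.comp_differentiableOn isOpen_strip (by fun_prop)
    fun _ hz => add_real_mem_strip hz x
  injOn z hz w hw hzw := by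
    simpa using hh.injOn (add_real_mem_strip hz x) (add_real_mem_strip hw x) hzw
  map_eq z hz := by
    rw [hh.map_eq _ (add_real_mem_strip hz x)]
    congr 1
    ring

end IsStripMap

/-- A family of strip maps for self-maps `f i` which converge to `g`, together with two sequences
of points, with distinct limits, which the strips omit for dynamical reasons. -/
structure StripFamily {ι : Type*} (L : ℝ) (𝒰 : Filter ι) (f : ι → Sphere → Sphere)
    (g : Sphere → Sphere) (h : ι → ℂ → Sphere) : Prop where
  pos : 0 < L
  conv : ∀ x, CConvAt 𝒰 f g x
  strip : ∀ i, IsStripMap L (f i) (h i)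
  omits : ∃ (p q : ι → Sphere) (p₀ q₀ : Sphere), p₀ ≠ q₀ ∧ Tendsto p 𝒰 (𝓝 p₀) ∧
    Tendsto q 𝒰 (𝓝 q₀) ∧ (∀ᶠ i in 𝒰, f i (f i (p i)) = f i (p i)) ∧
    ∀ᶠ i in 𝒰, f i (f i (q i)) = f i (q i)

/-- The limit along the ultrafilter `𝒰` of the strip maps `h i`, re-centred at `t i`. -/
def limMap {ι : Type*} (𝒰 : Ultrafilter ι) (h : ι → ℂ → Sphere) (t : ι → ℝ) (z : ℂ) : Sphere :=
  (Ultrafilter.map (fun i => h i (z + t i)) 𝒰).lim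

theorem tendsto_limMap {ι : Type*} (𝒰 : Ultrafilter ι) (h : ι → ℂ → Sphere) (t : ι → ℝ) (z : ℂ) :
    Tendsto (fun i => h i (z + t i)) 𝒰 (𝓝 (limMap 𝒰 h t z)) :=
  Ultrafilter.le_nhds_lim (Ultrafilter.map (fun i => h i (z + t i)) 𝒰)

theorem tendsto_limMap_zero {ι : Type*} (𝒰 : Ultrafilter ι) (h : ι → ℂ → Sphere) (t : ι → ℝ) :
    Tendsto (fun i => h i (t i)) 𝒰 (𝓝 (limMap 𝒰 h t 0)) := by
  simpa using tendsto_limMap 𝒰 h t 0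

namespace StripFamily

variable {ι : Type*} {L : ℝ} {𝒰 : Ultrafilter ι} {f : ι → Sphere → Sphere}
  {g : Sphere → Sphere} {h : ι → ℂ → Sphere}

/-- Normality of the re-centred strips on each small disk. Pointwise limits come for free from
compactness along the ultrafilter, so no subsequences are extracted. -/
theorem cconvAt (hF : StripFamily L 𝒰 f g h) (t : ι → ℝ) {z : ℂ} (hz : z ∈ standardStrip L) :
    CConvAt (𝒰 : Filter ι) (fun i w => h i (w + t i)) (limMap 𝒰 h t) z := by
  obtain ⟨p, q, p₀, q₀, hne, hp, hq, hp', hq'⟩ := hF.omits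
  obtain ⟨r, hr, hrs⟩ := Metric.isOpen_iff.1 isOpen_strip z hz
  refine tendsto_of_omits (φ := fun i w => h i (w + t i)) hr (Eventually.of_forall fun i => ?_)
    (Eventually.of_forall fun i => ?_) hp hq hne ?_ (tendsto_limMap 𝒰 h t z)
  · exact ((hF.strip i).comp_add (t i)).holomorphicOn.mono hrs
  · exact ((hF.strip i).comp_add (t i)).injOn.mono hrs
  · filter_upwards [hp', hq'] with i h1 h2 w hw
    exact ⟨((hF.strip i).comp_add (t i)).ne_of_map_map_eq h1 (hrs hw),
      ((hF.strip i).comp_add (t i)).ne_of_map_map_eq h2 (hrs hw)⟩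

theorem map_limMap (hF : StripFamily L 𝒰 f g h) (t : ι → ℝ) {z : ℂ} (hz : z ∈ standardStrip L) :
    g (limMap 𝒰 h t z) = limMap 𝒰 h t (z - 1) := by
  have h1 := (hF.conv (limMap 𝒰 h t z)).tendsto_comp (tendsto_limMap 𝒰 h t z)
  refine tendsto_nhds_unique (h1.congr fun i => ?_) (tendsto_limMap 𝒰 h t (z - 1))
  exact ((hF.strip i).comp_add (t i)).map_eq z hz

theorem holomorphicOn_limMap (hF : StripFamily L 𝒰 f g h) (t : ι → ℝ) :
    HolomorphicOn (limMap 𝒰 h t) (standardStrip L) :=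
  CConvAt.holomorphicOn isOpen_strip
    (Eventually.of_forall fun i => ((hF.strip i).comp_add (t i)).holomorphicOn)
    fun _ hz => hF.cconvAt t hz

/-- Hurwitz' dichotomy for limits of injective maps. The functional equation passes to the limit, so
a constant limit is a fixed point of `g`. -/
theorem isStripMap_or_eq (hF : StripFamily L 𝒰 f g h) (t : ι → ℝ) :
    IsStripMap L g (limMap 𝒰 h t) ∨ ∃ v, g v = v ∧ ∀ z ∈ standardStrip L, limMap 𝒰 h t z = v := by
  rcases CConvAt.injOn_or_eq_const isOpen_strip isPreconnected_strip
    (Eventually.of_forall fun i => ((hF.strip i).comp_add (t i)).holomorphicOn)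
    (Eventually.of_forall fun i => ((hF.strip i).comp_add (t i)).injOn)
    (fun _ hz => hF.cconvAt t hz) with h1 | ⟨c, hc⟩
  · exact Or.inl ⟨hF.holomorphicOn_limMap t, h1, fun z hz => hF.map_limMap t hz⟩
  · refine Or.inr ⟨c, ?_, hc⟩
    have h0 := zero_mem_strip hF.pos
    have h1 := hF.map_limMap t h0
    rwa [hc _ h0, hc _ (sub_one_mem_strip h0)] at h1

theorem isStripMap_of_ne (hF : StripFamily L 𝒰 f g h) {t : ι → ℝ} {z : ℂ}
    (hz : z ∈ standardStrip L) (hne : g (limMap 𝒰 h t z) ≠ limMap 𝒰 h t z) :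
    IsStripMap L g (limMap 𝒰 h t) := by
  refine (hF.isStripMap_or_eq t).resolve_right ?_
  rintro ⟨v, hv, hz'⟩
  rw [hz' z hz] at hne
  exact hne hv

theorem eq_of_fixed (hF : StripFamily L 𝒰 f g h) {t : ι → ℝ} {z : ℂ}
    (hz : z ∈ standardStrip L) (he : g (limMap 𝒰 h t z) = limMap 𝒰 h t z) {w : ℂ}
    (hw : w ∈ standardStrip L) : limMap 𝒰 h t w = limMap 𝒰 h t z := by
  rcases hF.isStripMap_or_eq t with h1 | ⟨v, hv, hz'⟩
  · exact absurd he (h1.map_ne hz)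
  · rw [hz' w hw, hz' z hz]

/-- A sequence of points of the strips that converges to a point of the limiting strip converges
in the coordinate of the strip. -/
theorem tendsto_sub (hF : StripFamily L 𝒰 f g h) {t : ι → ℝ} (ht : IsStripMap L g (limMap 𝒰 h t))
    {w : ℂ} (hw : w ∈ standardStrip L) {s : ι → ℂ} (hs : ∀ i, s i ∈ standardStrip L)
    (hsw : Tendsto (fun i => h i (s i)) 𝒰 (𝓝 (limMap 𝒰 h t w))) :
    Tendsto (fun i => s i - t i) 𝒰 (𝓝 w) := by
  rw [Metric.tendsto_nhds]
  intro ε hε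
  have := CConvAt.eventually_exists_eq isOpen_strip hw
    (Eventually.of_forall fun i => ((hF.strip i).comp_add (t i)).holomorphicOn)
    (fun _ hz => hF.cconvAt t hz) (InjOn.not_eventually_eq isOpen_strip hw ht.injOn) hsw hε
  filter_upwards [this] with i hi
  obtain ⟨z, hz, hzs, hzi⟩ := hi
  have h1 := (hF.strip i).injOn (add_real_mem_strip hzs (t i)) (hs i) hzi
  rw [← h1, add_sub_cancel_right]
  exact hz

theorem limMap_eq_of_tendsto (hF : StripFamily L 𝒰 f g h) {t s : ι → ℝ} {c : ℝ}
    (hc : Tendsto (fun i => s i - t i) 𝒰 (𝓝 c)) {z : ℂ} (hz : z ∈ standardStrip L) :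
    limMap 𝒰 h s z = limMap 𝒰 h t (z + c) := by
  have h1 : Tendsto (fun i => z + ((s i - t i : ℝ) : ℂ)) 𝒰 (𝓝 (z + c)) :=
    tendsto_const_nhds.add ((Complex.continuous_ofReal.tendsto c).comp hc)
  have h2 := (hF.cconvAt t (add_real_mem_strip hz c)).tendsto_comp h1
  refine tendsto_nhds_unique (tendsto_limMap 𝒰 h s z) (h2.congr fun i => ?_)
  congr 1
  push_cast
  ring

end StripFamily

/-! ### The ends of a strip -/

/-- A path which accumulates only on a finite set converges. -/
theorem exists_tendsto_of_finite {X : Type*} [TopologicalSpace X] [T2Space X] {F : Set X}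
    (hF : F.Finite) {y : ℝ → X} (hy : Continuous y)
    (h : ∀ 𝒱 : Ultrafilter ℝ, (𝒱 : Filter ℝ) ≤ atTop → ∃ v ∈ F, Tendsto y 𝒱 (𝓝 v)) :
    ∃ v ∈ F, Tendsto y atTop (𝓝 v) := by
  obtain ⟨U, hU, hdis⟩ := hF.t2_separation
  have hev : ∀ᶠ x in atTop, y x ∈ ⋃ v ∈ F, U v := by
    by_contra hcon
    have hne : (atTop ⊓ 𝓟 {x | y x ∉ ⋃ v ∈ F, U v} : Filter ℝ).NeBot :=
      frequently_iff_neBot.1 (not_eventually.1 hcon)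
    obtain ⟨v, hv, hvt⟩ := h (Ultrafilter.of (atTop ⊓ 𝓟 {x | y x ∉ ⋃ v ∈ F, U v}))
      ((Ultrafilter.of_le _).trans inf_le_left)
    have h1 := hvt ((hU v).2.mem_nhds (hU v).1)
    have h2 : {x | y x ∉ ⋃ v ∈ F, U v} ∈ Ultrafilter.of (atTop ⊓ 𝓟 {x | y x ∉ ⋃ v ∈ F, U v}) :=
      ((Ultrafilter.of_le _).trans inf_le_right) (mem_principal_self _)
    obtain ⟨x, hx1, hx2⟩ := Ultrafilter.nonempty_of_mem (inter_mem h1 h2)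
    exact hx2 (mem_biUnion hv hx1)
  obtain ⟨T, hT⟩ := eventually_atTop.1 hev
  -- From `T` on the path stays in a disjoint union of neighbourhoods; being connected, it stays in
  -- a single one.
  obtain ⟨v₀, hv₀, hTv⟩ := mem_iUnion₂.1 (hT T le_rfl)
  have himg : y '' Ici T ⊆ U v₀ := by
    refine (isPreconnected_Ici.image y hy.continuousOn).subset_left_of_subset_union (hU v₀).2
      (v := ⋃ v ∈ F \ {v₀}, U v) (isOpen_biUnion fun v _ => (hU v).2) ?_ ?_
      ⟨y T, mem_image_of_mem y self_mem_Ici, hTv⟩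
    · rw [disjoint_iUnion₂_right]
      exact fun v hv => hdis hv₀ hv.1 fun h => hv.2 h.symm
    · rintro _ ⟨x, hx, rfl⟩
      obtain ⟨v, hv, hxv⟩ := mem_iUnion₂.1 (hT x hx)
      by_cases hvv : v = v₀
      · exact Or.inl (hvv ▸ hxv)
      · exact Or.inr (mem_biUnion ⟨hv, hvv⟩ hxv)
  refine ⟨v₀, hv₀, tendsto_iff_ultrafilter _ _ _ |>.2 fun 𝒱 h𝒱 => ?_⟩
  obtain ⟨v, hv, hvt⟩ := h 𝒱 h𝒱
  have h1 := hvt ((hU v).2.mem_nhds (hU v).1)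
  have h2 : y ⁻¹' U v₀ ∈ 𝒱 := by
    filter_upwards [h𝒱 (Ici_mem_atTop T)] with x hx
    exact himg (mem_image_of_mem y hx)
  obtain ⟨x, hx1, hx2⟩ := Ultrafilter.nonempty_of_mem (inter_mem h1 h2)
  have : v = v₀ := by
    by_contra hne
    exact disjoint_left.1 (hdis hv hv₀ hne) hx1 hx2
  exact this ▸ hvt

/-- There are two distinct points which every strip of `g` omits for dynamical reasons. -/
def HasOmittedPair (g : Sphere → Sphere) : Prop :=
  ∃ p q, p ≠ q ∧ g (g p) = g p ∧ g (g q) = g q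

theorem stripFamily_const {ι : Type*} {L : ℝ} (hL : 0 < L) (𝒰 : Filter ι) {g : Sphere → Sphere}
    (hg : Continuous g) (ho : HasOmittedPair g) {h : ι → ℂ → Sphere}
    (hh : ∀ i, IsStripMap L g (h i)) : StripFamily L 𝒰 (fun _ => g) g h where
  pos := hL
  conv x := cconvAt_const hg.continuousAt
  strip := hh
  omits := by
    obtain ⟨p, q, hpq, hp, hq⟩ := ho
    exact ⟨fun _ => p, fun _ => q, p, q, hpq, tendsto_const_nhds, tendsto_const_nhds,
      Eventually.of_forall fun _ => hp, Eventually.of_forall fun _ => hq⟩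

/-- `v` is the end of the strip map `H` in the direction `σ = ± 1`. -/
def IsEnd (L : ℝ) (H : ℂ → Sphere) (σ : ℝ) (v : Sphere) : Prop :=
  ∀ z ∈ standardStrip L, Tendsto (fun x : ℝ => H (z + (σ * x : ℝ))) atTop (𝓝 v)

theorem IsEnd.unique {L : ℝ} (hL : 0 < L) {H : ℂ → Sphere} {σ : ℝ} {v w : Sphere}
    (hv : IsEnd L H σ v) (hw : IsEnd L H σ w) : v = w :=
  tendsto_nhds_unique (hv 0 (zero_mem_strip hL)) (hw 0 (zero_mem_strip hL))

theorem IsEnd.tendsto_real {L : ℝ} (hL : 0 < L) {H : ℂ → Sphere} {σ : ℝ} {v : Sphere}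
    (hv : IsEnd L H σ v) : Tendsto (fun x : ℝ => H (σ * x : ℝ)) atTop (𝓝 v) := by
  simpa using hv 0 (zero_mem_strip hL)

/-- Translate the strip to infinity along itself. If some limit were not constant, Hurwitz would
give one value at two points of the original strip: the shifts are taken more than `2` apart and the
solutions lie within `1` of them, against injectivity. So all limits are constants at fixed points,
and a path accumulating only on a finite set converges. -/
theorem IsStripMap.exists_isEnd {L : ℝ} (hL : 0 < L) {g : Sphere → Sphere} (hg : Continuous g)
    (ho : HasOmittedPair g) (hfin : {x | g x = x}.Finite) {H : ℂ → Sphere}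
    (hH : IsStripMap L g H) {σ : ℝ} (hσ : σ ≠ 0) : ∃ v, g v = v ∧ IsEnd L H σ v := by
  have h0 := zero_mem_strip hL
  have key : ∀ 𝒱 : Ultrafilter ℝ, (𝒱 : Filter ℝ) ≤ atTop → ∃ v, g v = v ∧
      ∀ z ∈ standardStrip L, Tendsto (fun x : ℝ => H (z + (σ * x : ℝ))) 𝒱 (𝓝 v) := by
    intro 𝒱 h𝒱
    have hF : StripFamily L (𝒱 : Filter ℝ) (fun _ => g) g (fun _ => H) :=
      stripFamily_const hL _ hg ho fun _ => hH
    rcases hF.isStripMap_or_eq (fun x => σ * x) with hK | ⟨v, hv, hvz⟩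
    · exfalso
      have hev := CConvAt.eventually_exists_eq isOpen_strip h0
        (Eventually.of_forall fun x : ℝ => (hH.comp_add (σ * x)).holomorphicOn)
        (fun _ hz => hF.cconvAt _ hz) (InjOn.not_eventually_eq isOpen_strip h0 hK.injOn)
        (tendsto_const_nhds) (zero_lt_one' ℝ)
      obtain ⟨x, z, hz, hzs, hzx⟩ := hev.exists
      obtain ⟨x', ⟨z', hz', hzs', hzx'⟩, hx'⟩ :=
        (hev.and (h𝒱 (Ioi_mem_atTop (x + 2 / |σ|)))).exists
      have h1 := hH.injOn (add_real_mem_strip hzs _) (add_real_mem_strip hzs' _)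
        (hzx.trans hzx'.symm)
      have h2 : ((σ * (x' - x) : ℝ) : ℂ) = z - z' := by
        push_cast at h1 ⊢
        linear_combination -h1
      have h3 : ‖((σ * (x' - x) : ℝ) : ℂ)‖ < 2 := by
        rw [h2]
        rw [mem_ball_zero_iff] at hz hz'
        linarith [norm_sub_le z z']
      rw [Complex.norm_real, Real.norm_eq_abs, abs_mul] at h3
      have h4 : 2 / |σ| < x' - x := by
        have : x + 2 / |σ| < x' := hx'
        linarith
      have hσ' : 0 < |σ| := abs_pos.2 hσ
      have h5 : 2 < |σ| * |x' - x| := by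
        rw [div_lt_iff₀ hσ'] at h4
        have := le_abs_self (x' - x)
        nlinarith
      linarith
    · refine ⟨v, hv, fun z hz => ?_⟩
      rw [← hvz z hz]
      exact tendsto_limMap 𝒱 (fun _ => H) (fun x => σ * x) z
  have hcont : Continuous fun x : ℝ => H (σ * x : ℝ) :=
    (hH.continuous_real hL).comp (by fun_prop : Continuous fun x : ℝ => σ * x)
  obtain ⟨v, hv, hvt⟩ := exists_tendsto_of_finite hfin hcont (fun 𝒱 h𝒱 => by
    obtain ⟨v, hv, hvt⟩ := key 𝒱 h𝒱
    exact ⟨v, hv, by simpa using hvt 0 h0⟩)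
  refine ⟨v, hv, fun z hz => (tendsto_iff_ultrafilter _ _ _).2 fun 𝒱 h𝒱 => ?_⟩
  obtain ⟨w, hw, hwt⟩ := key 𝒱 h𝒱
  have h1 := hwt 0 h0
  simp only [zero_add] at h1
  rw [tendsto_nhds_unique (hvt.mono_left h𝒱) h1]
  exact hwt z hz

/-! ### Multipliers at the ends of strips -/

/-- The properties of a rational map of degree at least two which matter for the limits of
strips. -/
structure IsTameMap (g : Sphere → Sphere) : Prop where
  isHolSelf : IsHolSelf g
  finite_fixed : {x | g x = x}.Finite
  finite_fiber : ∀ c, {x | g x = c}.Finite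
  exists_preimage : ∀ p, g p = p → multiplier g p ≠ 0 → ∃ q ≠ p, g q = p

theorem isTameMap_ratMap {r : RatFunc ℂ} (hr : 2 ≤ ratDegree r) : IsTameMap (ratMap r) :=
  ⟨isHolSelf_ratMap r, finite_fixed_ratMap hr, finite_fiber_ratMap (one_le_two.trans hr),
    fun _ hp hm => exists_ne_ratMap_eq hr hp hm⟩

theorem IsTameMap.not_eventually_param {g : Sphere → Sphere} (hg : IsTameMap g) (p : Sphere)
    (w : ℂ) (c : Sphere) : ¬ ∀ᶠ z in 𝓝 w, g (param p z) = c := by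
  intro h
  have hfin : {z | g (param p z) = c}.Finite :=
    (hg.finite_fiber c).preimage (param_injective p).injOn
  exact (infinite_of_mem_nhds w h) hfin

theorem fixed_of_tendsto {ι : Type*} {𝒰 : Filter ι} [𝒰.NeBot] {f : ι → Sphere → Sphere}
    {g : Sphere → Sphere} (hfg : ∀ x, CConvAt 𝒰 f g x) {p : ι → Sphere} {p₀ : Sphere}
    (hp : Tendsto p 𝒰 (𝓝 p₀)) (hfix : ∀ᶠ i in 𝒰, f i (p i) = p i) : g p₀ = p₀ :=
  tendsto_nhds_unique (((hfg p₀).tendsto_comp hp).congr' hfix) hp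

/-- Take a preimage `a ≠ p₀` of `p₀` and let Hurwitz move it to a preimage of `p i` under `f i`.
Solutions are sought in a closed neighbourhood of `a` that misses `p₀`, which keeps their limit away
from `p₀`. -/
theorem exists_omitted {ι : Type*} {𝒰 : Ultrafilter ι} {f : ι → Sphere → Sphere}
    {g : Sphere → Sphere} (hg : IsTameMap g) (hf : ∀ᶠ i in (𝒰 : Filter ι), IsHolSelf (f i))
    (hfg : ∀ x, CConvAt (𝒰 : Filter ι) f g x) {p : ι → Sphere} {p₀ : Sphere}
    (hp : Tendsto p 𝒰 (𝓝 p₀)) (hp₀ : g p₀ = p₀) (hmul : multiplier g p₀ ≠ 0) :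
    ∃ (q : ι → Sphere) (q₀ : Sphere), p₀ ≠ q₀ ∧ Tendsto q 𝒰 (𝓝 q₀) ∧
      ∀ᶠ i in (𝒰 : Filter ι), f i (q i) = p i := by
  obtain ⟨a, hap, ha⟩ := hg.exists_preimage p₀ hp₀ hmul
  obtain ⟨N, ⟨hN, hNc⟩, hNp⟩ := (closed_nhds_basis a).mem_iff.1 (isOpen_ne.mem_nhds hap)
  have hN' : param a ⁻¹' N ∈ 𝓝 0 := (continuous_param a).continuousAt (by rwa [param_zero])
  obtain ⟨r, hr, hrN⟩ := Metric.mem_nhds_iff.1 hN'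
  have hev := CConvAt.eventually_exists_eq (𝒰 := (𝒰 : Filter ι)) (U := univ) (z₀ := 0)
    (φ := fun i w => f i (param a w)) (Φ := fun w => g (param a w)) isOpen_univ
    (mem_univ _) (hf.mono fun i hi => hi.holomorphicOn_param a)
    (fun z _ => (hfg _).comp (φ := fun _ => param a)
      (cconvAt_const (continuous_param a).continuousAt))
    (by simpa [ha] using hg.not_eventually_param a 0 p₀) (y := p) (by simpa [ha] using hp) hr
  classical
  let z : ι → ℂ := fun i => if h : ∃ z ∈ Metric.ball (0 : ℂ) r, z ∈ univ ∧ f i (param a z) = p i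
    then h.choose else 0
  have hz : ∀ᶠ i in (𝒰 : Filter ι), z i ∈ Metric.ball 0 r ∧ f i (param a (z i)) = p i := by
    filter_upwards [hev] with i hi
    simp only [z, dif_pos hi]
    exact ⟨hi.choose_spec.1, hi.choose_spec.2.2⟩
  have hlim := Ultrafilter.le_nhds_lim (Ultrafilter.map (fun i => param a (z i)) 𝒰)
  refine ⟨fun i => param a (z i), _, ?_, hlim, hz.mono fun i hi => hi.2⟩
  have hmem : (Ultrafilter.map (fun i => param a (z i)) 𝒰).lim ∈ N :=
    hNc.mem_of_tendsto (b := (𝒰 : Filter ι)) hlim (hz.mono fun i hi => hrN hi.1)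
  exact fun h => hNp hmem h.symm

theorem tendsto_strict_diff_ratio {ι : Type*} {𝒰 : Filter ι} [𝒰.NeBot]
    {f : ι → Sphere → Sphere} {g : Sphere → Sphere} (hf : ∀ᶠ i in 𝒰, IsHolSelf (f i))
    (hfg : ∀ x, CConvAt 𝒰 f g x) {p : Sphere} (hp : g p = p) {x y : ι → ℂ}
    (hx : Tendsto x 𝒰 (𝓝 0)) (hy : Tendsto y 𝒰 (𝓝 0)) (hxy : ∀ᶠ i in 𝒰, x i ≠ y i) :
    Tendsto (fun i => (chart p (f i (param p (x i))) - chart p (f i (param p (y i))))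
      / (x i - y i)) 𝒰 (𝓝 (multiplier g p)) := by
  rw [Metric.tendsto_nhds]
  intro ε hε
  obtain ⟨ρ, hρ, h⟩ := exists_ball_strict_diff hf hfg hp (half_pos hε)
  filter_upwards [h, hx (Metric.ball_mem_nhds 0 hρ), hy (Metric.ball_mem_nhds 0 hρ), hxy]
    with i h1 h2 h3 h4
  have h5 := (h1 _ h2).2 _ h3
  have h6 : x i - y i ≠ 0 := sub_ne_zero.2 h4
  rw [dist_eq_norm, div_sub' h6, norm_div, div_lt_iff₀ (norm_pos_iff.2 h6)]
  have h7 := norm_pos_iff.2 h6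
  rw [mul_comm (x i - y i)]
  nlinarith

/-- Quotients of consecutive terms of a convergent subsequence of the powers tend to `1`. The
exponents are differences of a strictly increasing sequence, hence positive. -/
theorem exists_pow_tendsto_one {l : ℂ} (hl : ‖l‖ = 1) :
    ∃ j : ℕ → ℕ, (∀ k, 1 ≤ j k) ∧ Tendsto (fun k => l ^ j k) atTop (𝓝 1) := by
  have hb : ∀ n : ℕ, l ^ n ∈ Metric.closedBall (0 : ℂ) 1 := fun n => by simp [hl]
  obtain ⟨a, -, φ, hφ, hφa⟩ := tendsto_subseq_of_bounded Metric.isBounded_closedBall hb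
  have ha : a ≠ 0 := by
    have h1 := hφa.norm
    simp only [Function.comp_def, norm_pow, hl, one_pow] at h1
    have := tendsto_nhds_unique h1 tendsto_const_nhds
    exact norm_ne_zero_iff.1 (by rw [this]; exact one_ne_zero)
  have hl0 : l ≠ 0 := norm_ne_zero_iff.1 (by rw [hl]; exact one_ne_zero)
  refine ⟨fun k => φ (k + 1) - φ k, fun k => ?_, ?_⟩
  · have := hφ (Nat.lt_succ_self k)
    change 1 ≤ φ (k + 1) - φ k
    have h3 : φ k < φ (k + 1) := this
    omega
  · have h2 : Tendsto (fun k => l ^ φ (k + 1) / l ^ φ k) atTop (𝓝 (a / a)) :=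
      (hφa.comp (tendsto_add_atTop_nat 1)).div hφa ha
    rw [div_self ha] at h2
    refine h2.congr fun k => ?_
    rw [pow_sub₀ _ hl0 (hφ (Nat.lt_succ_self k)).le, div_eq_mul_inv]

theorem div_mul_div_eq_of_ne {x y α s D E : ℂ} (hs : s ≠ 0) (hx : x ≠ α) (hD : D ≠ 0)
    (hE : E ≠ 0) : (y - α) / (x - α) * (D / E) = s * (α - y) / E / (s * (α - x) / D) := by
  have h1 : x - α ≠ 0 := sub_ne_zero.2 hx
  have h2 : α - x ≠ 0 := sub_ne_zero.2 hx.symm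
  field_simp
  ring

/-- Rescaling strips that shrink to a fixed point `p₀` of `g`: the multiplier is `1` as soon as it
has modulus `1`, and in that case the strips become infinitesimally small compared with their
distance to the fixed points `p i`. -/
theorem StripFamily.rescale {ι : Type*} {L : ℝ} {𝒰 : Ultrafilter ι} {f : ι → Sphere → Sphere}
    {g : Sphere → Sphere} {h : ι → ℂ → Sphere} (hF : StripFamily L 𝒰 f g h)
    (hf : ∀ᶠ i in (𝒰 : Filter ι), IsHolSelf (f i)) {p q : ι → Sphere} {p₀ q₀ : Sphere}
    (hp : Tendsto p 𝒰 (𝓝 p₀)) (hfix : ∀ᶠ i in (𝒰 : Filter ι), f i (p i) = p i)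
    (hq : Tendsto q 𝒰 (𝓝 q₀)) (hne : p₀ ≠ q₀)
    (hqfix : ∀ᶠ i in (𝒰 : Filter ι), f i (f i (q i)) = f i (q i)) {t : ι → ℝ}
    (ht : limMap 𝒰 h t 0 = p₀) :
    (‖multiplier g p₀‖ = 1 → multiplier g p₀ = 1) ∧
    (multiplier g p₀ = 1 → ∀ z ∈ standardStrip L,
      Tendsto (fun x : ι × ℂ => (chart p₀ (h x.1 (x.2 + t x.1)) - chart p₀ (p x.1))
        / (chart p₀ (h x.1 (t x.1)) - chart p₀ (p x.1))) ((𝒰 : Filter ι) ×ˢ 𝓝 z) (𝓝 1)) := by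
  have hg : g p₀ = p₀ := fixed_of_tendsto hF.conv hp hfix
  have h0 : (0 : ℂ) ∈ standardStrip L := zero_mem_strip hF.pos
  have hlim : ∀ z ∈ standardStrip L, limMap 𝒰 h t z = p₀ := fun z hz => by
    rw [hF.eq_of_fixed h0 (by rw [ht, hg]) hz, ht]
  have hcc : ∀ z ∈ standardStrip L,
      Tendsto (fun x : ι × ℂ => h x.1 (x.2 + t x.1)) ((𝒰 : Filter ι) ×ˢ 𝓝 z) (𝓝 p₀) := by
    intro z hz
    have := hF.cconvAt t hz
    rwa [CConvAt, hlim z hz] at this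
  set P : ι → ℂ × ℂ := fun i => homLift p₀ (chart p₀ (p i)) with hP
  set Q : ι → ℂ × ℂ := fun i => homLift q₀ (chart q₀ (q i)) with hQ
  have hαt : Tendsto (fun i => chart p₀ (p i)) 𝒰 (𝓝 0) := (tendsto_chart p₀).comp hp
  have hPt : Tendsto P 𝒰 (𝓝 (homLift p₀ 0)) := ((continuous_homLift p₀).tendsto 0).comp hαt
  have hQt : Tendsto Q 𝒰 (𝓝 (homLift q₀ 0)) :=
    ((continuous_homLift q₀).tendsto 0).comp ((tendsto_chart q₀).comp hq)
  have hpp : ∀ᶠ i in (𝒰 : Filter ι), param p₀ (chart p₀ (p i)) = p i :=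
    hp.eventually (eventually_param_chart p₀)
  have hPp : ∀ᶠ i in (𝒰 : Filter ι), hmk (P i).1 (P i).2 = p i := by
    filter_upwards [hpp] with i hi
    rw [hP, hmk_homLift, hi]
  have hQq : ∀ᶠ i in (𝒰 : Filter ι), hmk (Q i).1 (Q i).2 = q i := by
    filter_upwards [hq.eventually (eventually_param_chart q₀)] with i hi
    rw [hQ, hmk_homLift, hi]
  have hdet : Continuous fun x : (ℂ × ℂ) × ℂ × ℂ => det2 x.1 x.2 := by unfold det2; fun_prop
  have hdet0 : det2 (homLift p₀ 0) (homLift q₀ 0) ≠ 0 := by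
    rw [det2_ne_zero_iff (homLift_ne_zero _ _) (homLift_ne_zero _ _), hmk_homLift, hmk_homLift,
      param_zero, param_zero]
    exact hne
  have hdet1 : det2 (homLift q₀ 0) (homLift p₀ 0) ≠ 0 := by
    rw [det2_ne_zero_iff (homLift_ne_zero _ _) (homLift_ne_zero _ _), hmk_homLift, hmk_homLift,
      param_zero, param_zero]
    exact hne.symm
  have hPQ : ∀ᶠ i in (𝒰 : Filter ι), det2 (P i) (Q i) ≠ 0 :=
    ((hdet.tendsto _).comp (hPt.prodMk_nhds hQt)).eventually_ne hdet0
  have hgood : ∀ᶠ i in (𝒰 : Filter ι), ∀ z ∈ standardStrip L,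
      h i (z + t i) ≠ hmk (P i).1 (P i).2 ∧ h i (z + t i) ≠ hmk (Q i).1 (Q i).2 := by
    filter_upwards [hPp, hQq, hfix, hqfix] with i h1 h2 h3 h4 z hz
    rw [h1, h2]
    exact ⟨((hF.strip i).comp_add (t i)).ne_of_map_map_eq (by rw [h3, h3]) hz,
      ((hF.strip i).comp_add (t i)).ne_of_map_map_eq h4 hz⟩
  obtain ⟨s, hs, hsdet⟩ := exists_det2_homLift p₀
  -- the Möbius coordinate in terms of the chart
  have hmob : ∀ (i : ι) (y : Sphere), y ∈ range (param p₀) → mobius (P i) (Q i) y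
      = s * (chart p₀ (p i) - chart p₀ y) / det2 (Q i) (homLift p₀ (chart p₀ y)) := by
    intro i y hy
    conv_lhs => rw [← param_chart_of_mem hy, mobius_param]
    rw [hP, hsdet]
  -- Möbius coordinate with zero `p i` and pole `q i`, scaled to be `1` at the centre. It omits `0`
  -- and `∞` on the strip, so these functions are normal although the strips themselves collapse to
  -- `p₀`.
  set W : ι → ℂ → ℂ := fun i z =>
    mobius (P i) (Q i) (h i (z + t i)) / mobius (P i) (Q i) (h i (t i)) with hW
  have hmob0 : ∀ᶠ i in (𝒰 : Filter ι), ∀ z ∈ standardStrip L,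
      mobius (P i) (Q i) (h i (z + t i)) ≠ 0 := by
    filter_upwards [hgood] with i hi z hz
    exact mobius_ne_zero (homLift_ne_zero _ _) (homLift_ne_zero _ _) (hi z hz).1 (hi z hz).2
  have hmob00 : ∀ᶠ i in (𝒰 : Filter ι), mobius (P i) (Q i) (h i (t i)) ≠ 0 := by
    filter_upwards [hmob0] with i hi
    simpa using hi 0 h0
  have hWd : ∀ᶠ i in (𝒰 : Filter ι),
      HolomorphicOn (fun z => ((W i z : ℂ) : Sphere)) (standardStrip L) := by
    filter_upwards [hgood] with i hi
    have h1 : DifferentiableOn ℂ (W i) (standardStrip L) :=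
      (((hF.strip i).comp_add (t i)).holomorphicOn.mobius isOpen_strip (homLift_ne_zero _ _)
        fun z hz => (hi z hz).2).div_const _
    simpa using holomorphicOn_hmk (B := fun _ => 1) isOpen_strip h1 (differentiableOn_const 1)
      fun _ _ => Or.inr one_ne_zero
  have hWi : ∀ᶠ i in (𝒰 : Filter ι),
      InjOn (fun z => ((W i z : ℂ) : Sphere)) (standardStrip L) := by
    filter_upwards [hgood, hPQ, hmob00] with i h1 h2 h3 z hz w hw hzw
    have h4 : W i z = W i w := OnePoint.coe_injective hzw
    have h5 := (div_left_inj' h3).1 h4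
    exact ((hF.strip i).comp_add (t i)).injOn hz hw
      (mobius_inj (homLift_ne_zero _ _) h2 (h1 z hz).2 (h1 w hw).2 h5)
  set W' : ℂ → Sphere := fun z => (Ultrafilter.map (fun i => ((W i z : ℂ) : Sphere)) 𝒰).lim
  have hW't : ∀ z, Tendsto (fun i => ((W i z : ℂ) : Sphere)) 𝒰 (𝓝 (W' z)) := fun z =>
    Ultrafilter.le_nhds_lim (Ultrafilter.map (fun i => ((W i z : ℂ) : Sphere)) 𝒰)
  have hWcc : ∀ z ∈ standardStrip L,
      CConvAt (𝒰 : Filter ι) (fun i z => ((W i z : ℂ) : Sphere)) W' z := by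
    intro z hz
    obtain ⟨r, hr, hrs⟩ := Metric.isOpen_iff.1 isOpen_strip z hz
    refine tendsto_of_omits (φ := fun i z => ((W i z : ℂ) : Sphere)) hr
      (hWd.mono fun i hi => hi.mono hrs) (hWi.mono fun i hi => hi.mono hrs)
      (p := fun _ => ((0 : ℂ) : Sphere)) (q := fun _ => OnePoint.infty) tendsto_const_nhds
      tendsto_const_nhds (by simp) ?_ (hW't z)
    filter_upwards [hmob0, hmob00] with i h1 h2 w hw
    refine ⟨?_, by simp⟩
    exact fun h3 => div_ne_zero (h1 w (hrs hw)) h2 (OnePoint.coe_injective h3)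
  -- the functional equation of the limit
  have hstep : ∀ z ∈ standardStrip L,
      Tendsto (fun i => W i (z - 1) / W i z) 𝒰 (𝓝 (multiplier g p₀)) := by
    intro z hz
    have hz1 := sub_one_mem_strip hz
    have a1 := (hcc z hz).comp (tendsto_id.prodMk tendsto_const_nhds)
    have a2 := (hcc (z - 1) hz1).comp (tendsto_id.prodMk tendsto_const_nhds)
    simp only [Function.comp_def, id] at a1 a2
    have b1 := (tendsto_chart p₀).comp a1
    have b2 := (tendsto_chart p₀).comp a2
    have c1 := (hdet.tendsto _).comp
      (hQt.prodMk_nhds (((continuous_homLift p₀).tendsto 0).comp b1))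
    have c2 := (hdet.tendsto _).comp
      (hQt.prodMk_nhds (((continuous_homLift p₀).tendsto 0).comp b2))
    have c3 := c1.div c2 hdet1
    simp only [Function.comp_def] at b1 b2 c3
    rw [div_self hdet1] at c3
    have hran1 : ∀ᶠ i in (𝒰 : Filter ι), h i (z + t i) ∈ range (param p₀) :=
      a1 (by simpa using range_param_mem_nhds p₀ 0)
    have hran2 : ∀ᶠ i in (𝒰 : Filter ι), h i (z - 1 + t i) ∈ range (param p₀) :=
      a2 (by simpa using range_param_mem_nhds p₀ 0)
    have hne' : ∀ᶠ i in (𝒰 : Filter ι), chart p₀ (h i (z + t i)) ≠ chart p₀ (p i) := by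
      filter_upwards [hgood, hPp, hran1, hpp] with i h1 h2 h3 h4 h5
      apply (h1 z hz).1
      rw [h2, ← h4, ← h5, param_chart_of_mem h3]
    have d1 := (tendsto_strict_diff_ratio hf hF.conv hg b1 hαt hne').mul c3
    rw [mul_one] at d1
    refine d1.congr' ?_
    filter_upwards [hran1, hran2, hpp, hfix, hmob0, hmob00, hne', hgood, c1.eventually_ne hdet1,
      c2.eventually_ne hdet1] with i e1 e2 e3 e4 e5 e6 e7 e8 e9 e10
    have e11 : f i (param p₀ (chart p₀ (h i (z + t i)))) = h i (z - 1 + t i) := by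
      rw [param_chart_of_mem e1]
      exact ((hF.strip i).comp_add (t i)).map_eq z hz
    rw [e11, e3, e4]
    simp only [hW]
    rw [div_div_div_cancel_right₀ e6, hmob i _ e1, hmob i _ e2]
    simp only [Function.comp_apply] at e9 e10
    exact div_mul_div_eq_of_ne hs e7 e9 e10
  have hW0 : W' 0 = ((1 : ℂ) : Sphere) := by
    refine tendsto_nhds_unique (hW't 0) (tendsto_const_nhds.congr' ?_)
    filter_upwards [hmob00] with i hi
    simp [hW, div_self hi]
  have hnat : ∀ j : ℕ, (-(j : ℂ)) ∈ standardStrip L := fun j => by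
    have := real_mem_strip hF.pos (-(j : ℝ))
    push_cast at this
    exact this
  have hWj : ∀ j : ℕ, Tendsto (fun i => W i (-(j : ℂ))) 𝒰 (𝓝 (multiplier g p₀ ^ j)) := by
    intro j
    induction j with
    | zero =>
      rw [pow_zero]
      refine tendsto_const_nhds.congr' ?_
      filter_upwards [hmob00] with i hi
      simp [hW, div_self hi]
    | succ j ih =>
      rw [pow_succ]
      refine (ih.mul (hstep _ (hnat j))).congr' ?_
      filter_upwards [hmob0, hmob00] with i h1 h2
      have h3 : W i (-(j : ℂ)) ≠ 0 := div_ne_zero (h1 _ (hnat j)) h2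
      rw [mul_div_cancel₀ _ h3]
      congr 1
      push_cast
      ring
  have hW'j : ∀ j : ℕ, W' (-(j : ℂ)) = ((multiplier g p₀ ^ j : ℂ) : Sphere) := fun j =>
    tendsto_nhds_unique (hW't _) ((OnePoint.continuous_coe.tendsto _).comp (hWj j))
  have hdich := CConvAt.injOn_or_eq_const isOpen_strip isPreconnected_strip hWd hWi hWcc
  have hone : multiplier g p₀ = 1 → ∀ z ∈ standardStrip L, W' z = ((1 : ℂ) : Sphere) := by
    intro h1
    rcases hdich with hinj | ⟨c, hc⟩
    · exfalso
      -- For multiplier `1` the limit takes the same value at `-1` and at `0`, so it is constant.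
      have := hinj (hnat 1) h0 (by rw [hW'j, hW0, h1, one_pow])
      norm_num at this
    · intro z hz
      rw [hc z hz, ← hc 0 h0, hW0]
  refine ⟨fun h1 => ?_, fun h1 z hz => ?_⟩
  · rcases hdich with hinj | ⟨c, hc⟩
    · exfalso
      -- An injective limit takes values close to `W' 0 = 1` only near `0`. But `W' (-j)` is the
      -- `j`-th power of the multiplier, which returns to `1` for positive `j`.
      obtain ⟨j, hj, hjt⟩ := exists_pow_tendsto_one h1
      have hcont : ContinuousOn W' (standardStrip L) := CConvAt.continuousOn isOpen_strip hWcc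
      have hev := CConvAt.eventually_exists_eq (𝒰 := (atTop : Filter ℕ)) (φ := fun _ => W')
        (Φ := W') isOpen_strip h0
        (Eventually.of_forall fun _ => CConvAt.holomorphicOn isOpen_strip hWd hWcc)
        (fun z hz => cconvAt_const (hcont.continuousAt (isOpen_strip.mem_nhds hz)))
        (InjOn.not_eventually_eq isOpen_strip h0 hinj)
        (y := fun k => ((multiplier g p₀ ^ j k : ℂ) : Sphere))
        (by rw [hW0]; exact (OnePoint.continuous_coe.tendsto _).comp hjt) (half_pos one_pos)
      obtain ⟨k, z, hz, hzs, hzk⟩ := hev.exists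
      have hzj := hinj hzs (hnat (j k)) (by rw [hzk, hW'j])
      rw [hzj, mem_ball_zero_iff, norm_neg, Complex.norm_natCast] at hz
      have : (1 : ℝ) ≤ j k := by exact_mod_cast hj k
      linarith
    · have h2 : W' (-((1 : ℕ) : ℂ)) = W' 0 := by rw [hc _ (hnat 1), hc _ h0]
      rw [hW'j, hW0, pow_one] at h2
      exact OnePoint.coe_injective h2
  · have a1 := hWcc z hz
    rw [CConvAt, hone h1 z hz] at a1
    have a2 : Tendsto (fun x : ι × ℂ => W x.1 x.2) ((𝒰 : Filter ι) ×ˢ 𝓝 z) (𝓝 1) :=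
      (OnePoint.isOpenEmbedding_coe.tendsto_nhds_iff).2 a1
    have b1 := (tendsto_chart p₀).comp (hcc z hz)
    have b2 := (tendsto_chart p₀).comp
      (((hcc 0 h0).comp (tendsto_id.prodMk tendsto_const_nhds)).comp
        (tendsto_fst (f := (𝒰 : Filter ι)) (g := 𝓝 z)))
    simp only [Function.comp_def, id, zero_add] at b1 b2
    have hQt' : Tendsto (fun x : ι × ℂ => Q x.1) ((𝒰 : Filter ι) ×ˢ 𝓝 z) (𝓝 (homLift q₀ 0)) :=
      hQt.comp tendsto_fst
    -- Back to the chart: up to a common factor the Möbius coordinate is the difference of chart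
    -- coordinates divided by `det2 (Q i) _`, and the two denominators have the same non-zero limit.
    have c1 := (hdet.tendsto _).comp
      (hQt'.prodMk_nhds (((continuous_homLift p₀).tendsto 0).comp b1))
    have c2 := (hdet.tendsto _).comp
      (hQt'.prodMk_nhds (((continuous_homLift p₀).tendsto 0).comp b2))
    have c3 := a2.mul (c1.div c2 hdet1)
    rw [div_self hdet1, mul_one] at c3
    refine c3.congr' ?_
    have hr0 : ∀ᶠ i in (𝒰 : Filter ι), h i (t i) ∈ range (param p₀) := by
      have := (hcc 0 h0).comp (tendsto_id.prodMk tendsto_const_nhds)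
      simp only [Function.comp_def, id, zero_add] at this
      exact this (by simpa using range_param_mem_nhds p₀ 0)
    have hr1 : ∀ᶠ x : ι × ℂ in (𝒰 : Filter ι) ×ˢ 𝓝 z, h x.1 (x.2 + t x.1) ∈ range (param p₀) :=
      hcc z hz (by simpa using range_param_mem_nhds p₀ 0)
    filter_upwards [hr1, tendsto_fst.eventually hr0, tendsto_fst.eventually hmob00,
      c1.eventually_ne hdet1, c2.eventually_ne hdet1] with x e1 e2 e3 e4 e5
    simp only [hW, Function.comp_apply] at e4 e5 ⊢
    rw [hmob _ _ e2] at e3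
    rw [hmob _ _ e1, hmob _ _ e2]
    have e6 : chart p₀ (p x.1) - chart p₀ (h x.1 (t x.1)) ≠ 0 := fun h0 => e3 (by simp [h0])
    have e7 : chart p₀ (h x.1 (t x.1)) - chart p₀ (p x.1) ≠ 0 := fun h0 => e6 (by
      linear_combination -h0)
    rw [← div_mul_div_eq_of_ne hs (sub_ne_zero.1 e7) e5 e4, mul_assoc]
    simp only [Pi.div_apply, Function.comp_apply]
    rw [div_mul_div_cancel₀ e4, div_self e5, mul_one]

/-- `v` is the limit of the orbits of the strip map `H` in the direction `σ = ± 1`. -/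
def IsOrbitEnd (L : ℝ) (H : ℂ → Sphere) (σ : ℝ) (v : Sphere) : Prop :=
  ∀ z ∈ standardStrip L, Tendsto (fun m : ℕ => H (z + (σ * m : ℝ))) atTop (𝓝 v)

theorem IsEnd.isOrbitEnd {L : ℝ} {H : ℂ → Sphere} {σ : ℝ} {v : Sphere} (hv : IsEnd L H σ v) :
    IsOrbitEnd L H σ v :=
  fun z hz => (hv z hz).comp tendsto_natCast_atTop_atTop

theorem IsOrbitEnd.tendsto_real {L : ℝ} (hL : 0 < L) {H : ℂ → Sphere} {σ : ℝ} {v : Sphere}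
    (hv : IsOrbitEnd L H σ v) : Tendsto (fun m : ℕ => H (σ * m : ℝ)) atTop (𝓝 v) := by
  simpa using hv 0 (zero_mem_strip hL)

theorem IsOrbitEnd.map_eq {L : ℝ} (hL : 0 < L) {f : Sphere → Sphere} (hf : Continuous f)
    {h : ℂ → Sphere} (hh : IsStripMap L f h) {σ : ℝ} {v : Sphere} (hv : IsOrbitEnd L h σ v) :
    f v = v := by
  have h0 := zero_mem_strip hL
  refine tendsto_nhds_unique ((hf.tendsto v).comp (hv 0 h0))
    ((hv (0 - 1) (sub_one_mem_strip h0)).congr fun x => ?_)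
  rw [Function.comp_apply, hh.map_eq _ (add_real_mem_strip h0 _)]
  congr 1
  ring

theorem IsEnd.map_eq {L : ℝ} (hL : 0 < L) {f : Sphere → Sphere} (hf : Continuous f)
    {h : ℂ → Sphere} (hh : IsStripMap L f h) {σ : ℝ} {v : Sphere} (hv : IsEnd L h σ v) :
    f v = v :=
  hv.isOrbitEnd.map_eq hL hf hh

theorem not_tendsto_zero_of_le_succ {d : ℕ → ℝ} (hpos : ∀ m, 0 < d m)
    (h : ∀ᶠ m in atTop, d m ≤ d (m + 1)) : ¬ Tendsto d atTop (𝓝 0) := by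
  intro ht
  obtain ⟨M, hM⟩ := eventually_atTop.1 h
  have h1 : ∀ m ≥ M, d M ≤ d m := by
    intro m hm
    induction m, hm using Nat.le_induction with
    | base => exact le_rfl
    | succ m hm ih => exact ih.trans (hM m hm)
  have h2 := ge_of_tendsto ht (eventually_atTop.2 ⟨M, h1⟩)
  exact absurd (hpos M) (not_lt.2 h2)

/-! ### The multiplier at a limit of ends -/

section Ends

variable {ι : Type*} {L : ℝ} {f : ι → Sphere → Sphere} {g : Sphere → Sphere} {h : ι → ℂ → Sphere}
  {p : ι → Sphere} {p₀ : Sphere}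

/-- If the modulus exceeded `1`, a single `f i` close to `g` would not decrease distances to its
fixed point `p i` on a fixed ball about `p₀`. Then the distances along an orbit converging to `p i`
would be positive, non-decreasing in the long run, and yet tend to zero. -/
theorem norm_multiplier_le_one_of_ends {𝒰 : Filter ι} [𝒰.NeBot] (hL : 0 < L)
    (hf : ∀ i, IsHolSelf (f i)) (hfg : ∀ x, CConvAt 𝒰 f g x)
    (hh : ∀ i, IsStripMap L (f i) (h i)) (hend : ∀ i, IsOrbitEnd L (h i) (-1) (p i))
    (hp : Tendsto p 𝒰 (𝓝 p₀)) : ‖multiplier g p₀‖ ≤ 1 := by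
  have hfix : ∀ i, f i (p i) = p i := fun i => (hend i).map_eq hL (hf i).continuous (hh i)
  have hp₀ : g p₀ = p₀ := fixed_of_tendsto hfg hp (Eventually.of_forall hfix)
  by_contra! hcon
  obtain ⟨ρ, hρ, hsd⟩ := exists_ball_strict_diff (Eventually.of_forall hf) hfg hp₀
    (sub_pos.2 hcon)
  obtain ⟨i, hi, hi1, hi2⟩ := (hsd.and ((hp.eventually (eventually_param_chart p₀)).and
    (((tendsto_chart p₀).comp hp).eventually (Metric.ball_mem_nhds 0 hρ)))).exists
  have hst : ∀ m : ℕ, (((-1) * (m : ℝ) : ℝ) : ℂ) ∈ standardStrip L :=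
    fun m => real_mem_strip hL _
  have hne : ∀ m : ℕ, h i (((-1) * (m : ℝ) : ℝ) : ℂ) ≠ p i := fun m =>
    (hh i).ne_of_map_map_eq (by rw [hfix, hfix]) (hst m)
  have ht := (hend i).tendsto_real hL
  have hNopen : ∀ᶠ m : ℕ in atTop, h i (((-1) * (m : ℝ) : ℝ) : ℂ) ∈ param p₀ '' Metric.ball 0 ρ :=
    ht ((isOpenMap_param p₀ _ Metric.isOpen_ball).mem_nhds ⟨_, hi2, hi1⟩)
  have hdt : Tendsto (fun m : ℕ => ‖chart p₀ (h i (((-1) * (m : ℝ) : ℝ) : ℂ)) - chart p₀ (p i)‖)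
      atTop (𝓝 0) := by
    have hc := continuousAt_chart_param p₀ (chart p₀ (p i))
    rw [hi1] at hc
    have hc2 := ((hc.tendsto.comp ht).sub_const (chart p₀ (p i))).norm
    rw [sub_self, norm_zero] at hc2
    exact hc2
  obtain ⟨M, hM⟩ := eventually_atTop.1 hNopen
  refine not_tendsto_zero_of_le_succ (d := fun m : ℕ =>
    ‖chart p₀ (h i (((-1) * ((m + M : ℕ) : ℝ) : ℝ) : ℂ)) - chart p₀ (p i)‖) (fun m => ?_)
    (Eventually.of_forall fun m => ?_) (hdt.comp (tendsto_add_atTop_nat M))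
  · rw [norm_pos_iff, sub_ne_zero]
    intro he
    obtain ⟨w, hw, hwe⟩ := hM (m + M) (Nat.le_add_left _ _)
    refine hne (m + M) ?_
    rw [← hi1, ← he, param_chart_of_mem ⟨w, hwe⟩]
  · obtain ⟨w, hw, hwe⟩ := hM (m + M) (Nat.le_add_left _ _)
    have h1 := (hi w hw).2 _ hi2
    have h2 : f i (param p₀ w) = h i (((-1) * ((m + 1 + M : ℕ) : ℝ) : ℝ) : ℂ) := by
      rw [hwe, (hh i).map_eq _ (hst _)]
      congr 1
      push_cast
      ring
    rw [Function.comp_apply, h2, hi1, hfix] at h1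
    rw [← hwe, chart_param]
    have h3 := norm_sub_norm_le (multiplier g p₀ * (w - chart p₀ (p i)))
      (multiplier g p₀ * (w - chart p₀ (p i)) -
        (chart p₀ (h i (((-1) * ((m + 1 + M : ℕ) : ℝ) : ℝ) : ℂ)) - chart p₀ (p i)))
    rw [sub_sub_cancel, norm_mul, norm_sub_rev (multiplier g p₀ * _)] at h3
    nlinarith

/-- The mirror argument: near a limit of modulus less than `1` a single `f i` does not increase
distances to `p i`, so they cannot shrink to zero along a backward orbit. -/
theorem one_le_norm_multiplier_of_ends {𝒰 : Filter ι} [𝒰.NeBot] (hL : 0 < L)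
    (hf : ∀ i, IsHolSelf (f i)) (hfg : ∀ x, CConvAt 𝒰 f g x)
    (hh : ∀ i, IsStripMap L (f i) (h i)) (hend : ∀ i, IsOrbitEnd L (h i) 1 (p i))
    (hp : Tendsto p 𝒰 (𝓝 p₀)) : 1 ≤ ‖multiplier g p₀‖ := by
  have hfix : ∀ i, f i (p i) = p i := fun i => (hend i).map_eq hL (hf i).continuous (hh i)
  have hp₀ : g p₀ = p₀ := fixed_of_tendsto hfg hp (Eventually.of_forall hfix)
  by_contra! hcon
  obtain ⟨ρ, hρ, hsd⟩ := exists_ball_strict_diff (Eventually.of_forall hf) hfg hp₀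
    (sub_pos.2 hcon)
  obtain ⟨i, hi, hi1, hi2⟩ := (hsd.and ((hp.eventually (eventually_param_chart p₀)).and
    (((tendsto_chart p₀).comp hp).eventually (Metric.ball_mem_nhds 0 hρ)))).exists
  have hst : ∀ m : ℕ, ((1 * (m : ℝ) : ℝ) : ℂ) ∈ standardStrip L :=
    fun m => real_mem_strip hL _
  have hne : ∀ m : ℕ, h i ((1 * (m : ℝ) : ℝ) : ℂ) ≠ p i := fun m =>
    (hh i).ne_of_map_map_eq (by rw [hfix, hfix]) (hst m)
  have ht := (hend i).tendsto_real hL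
  have hNopen : ∀ᶠ m : ℕ in atTop, h i ((1 * (m : ℝ) : ℝ) : ℂ) ∈ param p₀ '' Metric.ball 0 ρ :=
    ht ((isOpenMap_param p₀ _ Metric.isOpen_ball).mem_nhds ⟨_, hi2, hi1⟩)
  have hdt : Tendsto (fun m : ℕ => ‖chart p₀ (h i ((1 * (m : ℝ) : ℝ) : ℂ)) - chart p₀ (p i)‖)
      atTop (𝓝 0) := by
    have hc := continuousAt_chart_param p₀ (chart p₀ (p i))
    rw [hi1] at hc
    have hc2 := ((hc.tendsto.comp ht).sub_const (chart p₀ (p i))).norm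
    rw [sub_self, norm_zero] at hc2
    exact hc2
  obtain ⟨M, hM⟩ := eventually_atTop.1 hNopen
  refine not_tendsto_zero_of_le_succ (d := fun m : ℕ =>
    ‖chart p₀ (h i ((1 * ((m + M : ℕ) : ℝ) : ℝ) : ℂ)) - chart p₀ (p i)‖) (fun m => ?_)
    (Eventually.of_forall fun m => ?_) (hdt.comp (tendsto_add_atTop_nat M))
  · rw [norm_pos_iff, sub_ne_zero]
    intro he
    obtain ⟨w, hw, hwe⟩ := hM (m + M) (Nat.le_add_left _ _)
    refine hne (m + M) ?_
    rw [← hi1, ← he, param_chart_of_mem ⟨w, hwe⟩]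
  · obtain ⟨w, hw, hwe⟩ := hM (m + 1 + M) (Nat.le_add_left _ _)
    have h1 := (hi w hw).2 _ hi2
    have h2 : f i (param p₀ w) = h i ((1 * ((m + M : ℕ) : ℝ) : ℝ) : ℂ) := by
      rw [hwe, (hh i).map_eq _ (hst _)]
      congr 1
      push_cast
      ring
    rw [Function.comp_apply, h2, hi1, hfix] at h1
    rw [← hwe, chart_param]
    have h3 := norm_sub_norm_le
      (chart p₀ (h i ((1 * ((m + M : ℕ) : ℝ) : ℝ) : ℂ)) - chart p₀ (p i))
      (multiplier g p₀ * (w - chart p₀ (p i)))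
    rw [norm_mul] at h3
    nlinarith

/-- Limits of ends of strips are limits of points on the central lines. -/
theorem exists_tendsto_of_ends {L : ℝ} {h : ℕ → ℂ → Sphere} {p : ℕ → Sphere} {𝒰 : Filter ℕ}
    (h𝒰 : 𝒰 ≤ atTop) (hL : 0 < L) {σ : ℝ} (hend : ∀ i, IsOrbitEnd L (h i) σ (p i))
    (hp : Tendsto p 𝒰 (𝓝 p₀)) : ∃ t : ℕ → ℝ, Tendsto (fun i => h i (t i)) 𝒰 (𝓝 p₀) := by
  have hex : ∀ i : ℕ, ∃ t : ℝ, dist (h i t) (p i) < 1 / ((i : ℝ) + 1) := fun i => by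
    obtain ⟨x, hx⟩ := (((hend i).tendsto_real hL).eventually
      (Metric.ball_mem_nhds (p i) (Nat.one_div_pos_of_nat (n := i)))).exists
    exact ⟨σ * x, hx⟩
  choose t ht using hex
  refine ⟨t, ?_⟩
  rw [tendsto_iff_dist_tendsto_zero] at hp ⊢
  have h1 : Tendsto (fun i : ℕ => 1 / ((i : ℝ) + 1)) 𝒰 (𝓝 0) :=
    tendsto_one_div_add_atTop_nhds_zero_nat.mono_left h𝒰
  have h2 := h1.add hp
  rw [add_zero] at h2
  refine squeeze_zero (fun _ => dist_nonneg) (fun i => ?_) h2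
  exact (dist_triangle _ (p i) _).trans (add_le_add (ht i).le le_rfl)

/-- Centres on the lines that converge to `p₀` make the re-centred strips collapse there, and
preimages of the ends provide the second omitted sequence. This is the situation of
`StripFamily.rescale`. -/
theorem multiplier_eq_one_of_ends {L : ℝ} {f : ℕ → Sphere → Sphere} {h : ℕ → ℂ → Sphere}
    {p : ℕ → Sphere} {𝒰 : Ultrafilter ℕ} (h𝒰 : (𝒰 : Filter ℕ) ≤ atTop) (hL : 0 < L)
    (hg : IsTameMap g) (hf : ∀ i, IsHolSelf (f i)) (hfg : ∀ x, CConvAt (𝒰 : Filter ℕ) f g x)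
    (hh : ∀ i, IsStripMap L (f i) (h i)) {σ : ℝ} (hend : ∀ i, IsOrbitEnd L (h i) σ (p i))
    (hp : Tendsto p 𝒰 (𝓝 p₀)) (hnorm : ‖multiplier g p₀‖ = 1) : multiplier g p₀ = 1 := by
  have hfix : ∀ i, f i (p i) = p i := fun i => (hend i).map_eq hL (hf i).continuous (hh i)
  have hp₀ : g p₀ = p₀ := fixed_of_tendsto hfg hp (Eventually.of_forall hfix)
  obtain ⟨q, q₀, hne, hq, hfq⟩ := exists_omitted hg (Eventually.of_forall hf) hfg hp hp₀
    (norm_ne_zero_iff.1 (by rw [hnorm]; exact one_ne_zero))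
  have hqfix : ∀ᶠ i in (𝒰 : Filter ℕ), f i (f i (q i)) = f i (q i) := by
    filter_upwards [hfq] with i hi
    rw [hi, hfix]
  have hF : StripFamily L (𝒰 : Filter ℕ) f g h :=
    ⟨hL, hfg, hh, p, q, p₀, q₀, hne, hp, hq,
      Eventually.of_forall fun i => by rw [hfix, hfix], hqfix⟩
  obtain ⟨t, hlim⟩ := exists_tendsto_of_ends h𝒰 hL hend hp
  exact (hF.rescale (Eventually.of_forall hf) hp (Eventually.of_forall hfix) hq hne hqfix
    (tendsto_nhds_unique (tendsto_limMap_zero 𝒰 h t) hlim)).1 hnorm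

end Ends

/-! ### Traps at hyperbolic fixed points -/

section Traps

variable {ι : Type*} {𝒰 : Filter ι} [𝒰.NeBot] {f : ι → Sphere → Sphere} {g : Sphere → Sphere}
  {p : Sphere}

theorem param_image_mem_nhds (p : Sphere) {r : ℝ} (hr : 0 < r) :
    param p '' Metric.closedBall 0 r ∈ 𝓝 p := by
  have := (isOpenMap_param p).image_mem_nhds (Metric.closedBall_mem_nhds (0 : ℂ) hr)
  rwa [param_zero] at this

/-- `K` is a closed disk in the centred chart. There `f i` contracts by `‖multiplier g p‖ + ε = 1 -
ε`, and the spare `ε * s` absorbs the displacement of `p`, which `f i` need not fix. The estimate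
for `g` itself excludes other fixed points. -/
theorem exists_attracting_trap (hg : IsHolSelf g) (hf : ∀ i, IsHolSelf (f i))
    (hfg : ∀ x, CConvAt 𝒰 f g x) (hp : g p = p) (hmul : ‖multiplier g p‖ < 1) :
    ∃ K ∈ 𝓝 p, IsCompact K ∧ (∀ᶠ i in 𝒰, MapsTo (f i) K K) ∧ ∀ y ∈ K, g y = y → y = p := by
  set ε := (1 - ‖multiplier g p‖) / 2 with hε
  have hε0 : 0 < ε := by rw [hε]; linarith
  obtain ⟨ρ, hρ, hsd⟩ := exists_ball_strict_diff (Eventually.of_forall hf) hfg hp hε0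
  obtain ⟨ρ', hρ', hsd'⟩ := exists_ball_strict_diff (𝒰 := 𝒰) (f := fun _ => g)
    (Eventually.of_forall fun _ => hg)
    (fun x => cconvAt_const hg.continuous.continuousAt) hp hε0
  obtain ⟨_, hsd'⟩ := hsd'.exists
  set s := min ρ ρ' / 2 with hs
  have hs0 : 0 < s := by positivity
  have hsρ : s < ρ := by
    have := min_le_left ρ ρ'
    rw [hs]; linarith
  have hsρ' : s < ρ' := by
    have := min_le_right ρ ρ'
    rw [hs]; linarith
  have hzero : ∀ᶠ i in 𝒰, ‖chart p (f i p)‖ < ε * s := by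
    have h1 := (hfg p).tendsto
    rw [hp] at h1
    have h2 := ((tendsto_chart p).comp h1).norm
    rw [norm_zero] at h2
    exact h2.eventually_lt_const (by positivity)
  refine ⟨param p '' Metric.closedBall 0 s, param_image_mem_nhds p hs0,
    (isCompact_closedBall _ _).image (continuous_param p), ?_, ?_⟩
  · filter_upwards [hsd, hzero] with i h1 h2
    rintro _ ⟨w, hw, rfl⟩
    have hwρ := Metric.closedBall_subset_ball hsρ hw
    refine ⟨chart p (f i (param p w)), ?_, param_chart_of_mem (h1 w hwρ).1⟩
    have h3 := (h1 w hwρ).2 0 (Metric.mem_ball_self hρ)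
    rw [param_zero, sub_zero] at h3
    rw [mem_closedBall_zero_iff] at hw ⊢
    have h4 : ‖chart p (f i (param p w))‖ ≤ ‖chart p (f i (param p w)) - chart p (f i p)
        - multiplier g p * w‖ + (‖chart p (f i p)‖ + ‖multiplier g p * w‖) := by
      calc ‖chart p (f i (param p w))‖ = ‖(chart p (f i (param p w)) - chart p (f i p)
        - multiplier g p * w) + (chart p (f i p) + multiplier g p * w)‖ := by congr 1; ring
        _ ≤ _ := (norm_add_le _ _).trans (by gcongr; exact norm_add_le _ _)
    rw [norm_mul] at h4
    have h5 : (ε + ‖multiplier g p‖) * ‖w‖ ≤ (ε + ‖multiplier g p‖) * s :=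
      mul_le_mul_of_nonneg_left hw (by positivity)
    have h6 : (2 * ε + ‖multiplier g p‖) * s = s := by rw [hε]; ring
    linarith
  · rintro _ ⟨w, hw, rfl⟩ hgw
    have h3 := (hsd' w (Metric.closedBall_subset_ball hsρ' hw)).2 0 (Metric.mem_ball_self hρ')
    rw [param_zero, sub_zero, hgw, chart_param, hp, chart_self, sub_zero] at h3
    have h4 : ‖w‖ ≤ ‖w - multiplier g p * w‖ + ‖multiplier g p * w‖ := by
      calc ‖w‖ = ‖(w - multiplier g p * w) + multiplier g p * w‖ := by congr 1; ring
        _ ≤ _ := norm_add_le _ _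
    rw [norm_mul] at h4
    have h5 : ‖w‖ * ε ≤ 0 := by
      have : 1 - ‖multiplier g p‖ = 2 * ε := by rw [hε]; ring
      nlinarith
    have h6 : w = 0 := by
      by_contra hw0
      have := mul_pos (norm_pos_iff.2 hw0) hε0
      linarith
    rw [h6, param_zero]

/-- A trap for backward orbits: `f i` expands by at least `1 + ε` on the larger disk `O`, so a point
of `O` with image in `K` was already in `K`. The restriction to `O` is essential, since `K` may have
other preimages elsewhere. -/
theorem exists_repelling_trap (hg : IsHolSelf g) (hf : ∀ i, IsHolSelf (f i))
    (hfg : ∀ x, CConvAt 𝒰 f g x) (hp : g p = p) (hmul : 1 < ‖multiplier g p‖) :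
    ∃ K ∈ 𝓝 p, ∃ O : Set Sphere, IsCompact K ∧ IsOpen O ∧ K ⊆ O ∧
      (∀ᶠ i in 𝒰, ∀ y ∈ O, f i y ∈ K → y ∈ K) ∧ ∀ y ∈ K, g y = y → y = p := by
  set ε := (‖multiplier g p‖ - 1) / 2 with hε
  have hε0 : 0 < ε := by rw [hε]; linarith
  obtain ⟨ρ, hρ, hsd⟩ := exists_ball_strict_diff (Eventually.of_forall hf) hfg hp hε0
  obtain ⟨ρ', hρ', hsd'⟩ := exists_ball_strict_diff (𝒰 := 𝒰) (f := fun _ => g)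
    (Eventually.of_forall fun _ => hg)
    (fun x => cconvAt_const hg.continuous.continuousAt) hp hε0
  obtain ⟨_, hsd'⟩ := hsd'.exists
  set s := min ρ ρ' / 2 with hs
  have hs0 : 0 < s := by positivity
  have hsρ : s < ρ := by
    have := min_le_left ρ ρ'
    rw [hs]; linarith
  have hsρ' : s < ρ' := by
    have := min_le_right ρ ρ'
    rw [hs]; linarith
  have hzero : ∀ᶠ i in 𝒰, ‖chart p (f i p)‖ < ε * s := by
    have h1 := (hfg p).tendsto
    rw [hp] at h1
    have h2 := ((tendsto_chart p).comp h1).norm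
    rw [norm_zero] at h2
    exact h2.eventually_lt_const (by positivity)
  have hexp : ∀ {a w : ℂ}, ‖a - multiplier g p * w‖ ≤ ε * ‖w‖ → (1 + ε) * ‖w‖ ≤ ‖a‖ := by
    intro a w haw
    have h4 := norm_sub_norm_le (multiplier g p * w) (multiplier g p * w - a)
    rw [sub_sub_cancel, norm_mul, norm_sub_rev (multiplier g p * w)] at h4
    have h5 : ‖multiplier g p‖ = 1 + 2 * ε := by rw [hε]; ring
    rw [h5] at h4
    linarith
  refine ⟨param p '' Metric.closedBall 0 s, param_image_mem_nhds p hs0,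
    param p '' Metric.ball 0 ρ, (isCompact_closedBall _ _).image (continuous_param p),
    isOpenMap_param p _ Metric.isOpen_ball, image_mono (Metric.closedBall_subset_ball hsρ),
    ?_, ?_⟩
  · filter_upwards [hsd, hzero] with i h1 h2
    rintro _ ⟨w, hw, rfl⟩ ⟨w', hw', hww⟩
    refine ⟨w, ?_, rfl⟩
    have h3 := (h1 w hw).2 0 (Metric.mem_ball_self hρ)
    rw [param_zero, sub_zero, ← hww, chart_param] at h3
    have h4 := hexp h3
    rw [mem_closedBall_zero_iff] at hw' ⊢
    have h5 := norm_sub_le w' (chart p (f i p))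
    have h6 : (1 + ε) * ‖w‖ ≤ (1 + ε) * s := by linarith
    exact le_of_mul_le_mul_left h6 (by linarith)
  · rintro _ ⟨w, hw, rfl⟩ hgw
    have h3 := (hsd' w (Metric.closedBall_subset_ball hsρ' hw)).2 0 (Metric.mem_ball_self hρ')
    rw [param_zero, sub_zero, hgw, chart_param, hp, chart_self, sub_zero] at h3
    have h4 := hexp h3
    have h6 : w = 0 := by
      by_contra hw0
      have := mul_pos hε0 (norm_pos_iff.2 hw0)
      linarith
    rw [h6, param_zero]

end Traps

/-- A path whose unit steps cannot leave the closed set `K` without jumping out of a neighbourhood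
of `K` stays in `K`. -/
theorem path_trap {X : Type*} [TopologicalSpace X] {y : ℝ → X} (hy : Continuous y) {K O : Set X}
    (hK : IsClosed K) (hO : IsOpen O) (hKO : K ⊆ O) (h01 : ∀ x ∈ Icc (0 : ℝ) 1, y x ∈ K)
    (hstep : ∀ x, 0 ≤ x → y x ∈ K → y (x + 1) ∈ O → y (x + 1) ∈ K) : ∀ x, 0 ≤ x → y x ∈ K := by
  by_contra! hcon
  set S : Set ℝ := {x | 0 ≤ x ∧ y x ∉ K} with hS
  have hSne : S.Nonempty := hcon
  have hSlb : ∀ x ∈ S, 1 < x := fun x hx => by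
    by_contra! h1
    exact hx.2 (h01 x ⟨hx.1, h1⟩)
  have hbdd : BddBelow S := ⟨1, fun x hx => (hSlb x hx).le⟩
  set b := sInf S with hb
  have hb1 : 1 ≤ b := le_csInf hSne fun x hx => (hSlb x hx).le
  have hlt : ∀ x ∈ Ico 0 b, y x ∈ K := fun x hx => by
    by_contra h1
    exact absurd (csInf_le hbdd (show x ∈ S from ⟨hx.1, h1⟩)) (not_le.2 hx.2)
  have hbK : y b ∈ K := by
    have h1 : b ∈ closure (Ico 0 b) := by
      rw [closure_Ico (by linarith)]
      exact ⟨by linarith, le_rfl⟩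
    have h2 : closure (Ico 0 b) ⊆ y ⁻¹' K :=
      closure_minimal hlt (hK.preimage hy)
    exact h2 h1
  obtain ⟨δ, hδ, hδO⟩ := Metric.mem_nhds_iff.1 (hy.continuousAt (hO.mem_nhds (hKO hbK)))
  -- An escape time `x` less than `δ` and less than `1` beyond the infimum `b`: then `y x` is still
  -- in `O`, while `x - 1` precedes `b`, so the step hypothesis applies.
  obtain ⟨x, hxS, hxlt⟩ := exists_lt_of_csInf_lt hSne
    (show sInf S < b + min δ 1 by rw [← hb]; have := lt_min hδ one_pos; linarith)
  have hbx : b ≤ x := csInf_le hbdd hxS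
  have h1 : min δ 1 ≤ δ := min_le_left _ _
  have h2 : min δ 1 ≤ 1 := min_le_right _ _
  have h3 := hstep (x - 1) (by linarith) (hlt _ ⟨by linarith, by linarith⟩) (by
    rw [sub_add_cancel]
    refine hδO ?_
    rw [Metric.mem_ball, Real.dist_eq, abs_of_nonneg (by linarith)]
    linarith)
  rw [sub_add_cancel] at h3
  exact hxS.2 h3

/-! ### Strips near a fixed point end there -/

/-- The leading term of a Fatou coordinate at a fixed point with multiplier `1`. -/
theorem exists_fatou_coord {G : ℂ → ℂ} (hG : AnalyticAt ℂ G 0) (h0 : G 0 = 0) (h1 : deriv G 0 = 1)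
    (hid : ¬ ∀ᶠ w in 𝓝 0, G w = w) :
    ∃ n : ℕ, n ≠ 0 ∧ ∃ b : ℂ, b ≠ 0 ∧
      Tendsto (fun w => b / (G w) ^ n - b / w ^ n) (𝓝[≠] 0) (𝓝 1) := by
  have hD : AnalyticAt ℂ (fun w => G w - w) 0 := hG.sub analyticAt_id
  have hD' : ¬ ∀ᶠ w in 𝓝 (0 : ℂ), G w - w = 0 := by simpa only [sub_eq_zero] using hid
  obtain ⟨m, u, hu, hu0, hGu⟩ := hD.exists_eventuallyEq_pow_smul_nonzero_iff.2 hD'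
  simp only [sub_zero, smul_eq_mul] at hGu
  have hm0 : m ≠ 0 := by
    rintro rfl
    have := hGu.self_of_nhds
    simp [h0] at this
    exact hu0 this.symm
  have hm1 : m ≠ 1 := by
    rintro rfl
    have hd1 : HasDerivAt (fun w => G w - w) (deriv G 0 - 1) 0 :=
      hG.differentiableAt.hasDerivAt.sub (hasDerivAt_id' 0)
    have hd2 : HasDerivAt (fun w => w ^ 1 * u w) (u 0) 0 :=
      (((hasDerivAt_id (0 : ℂ)).pow 1).mul hu.differentiableAt.hasDerivAt).congr_deriv (by simp)
    have hd := hd1.unique (hd2.congr_of_eventuallyEq hGu)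
    rw [h1, sub_self] at hd
    exact hu0 hd.symm
  obtain ⟨n, rfl⟩ : ∃ n, m = n + 1 := ⟨m - 1, by omega⟩
  have hn : n ≠ 0 := fun h => hm1 (by omega)
  have hnC : (n : ℂ) ≠ 0 := Nat.cast_ne_zero.2 hn
  -- Here `G w = w * (1 + w ^ n * u w)`, where `n ≥ 1` because `G` agrees with the identity to first
  -- order. So `1 / (G w) ^ n - 1 / w ^ n` tends to `-n * u 0`, and `b` normalises this limit to
  -- `1`.
  refine ⟨n, hn, -1 / (n * u 0), div_ne_zero (by simp) (mul_ne_zero hnC hu0), ?_⟩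
  set b : ℂ := -1 / (n * u 0) with hb
  have hder : HasDerivAt (fun s : ℂ => ((1 + s) ^ n)⁻¹) (-n) 0 := by
    have h2 : HasDerivAt (fun s : ℂ => (1 + s) ^ n) n 0 := by
      have := ((hasDerivAt_id (0 : ℂ)).const_add 1).pow n
      exact this.congr_deriv (by simp)
    have h3 := h2.inv (by simp)
    exact h3.congr_deriv (by simp)
  have hslope := hder.tendsto_slope
  have hs : Tendsto (fun w : ℂ => w ^ n * u w) (𝓝[≠] 0) (𝓝[≠] 0) := by
    rw [tendsto_nhdsWithin_iff]
    constructor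
    · have : ContinuousAt (fun w : ℂ => w ^ n * u w) 0 :=
        (continuousAt_id.pow n).mul hu.continuousAt
      have h2 := this.tendsto.mono_left (nhdsWithin_le_nhds (s := {0}ᶜ))
      simpa [hn] using h2
    · filter_upwards [self_mem_nhdsWithin,
        (hu.continuousAt.eventually_ne hu0).filter_mono nhdsWithin_le_nhds] with w hw hw'
      exact mul_ne_zero (pow_ne_zero _ hw) hw'
  have hlim := ((hslope.comp hs).mul
    (hu.continuousAt.tendsto.mono_left (nhdsWithin_le_nhds (s := {0}ᶜ)))).const_mul b
  have hval : b * (-(n : ℂ) * u 0) = 1 := by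
    rw [hb]
    field_simp
  rw [hval] at hlim
  refine hlim.congr' ?_
  filter_upwards [self_mem_nhdsWithin, hGu.filter_mono nhdsWithin_le_nhds,
    (hu.continuousAt.eventually_ne hu0).filter_mono nhdsWithin_le_nhds] with w hw hGw huw
  have hw0 : w ≠ 0 := hw
  have hwn : w ^ n ≠ 0 := pow_ne_zero _ hw0
  have hG : G w = w * (1 + w ^ n * u w) := by linear_combination hGw
  rw [Function.comp_apply, slope_def_field, hG, mul_pow]
  simp only [sub_zero, add_zero, one_pow, inv_one]
  rw [div_eq_mul_inv b (w ^ n * _), mul_inv, ← div_div]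
  generalize ((1 + w ^ n * u w) ^ n)⁻¹ = D
  field_simp

/-- A weighted norm, adapted to half planes. -/
def sideNorm (σ : ℝ) (X : ℂ) : ℝ := σ * X.re + 2 * |X.im|

theorem sideNorm_le {σ : ℝ} (hσ : |σ| = 1) (X : ℂ) : sideNorm σ X ≤ 3 * ‖X‖ := by
  have h1 : σ * X.re ≤ ‖X‖ := by
    refine (le_abs_self _).trans ?_
    rw [abs_mul, hσ, one_mul]
    exact Complex.abs_re_le_norm X
  have h2 := Complex.abs_im_le_norm X
  unfold sideNorm
  linarith

theorem sideNorm_sub_le {σ : ℝ} (hσ : |σ| = 1) (X Y : ℂ) :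
    sideNorm σ X - 3 * ‖Y - X‖ ≤ sideNorm σ Y := by
  have h1 := sideNorm_le (σ := σ) hσ (X - Y)
  rw [norm_sub_rev] at h1
  have h2 : |X.im| ≤ |(X - Y).im| + |Y.im| := by
    have := abs_add_le (X - Y).im Y.im
    rwa [Complex.sub_im, sub_add_cancel] at this
  unfold sideNorm at h1 ⊢
  rw [Complex.sub_re] at h1
  linarith

/-- The two sectors for the signs `1` and `-1` overlap and cover the plane, so every point is well
inside one of them. -/
theorem norm_le_sideNorm (X : ℂ) : ‖X‖ ≤ sideNorm 1 X ∨ ‖X‖ ≤ sideNorm (-1) X := by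
  have h := Complex.norm_le_abs_re_add_abs_im X
  have h2 := abs_nonneg X.im
  unfold sideNorm
  rcases abs_cases X.re with h1 | h1
  · left; linarith
  · right; linarith

/-- The translation by `σ` gains `1` and an error of `1 / 8` costs at most `3 / 8`. -/
theorem sideNorm_step {σ : ℝ} (hσ : |σ| = 1) (X Y : ℂ) (h : ‖Y - X - σ‖ ≤ 1 / 8) :
    sideNorm σ X ≤ sideNorm σ Y := by
  have h1 := sideNorm_sub_le (σ := σ) hσ (X + σ) Y
  rw [show Y - (X + σ) = Y - X - σ by ring] at h1
  have h2 : sideNorm σ (X + σ) = sideNorm σ X + 1 := by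
    have : σ * σ = 1 := by rw [← abs_mul_abs_self, hσ, one_mul]
    simp only [sideNorm, Complex.add_re, Complex.add_im, Complex.ofReal_re, Complex.ofReal_im,
      add_zero]
    linear_combination this
  linarith

theorem sideNorm_smul {σ : ℝ} {c : ℝ} (hc : 0 ≤ c) (X : ℂ) :
    sideNorm σ (c * X) = c * sideNorm σ X := by
  simp only [sideNorm, Complex.re_ofReal_mul, Complex.im_ofReal_mul, abs_mul, abs_of_nonneg hc]
  ring

theorem continuous_sideNorm (σ : ℝ) : Continuous (sideNorm σ) := by
  unfold sideNorm
  fun_prop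

/-- The closed petal `sideNorm σ (b / w ^ n) ≥ R`. -/
def petal (σ : ℝ) (n : ℕ) (b : ℂ) (R : ℝ) : Set ℂ :=
  {w | R * (‖w‖ ^ n) ^ 2 ≤ sideNorm σ (b * (starRingEnd ℂ) (w ^ n))}

theorem isClosed_petal (σ : ℝ) (n : ℕ) (b : ℂ) (R : ℝ) : IsClosed (petal σ n b R) := by
  refine isClosed_le (by fun_prop) ((continuous_sideNorm σ).comp ?_)
  exact continuous_const.mul (Complex.continuous_conj.comp (continuous_id.pow n))

/-- In the definition of `petal` the condition on `b / w ^ n` is multiplied by `‖w ^ n‖ ^ 2`. This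
makes the petal closed and, for `n ≠ 0`, adds the fixed point `w = 0` to it. -/
theorem mem_petal_iff {σ : ℝ} {n : ℕ} {b : ℂ} {R : ℝ} {w : ℂ} (hw : w ≠ 0) :
    w ∈ petal σ n b R ↔ R ≤ sideNorm σ (b / w ^ n) := by
  have h1 : b * (starRingEnd ℂ) (w ^ n) = (((‖w‖ ^ n) ^ 2 : ℝ) : ℂ) * (b / w ^ n) := by
    have : (((‖w‖ ^ n) ^ 2 : ℝ) : ℂ) = w ^ n * (starRingEnd ℂ) (w ^ n) := by
      rw [← norm_pow, Complex.mul_conj, Complex.normSq_eq_norm_sq]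
    rw [this]
    field_simp
  have hpos : 0 < (‖w‖ ^ n) ^ 2 := by
    have := norm_pos_iff.2 hw
    positivity
  change R * (‖w‖ ^ n) ^ 2 ≤ _ ↔ _
  rw [h1, sideNorm_smul hpos.le, mul_comm R]
  exact mul_le_mul_iff_of_pos_left hpos

theorem norm_lt_of_mem_petal {σ : ℝ} (hσ : |σ| = 1) {n : ℕ} {b : ℂ} (hb : b ≠ 0)
    {r : ℝ} (hr : 0 < r) {w : ℂ} (h : w ∈ petal σ n b (6 * (‖b‖ / r ^ n))) : ‖w‖ < r := by
  rcases eq_or_ne w 0 with rfl | hw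
  · simpa using hr
  · have h1 := ((mem_petal_iff hw).1 h).trans (sideNorm_le hσ _)
    rw [norm_div, norm_pow] at h1
    have hb' := norm_pos_iff.2 hb
    have hw' := norm_pos_iff.2 hw
    have h2 : 0 < ‖b‖ / r ^ n := by positivity
    have h3 : ‖b‖ / r ^ n < ‖b‖ / ‖w‖ ^ n := by linarith
    rw [div_lt_div_iff_of_pos_left hb' (by positivity) (by positivity)] at h3
    exact lt_of_pow_lt_pow_left₀ n hr.le h3

theorem IsEnd.mem_of_forall {L : ℝ} (hL : 0 < L) {H : ℂ → Sphere} {σ : ℝ} {v : Sphere}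
    (hv : IsEnd L H σ v) {K : Set Sphere} (hK : IsClosed K)
    (h : ∀ m : ℕ, H ((σ * (m : ℝ) : ℝ) : ℂ) ∈ K) : v ∈ K :=
  hK.mem_of_tendsto ((hv.tendsto_real hL).comp tendsto_natCast_atTop_atTop)
    (Eventually.of_forall h)

/-! ### Strips of one map that pass near a fixed point -/

section Flower

variable {L : ℝ} {g : Sphere → Sphere} {p : Sphere}

theorem IsStripMap.forward_mem (hL : 0 < L) {H : ℂ → Sphere} (hH : IsStripMap L g H)
    {K : Set Sphere} (hK : ∀ x : ℝ, H x ∈ K → g (H x) ∈ K) (h0 : H 0 ∈ K) (m : ℕ) :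
    H (((-1) * (m : ℝ) : ℝ) : ℂ) ∈ K := by
  induction m with
  | zero => simpa using h0
  | succ m ih =>
    have h1 := hK _ ih
    rw [hH.map_eq _ (real_mem_strip hL _)] at h1
    convert h1 using 2
    push_cast
    ring

theorem isEnd_of_attracting (hL : 0 < L) (hg : IsTameMap g) (ho : HasOmittedPair g) (hp : g p = p)
    (hmul : ‖multiplier g p‖ < 1) :
    ∃ N ∈ 𝓝 p, ∀ H, IsStripMap L g H → H 0 ∈ N → IsEnd L H (-1) p := by
  obtain ⟨K, hK, hKc, hKm, hKf⟩ := exists_attracting_trap (𝒰 := (pure () : Filter Unit))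
    hg.isHolSelf (fun _ => hg.isHolSelf)
    (fun x => cconvAt_const hg.isHolSelf.continuous.continuousAt) hp hmul
  have hKm' : MapsTo g K K := by simpa using hKm
  refine ⟨K, hK, fun H hH hH0 => ?_⟩
  obtain ⟨v, hv, hve⟩ := hH.exists_isEnd hL hg.isHolSelf.continuous ho hg.finite_fixed
    (σ := -1) (by norm_num)
  have := hve.mem_of_forall hL hKc.isClosed (hH.forward_mem hL (fun x hx => hKm' hx) hH0)
  rwa [← hKf v this hv]

/-- The filter of strip maps whose base point tends to `p`. -/
def stripsAt (L : ℝ) (g : Sphere → Sphere) (p : Sphere) : Filter {H // IsStripMap L g H} :=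
  comap (fun H => H.1 0) (𝓝 p)

theorem exists_nhds_of_stripsAt {P : (ℂ → Sphere) → Prop} (h : ∀ᶠ H in stripsAt L g p, P H.1) :
    ∃ N ∈ 𝓝 p, ∀ H, IsStripMap L g H → H 0 ∈ N → P H := by
  obtain ⟨N, hN, hNP⟩ := mem_comap.1 h
  exact ⟨N, hN, fun H hH hH0 => hNP (show (⟨H, hH⟩ : {H // IsStripMap L g H}) ∈ _ from hH0)⟩

theorem limMap_of_le_stripsAt {𝒰 : Ultrafilter {H // IsStripMap L g H}}
    (h𝒰 : (𝒰 : Filter _) ≤ stripsAt L g p) : limMap 𝒰 (fun H => H.1) (fun _ => 0) 0 = p := by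
  have h1 : Tendsto (fun H : {H // IsStripMap L g H} => H.1 0) 𝒰 (𝓝 p) := tendsto_iff_comap.2 h𝒰
  have h2 := tendsto_limMap_zero 𝒰 (fun H => H.1) (fun _ => 0)
  rw [Complex.ofReal_zero] at h2
  exact tendsto_nhds_unique h2 h1

/-- Along an ultrafilter of strips whose base points tend to the fixed point `p` the limit map meets
a fixed point, so it is constant, and the convergence is uniform on `[0, 1]`. -/
theorem stripsAt_eventually_mem (hL : 0 < L) (hg : IsTameMap g) (ho : HasOmittedPair g)
    (hp : g p = p) {O : Set Sphere} (hO : IsOpen O) (hpO : p ∈ O) :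
    ∀ᶠ H in stripsAt L g p, ∀ x ∈ Icc (0 : ℝ) 1, H.1 x ∈ O := by
  refine mem_iff_ultrafilter.2 fun 𝒰 h𝒰 => ?_
  have hF : StripFamily L (𝒰 : Filter _) (fun _ => g) g (fun H : {H // IsStripMap L g H} => H.1) :=
    stripFamily_const hL _ hg.isHolSelf.continuous ho fun H => H.2
  have hl := limMap_of_le_stripsAt h𝒰
  have h1 := CConvAt.eventually_forall_mem (𝒰 := (𝒰 : Filter _))
    (φ := fun (H : {H // IsStripMap L g H}) w => H.1 (w + ((0 : ℝ) : ℂ)))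
    (isCompact_Icc.image Complex.continuous_ofReal : IsCompact (Complex.ofReal '' Icc (0 : ℝ) 1)) hO
    (fun z hz => hF.cconvAt (fun _ => 0) (by
      obtain ⟨x, -, rfl⟩ := hz
      exact real_mem_strip hL x)) (fun z hz => by
      obtain ⟨x, -, rfl⟩ := hz
      rw [hF.eq_of_fixed (zero_mem_strip hL) (by rw [hl, hp]) (real_mem_strip hL x), hl]
      exact hpO)
  filter_upwards [h1] with H hH x hx
  simpa using hH x ⟨x, hx, rfl⟩

/-- `StripFamily.rescale` for constant sequences `p` and `q`: a unit segment of the strip is small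
compared with its distance to `p`. -/
theorem stripsAt_eventually_ratio (hL : 0 < L) (hg : IsTameMap g)
    (hp : g p = p) (hmul : multiplier g p = 1) {O : Set ℂ} (hO : IsOpen O) (h1O : 1 ∈ O) :
    ∀ᶠ H in stripsAt L g p, ∀ x ∈ Icc (0 : ℝ) 1, chart p (H.1 x) / chart p (H.1 0) ∈ O := by
  refine mem_iff_ultrafilter.2 fun 𝒰 h𝒰 => ?_
  obtain ⟨q, hqp, hq⟩ := hg.exists_preimage p hp (by rw [hmul]; exact one_ne_zero)
  have hF : StripFamily L (𝒰 : Filter _) (fun _ => g) g (fun H : {H // IsStripMap L g H} => H.1) :=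
    stripFamily_const hL _ hg.isHolSelf.continuous
      ⟨p, q, hqp.symm, by rw [hp, hp], by rw [hq, hp]⟩ fun H => H.2
  have hl := limMap_of_le_stripsAt h𝒰
  have hr := (hF.rescale (p := fun _ => p) (q := fun _ => q)
    (Eventually.of_forall fun _ => hg.isHolSelf) tendsto_const_nhds
    (Eventually.of_forall fun _ => hp) tendsto_const_nhds hqp.symm
    (Eventually.of_forall fun _ => by rw [hq, hp]) hl).2 hmul
  have h1 := CConvAt.eventually_forall_mem (𝒰 := (𝒰 : Filter _))
    (φ := fun (H : {H // IsStripMap L g H}) w => (chart p (H.1 (w + ((0 : ℝ) : ℂ))) - chart p p)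
        / (chart p (H.1 ((0 : ℝ) : ℂ)) - chart p p)) (Φ := fun _ => 1)
    (isCompact_Icc.image Complex.continuous_ofReal : IsCompact (Complex.ofReal '' Icc (0 : ℝ) 1)) hO
    (fun z hz => hr z (by
      obtain ⟨x, -, rfl⟩ := hz
      exact real_mem_strip hL x)) (fun z hz => h1O)
  filter_upwards [h1] with H hH x hx
  simpa using hH x ⟨x, hx, rfl⟩

theorem isEnd_of_repelling (hL : 0 < L) (hg : IsTameMap g) (ho : HasOmittedPair g) (hp : g p = p)
    (hmul : 1 < ‖multiplier g p‖) :
    ∃ N ∈ 𝓝 p, ∀ H, IsStripMap L g H → H 0 ∈ N → IsEnd L H 1 p := by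
  obtain ⟨K, hK, O, hKc, hO, hKO, hKm, hKf⟩ := exists_repelling_trap
    (𝒰 := (pure () : Filter Unit)) hg.isHolSelf (fun _ => hg.isHolSelf)
    (fun x => cconvAt_const hg.isHolSelf.continuous.continuousAt) hp hmul
  have hKm' : ∀ y ∈ O, g y ∈ K → y ∈ K := by simpa using hKm
  refine exists_nhds_of_stripsAt ?_
  filter_upwards [stripsAt_eventually_mem hL hg ho hp isOpen_interior
    (mem_interior_iff_mem_nhds.2 hK)] with ⟨H, hH⟩ h01
  obtain ⟨v, hv, hve⟩ := hH.exists_isEnd hL hg.isHolSelf.continuous ho hg.finite_fixed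
    (σ := 1) (by norm_num)
  have hall := path_trap (hH.continuous_real hL) hKc.isClosed hO hKO
    (fun x hx => interior_subset (h01 x hx)) (fun x _ h1 h2 => hKm' _ h2 (by
      rw [hH.map_eq _ (real_mem_strip hL _)]
      simpa using h1))
  have := hve.mem_of_forall hL hKc.isClosed (fun m => hall _ (by positivity))
  rwa [← hKf v this hv]

/-- In the coordinate `X = b / w ^ n` the map is close to `X ↦ X + 1`. A base point near `p` has
large `X`, well inside one of the two sectors. In the first sector forward orbits stay in the petal;
in the second the whole backward path does, by `path_trap`. The only fixed point in either petal is
`p`, so the corresponding end is `p`. -/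
theorem isEnd_of_parabolic (hL : 0 < L) (hg : IsTameMap g) (hp : g p = p)
    (hmul : multiplier g p = 1) :
    ∃ N ∈ 𝓝 p, ∀ H, IsStripMap L g H → H 0 ∈ N → IsEnd L H (-1) p ∨ IsEnd L H 1 p := by
  obtain ⟨q, hqp, hq⟩ := hg.exists_preimage p hp (by rw [hmul]; exact one_ne_zero)
  have ho : HasOmittedPair g := ⟨p, q, hqp.symm, by rw [hp, hp], by rw [hq, hp]⟩
  set G : ℂ → ℂ := fun w => chart p (g (param p w)) with hGdef
  have hcont : Continuous fun w => g (param p w) :=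
    hg.isHolSelf.continuous.comp (continuous_param p)
  have hrange : ∀ᶠ w in 𝓝 (0 : ℂ), g (param p w) ∈ range (param p) := by
    refine hcont.continuousAt (x := 0) ?_
    rw [param_zero, hp]
    simpa using range_param_mem_nhds p 0
  have hGan : AnalyticAt ℂ G 0 := by
    rw [Complex.analyticAt_iff_eventually_differentiableAt]
    filter_upwards [hrange] with w hw
    exact (hg.isHolSelf.holomorphicOn_param p).differentiableAt_chart (mem_univ w) hw
  have hG0 : G 0 = 0 := by simp [hGdef, hp]
  have hG1 : deriv G 0 = 1 := by rw [← hmul, multiplier_eq]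
  have hid : ¬ ∀ᶠ w in 𝓝 (0 : ℂ), G w = w := by
    intro h
    have h2 : {w | g (param p w) = param p w} ∈ 𝓝 (0 : ℂ) := by
      filter_upwards [h, hrange] with w hw hr
      rw [← param_chart_of_mem hr]
      exact congrArg _ hw
    exact infinite_of_mem_nhds _ h2 (hg.finite_fixed.preimage (param_injective p).injOn)
  obtain ⟨n, hn, b, hb, hlim⟩ := exists_fatou_coord hGan hG0 hG1 hid
  obtain ⟨r, hr, hball⟩ : ∃ r > 0, ∀ w : ℂ, w ≠ 0 → ‖w‖ < r →
      g (param p w) ∈ range (param p) ∧ ‖b / (G w) ^ n - b / w ^ n - 1‖ ≤ 1 / 8 := by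
    have h1 : ∀ᶠ w in 𝓝[≠] (0 : ℂ), ‖b / (G w) ^ n - b / w ^ n - 1‖ ≤ 1 / 8 := by
      filter_upwards [hlim (Metric.closedBall_mem_nhds 1 (by norm_num : (0 : ℝ) < 1 / 8))] with w hw
      simpa [dist_eq_norm] using hw
    rw [eventually_nhdsWithin_iff] at h1
    obtain ⟨r, hr, h2⟩ := Metric.eventually_nhds_iff.1 (h1.and hrange)
    exact ⟨r, hr, fun w hw hwr => ⟨(h2 (by simpa using hwr)).2,
      (h2 (by simpa using hwr)).1 hw⟩⟩
  set R : ℝ := 6 * (‖b‖ / r ^ n) with hR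
  have hRpos : 0 < R := by
    have := norm_pos_iff.2 hb
    positivity
  have hlt : ∀ {σ : ℝ}, |σ| = 1 → ∀ w ∈ petal σ n b R, ‖w‖ < r := fun hσ w hw =>
    norm_lt_of_mem_petal hσ hb hr hw
  have hcl : ∀ {σ : ℝ}, |σ| = 1 → IsCompact (param p '' petal σ n b R) := fun {σ} hσ =>
    ((isCompact_closedBall (0 : ℂ) r).of_isClosed_subset (isClosed_petal _ _ _ _)
      fun w hw => mem_closedBall_zero_iff.2 (hlt hσ w hw).le).image (continuous_param p)
  have hfix : ∀ {σ : ℝ}, |σ| = 1 → ∀ v ∈ param p '' petal σ n b R, g v = v → v = p := by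
    rintro σ hσ _ ⟨w, hw, rfl⟩ hgw
    by_contra hne
    have hw0 : w ≠ 0 := fun h => hne (by rw [h, param_zero])
    have h1 := (hball w hw0 (hlt hσ w hw)).2
    rw [hGdef] at h1
    simp only [hgw, chart_param, sub_self, zero_sub, norm_neg, norm_one] at h1
    norm_num at h1
  have hne : ∀ {H : ℂ → Sphere}, IsStripMap L g H → ∀ (x : ℝ) (w : ℂ), param p w = H x → w ≠ 0 := by
    rintro H hH x w hw rfl
    rw [param_zero] at hw
    exact hH.ne_of_map_map_eq (by rw [hp, hp]) (real_mem_strip hL x) hw.symm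
  have hstart : ∀ᶠ H in stripsAt L g p, H.1 0 ∈ range (param p) ∧
      2 * R ≤ ‖b / (chart p (H.1 0)) ^ n‖ := by
    have h1 : ∀ᶠ y in 𝓝 p, y ∈ range (param p) := by
      have := range_param_mem_nhds p 0
      rwa [param_zero] at this
    have h2 : ∀ᶠ y in 𝓝 p, 2 * R * ‖chart p y‖ ^ n ≤ ‖b‖ := by
      have h3 := (((tendsto_chart p).norm.pow n).const_mul (2 * R)).eventually_le_const
        (u := ‖b‖) (by simpa [hn] using hb)
      exact h3
    have h4 : Tendsto (fun H : {H // IsStripMap L g H} => H.1 0) (stripsAt L g p) (𝓝 p) :=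
      tendsto_comap
    filter_upwards [h4.eventually h1, h4.eventually h2] with H h5 h6
    refine ⟨h5, ?_⟩
    have h7 : chart p (H.1 0) ≠ 0 := hne H.2 0 _ (by simpa using param_chart_of_mem h5)
    rwa [norm_div, norm_pow, le_div_iff₀ (pow_pos (norm_pos_iff.2 h7) n)]
  -- Along a unit segment `X` changes by at most a sixth of its initial norm, which costs at most
  -- half of that norm in `sideNorm`. Starting from at least `2 * R`, at least `R` remains.
  have hratio : ∀ᶠ H in stripsAt L g p, ∀ x ∈ Icc (0 : ℝ) 1,
      ‖((chart p (H.1 x) / chart p (H.1 0)) ^ n)⁻¹ - 1‖ < 1 / 6 := by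
    have hc : ContinuousAt (fun s : ℂ => ‖(s ^ n)⁻¹ - 1‖) 1 := by
      refine ((ContinuousAt.inv₀ (by fun_prop) (by simp)).sub continuousAt_const).norm
    have h1 : ∀ᶠ s in 𝓝 (1 : ℂ), ‖(s ^ n)⁻¹ - 1‖ < 1 / 6 :=
      hc.eventually_lt_const (by simp)
    obtain ⟨O, hO1, hO, h1O⟩ := eventually_nhds_iff.1 h1
    filter_upwards [stripsAt_eventually_ratio hL hg hp hmul hO h1O] with H hH x hx
    exact hO1 _ (hH x hx)
  refine exists_nhds_of_stripsAt ?_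
  filter_upwards [hstart, hratio, stripsAt_eventually_mem hL hg ho hp
    (isOpenEmbedding_param p).isOpen_range ⟨0, param_zero p⟩] with ⟨H, hH⟩ ⟨hs1, hs2⟩ hrat hmem
  simp only at hs1 hs2 hrat hmem
  have hw0 : chart p (H 0) ≠ 0 := hne hH 0 _ (by simpa using param_chart_of_mem hs1)
  rcases norm_le_sideNorm (b / (chart p (H 0)) ^ n) with hside | hside
  · left
    obtain ⟨v, hv, hve⟩ := hH.exists_isEnd hL hg.isHolSelf.continuous ho hg.finite_fixed
      (σ := -1) (by norm_num)
    have h1 : |(1 : ℝ)| = 1 := abs_one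
    have := hve.mem_of_forall hL (hcl h1).isClosed (hH.forward_mem hL (fun x hx => ?_) ?_)
    · rwa [← hfix h1 v this hv]
    · obtain ⟨w, hw, hwx⟩ := hx
      have hwne := hne hH x w hwx
      obtain ⟨h2, h3⟩ := hball w hwne (hlt h1 w hw)
      rw [← hwx]
      refine ⟨G w, ?_, param_chart_of_mem h2⟩
      have h4 := sideNorm_step h1 (b / w ^ n) (b / (G w) ^ n) (by simpa using h3)
      have h5 := ((mem_petal_iff hwne).1 hw).trans h4
      refine (mem_petal_iff fun h6 => ?_).2 h5
      rw [h6, zero_pow hn, div_zero] at h5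
      simp [sideNorm] at h5
      linarith
    · refine ⟨chart p (H 0), (mem_petal_iff hw0).2 ?_, param_chart_of_mem hs1⟩
      linarith
  · right
    obtain ⟨v, hv, hve⟩ := hH.exists_isEnd hL hg.isHolSelf.continuous ho hg.finite_fixed
      (σ := 1) (by norm_num)
    have h1 : |(-1 : ℝ)| = 1 := by simp
    have hall := path_trap (hH.continuous_real hL) (hcl h1).isClosed
      (isOpenMap_param p _ (Metric.isOpen_ball (x := (0 : ℂ)) (ε := r)))
      (image_mono fun w hw => mem_ball_zero_iff.2 (hlt h1 w hw)) (fun x hx => ?_)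
      (fun x _ h2 h3 => ?_)
    · have := hve.mem_of_forall hL (hcl h1).isClosed (fun m => hall _ (by positivity))
      rwa [← hfix h1 v this hv]
    · have hxr := param_chart_of_mem (hmem x hx)
      have hwx := hne hH x _ hxr
      refine ⟨chart p (H x), (mem_petal_iff hwx).2 ?_, hxr⟩
      have h2 := sideNorm_sub_le h1 (b / (chart p (H 0)) ^ n) (b / (chart p (H x)) ^ n)
      have h3 : b / (chart p (H x)) ^ n - b / (chart p (H 0)) ^ n =
          b / (chart p (H 0)) ^ n * (((chart p (H x) / chart p (H 0)) ^ n)⁻¹ - 1) := by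
        rw [div_pow]
        field_simp
      rw [h3, norm_mul] at h2
      have h4 := mul_le_mul_of_nonneg_left (hrat x hx).le (norm_nonneg (b / (chart p (H 0)) ^ n))
      linarith
    · obtain ⟨w, hw, hwx⟩ := h2
      obtain ⟨w', hw', hwx'⟩ := h3
      have hwne := hne hH x w hwx
      have hwne' := hne hH (x + 1) w' hwx'
      have h4 : G w' = w := by
        rw [hGdef]
        simp only
        rw [hwx', hH.map_eq _ (real_mem_strip hL _)]
        push_cast
        rw [add_sub_cancel_right, ← hwx, chart_param]
      have h5 := (hball w' hwne' (mem_ball_zero_iff.1 hw')).2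
      rw [h4] at h5
      refine ⟨w', (mem_petal_iff hwne').2 (((mem_petal_iff hwne).1 hw).trans ?_), hwx'⟩
      refine sideNorm_step h1 _ _ ?_
      rw [← norm_neg]
      refine le_of_eq_of_le (congrArg _ ?_) h5
      push_cast
      ring

end Flower

/-! ### The limit set of a family of strips -/

theorem exists_first_exit {X : Type*} [TopologicalSpace X] {y : ℝ → X} (hy : Continuous y)
    {B : Set X} (hB : IsOpen B) (h0 : y 0 ∈ B) {d : ℝ} (hd : 0 ≤ d) (hyd : y d ∉ B) :
    ∃ T, 0 ≤ T ∧ y T ∈ frontier B ∧ ∀ x ∈ Icc 0 T, y x ∈ closure B := by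
  set S : Set ℝ := {x | 0 ≤ x ∧ y x ∉ B} with hS
  have hSne : S.Nonempty := ⟨d, hd, hyd⟩
  have hbdd : BddBelow S := ⟨0, fun x hx => hx.1⟩
  have hScl : IsClosed S := isClosed_Ici.inter (hB.isClosed_compl.preimage hy)
  have hTS : sInf S ∈ S := hScl.csInf_mem hSne hbdd
  have hlt : ∀ x ∈ Ico 0 (sInf S), y x ∈ B := fun x hx => by
    by_contra h1
    exact absurd (csInf_le hbdd (show x ∈ S from ⟨hx.1, h1⟩)) (not_le.2 hx.2)
  have hT0 : sInf S ≠ 0 := fun h => by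
    rw [h] at hTS
    exact hTS.2 h0
  have hcl : ∀ x ∈ Icc 0 (sInf S), y x ∈ closure B := by
    rw [← closure_Ico hT0.symm]
    exact fun x hx => closure_mono (image_subset_iff.2 hlt) (image_closure_subset_closure_image hy
      ⟨x, hx, rfl⟩)
  refine ⟨sInf S, hTS.1, ?_, hcl⟩
  rw [hB.frontier_eq]
  exact ⟨hcl _ ⟨hTS.1, le_rfl⟩, hTS.2⟩

theorem Ultrafilter.tendsto_or_forall_lt {ι : Type*} (𝒰 : Ultrafilter ι) {d : ι → ℝ}
    (hd : ∀ᶠ i in (𝒰 : Filter ι), 0 ≤ d i) :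
    (∃ c, Tendsto d 𝒰 (𝓝 c)) ∨ ∀ x, ∀ᶠ i in (𝒰 : Filter ι), x < d i := by
  by_cases h : ∀ x, ∀ᶠ i in (𝒰 : Filter ι), x < d i
  · exact Or.inr h
  · left
    push Not at h
    obtain ⟨x, hx⟩ := h
    have hmem : Icc 0 x ∈ Ultrafilter.map d 𝒰 := by
      change ∀ᶠ i in (𝒰 : Filter ι), d i ∈ Icc 0 x
      filter_upwards [hd, hx] with i h1 h2
      exact ⟨h1, h2⟩
    obtain ⟨c, -, hc⟩ := isCompact_Icc.ultrafilter_le_nhds' _ hmem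
    exact ⟨c, hc⟩

theorem HolomorphicOn.isOpen_image {φ : ℂ → Sphere} {U : Set ℂ} (hφ : HolomorphicOn φ U)
    (hU : IsOpen U) (hinj : InjOn φ U) : IsOpen (φ '' U) := by
  rw [isOpen_iff_mem_nhds]
  rintro _ ⟨z, hz, rfl⟩
  have h := CConvAt.eventually_exists_eq (𝒰 := 𝓝 (φ z)) (φ := fun _ => φ) (Φ := φ) hU hz
    (Eventually.of_forall fun _ => hφ)
    (fun w hw => cconvAt_const (hφ.1.continuousAt (hU.mem_nhds hw)))
    (InjOn.not_eventually_eq hU hz hinj) (y := id) tendsto_id one_pos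
  filter_upwards [h] with y hy
  obtain ⟨w, -, hw, rfl⟩ := hy
  exact ⟨w, hw, rfl⟩

/-- The set of limits, along the ultrafilter `𝒰`, of points on the central lines. -/
def limSet {ι : Type*} (𝒰 : Ultrafilter ι) (h : ι → ℂ → Sphere) : Set Sphere :=
  range fun t : ι → ℝ => limMap 𝒰 h t 0

namespace StripFamily

variable {ι : Type*} {L : ℝ} {𝒰 : Ultrafilter ι} {f : ι → Sphere → Sphere}
  {g : Sphere → Sphere} {h : ι → ℂ → Sphere}

theorem limMap_real_mem (t : ι → ℝ) (x : ℝ) : limMap 𝒰 h t x ∈ limSet 𝒰 h := by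
  refine ⟨fun i => t i + x, ?_⟩
  have h1 := tendsto_limMap_zero 𝒰 h (fun i => t i + x)
  refine tendsto_nhds_unique h1 ((tendsto_limMap 𝒰 h t x).congr fun i => ?_)
  push_cast
  rw [add_comm]

/-- This is the isolation of edges. If points of the central lines converge to `limMap 𝒰 h t w`,
then their real parameters relative to `t` converge to `w`. -/
theorem exists_real_of_mem (hF : StripFamily L 𝒰 f g h) {t : ι → ℝ}
    (ht : IsStripMap L g (limMap 𝒰 h t)) {w : ℂ} (hw : w ∈ standardStrip L)
    (hmem : limMap 𝒰 h t w ∈ limSet 𝒰 h) : ∃ x : ℝ, w = x := by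
  obtain ⟨s, hs⟩ := hmem
  have h1 := hF.tendsto_sub ht hw (s := fun i => (s i : ℂ)) (fun i => real_mem_strip hF.pos _) (by
    simp only at hs
    rw [← hs]
    exact tendsto_limMap_zero 𝒰 h s)
  have h2 := (Complex.continuous_im.tendsto w).comp h1
  have h3 : w.im = 0 := tendsto_nhds_unique h2 (by simp [Function.comp_def])
  exact ⟨w.re, Complex.ext rfl (by simpa using h3)⟩

/-- A common point of two limits is approximated by points of the same strips, whose parameters
relative to `t` must converge; comparing them bounds the drift between the two sequences of centres.
-/
theorem exists_shift_of_eq (hF : StripFamily L 𝒰 f g h) {t s : ι → ℝ}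
    (ht : IsStripMap L g (limMap 𝒰 h t)) {w w' : ℂ} (hw : w ∈ standardStrip L)
    (hw' : w' ∈ standardStrip L) (he : limMap 𝒰 h s w' = limMap 𝒰 h t w) :
    ∃ c : ℝ, Tendsto (fun i => s i - t i) 𝒰 (𝓝 c) := by
  have h1 := hF.tendsto_sub ht hw (s := fun i => w' + s i) (fun i => add_real_mem_strip hw' _) (by
    rw [← he]
    exact tendsto_limMap 𝒰 h s w')
  have h2 := (Complex.continuous_re.tendsto _).comp (h1.sub_const w')
  refine ⟨(w - w').re, h2.congr fun i => ?_⟩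
  simp only [Function.comp_apply, Complex.sub_re, Complex.add_re, Complex.ofReal_re]
  ring

theorem image_eq_of_tendsto (hF : StripFamily L 𝒰 f g h) {t s : ι → ℝ} {c : ℝ}
    (hc : Tendsto (fun i => s i - t i) 𝒰 (𝓝 c)) :
    limMap 𝒰 h s '' standardStrip L = limMap 𝒰 h t '' standardStrip L := by
  ext y
  constructor
  · rintro ⟨z, hz, rfl⟩
    exact ⟨z + c, add_real_mem_strip hz c, (hF.limMap_eq_of_tendsto hc hz).symm⟩
  · rintro ⟨z, hz, rfl⟩
    have hz' := add_real_mem_strip hz (-c)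
    refine ⟨z + (-c : ℝ), hz', ?_⟩
    rw [hF.limMap_eq_of_tendsto hc hz']
    congr 1
    push_cast
    ring

/-- If the limit set meets both `B` (in a fixed point) and the exterior of `B`, then some strip in
the limit leaves `B` through its frontier. -/
theorem exists_crossing (hF : StripFamily L 𝒰 f g h) {B : Set Sphere} (hB : IsOpen B)
    (hfr : ∀ y ∈ frontier B, g y ≠ y) {t s : ι → ℝ} (htB : limMap 𝒰 h t 0 ∈ B)
    (htf : g (limMap 𝒰 h t 0) = limMap 𝒰 h t 0)
    (hsB : ∀ᶠ i in (𝒰 : Filter ι), h i (s i) ∉ B) :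
    ∃ (τ : ι → ℝ) (σ : ℝ), (σ = 1 ∨ σ = -1) ∧ IsStripMap L g (limMap 𝒰 h τ) ∧
      limMap 𝒰 h τ 0 ∈ frontier B ∧ ∀ x : ℝ, 0 ≤ x → limMap 𝒰 h τ ((σ * x : ℝ) : ℂ) ∈ closure B := by
  have h0 := zero_mem_strip hF.pos
  -- Along an ultrafilter the direction from `t i` to `s i` is constant.
  obtain ⟨ε, hε, hd⟩ : ∃ ε : ℝ, (ε = 1 ∨ ε = -1) ∧
      ∀ᶠ i in (𝒰 : Filter ι), 0 ≤ ε * (s i - t i) := by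
    rcases Ultrafilter.em 𝒰 (fun i => t i ≤ s i) with h1 | h1
    · exact ⟨1, Or.inl rfl, h1.mono fun i hi => by linarith⟩
    · exact ⟨-1, Or.inr rfl, h1.mono fun i hi => by linarith [not_le.1 hi]⟩
  have hεε : ε * ε = 1 := by rcases hε with rfl | rfl <;> norm_num
  have hBt : ∀ᶠ i in (𝒰 : Filter ι), h i (t i) ∈ B :=
    (tendsto_limMap_zero 𝒰 h t) (hB.mem_nhds htB)
  have hex : ∀ᶠ i in (𝒰 : Filter ι), ∃ T, 0 ≤ T ∧ h i (t i + ε * T : ℝ) ∈ frontier B ∧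
      ∀ x ∈ Icc 0 T, h i (t i + ε * x : ℝ) ∈ closure B := by
    filter_upwards [hBt, hsB, hd] with i h1 h2 h3
    refine exists_first_exit (y := fun x : ℝ => h i (t i + ε * x : ℝ))
      (((hF.strip i).continuous_real hF.pos).comp (by fun_prop)) hB (by simpa using h1) h3 ?_
    simp only [← mul_assoc, hεε, one_mul, add_sub_cancel]
    exact h2
  classical
  let T : ι → ℝ := fun i => if h' : ∃ T, 0 ≤ T ∧ h i (t i + ε * T : ℝ) ∈ frontier B ∧
      ∀ x ∈ Icc 0 T, h i (t i + ε * x : ℝ) ∈ closure B then h'.choose else 0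
  have hT : ∀ᶠ i in (𝒰 : Filter ι), 0 ≤ T i ∧ h i (t i + ε * T i : ℝ) ∈ frontier B ∧
      ∀ x ∈ Icc 0 (T i), h i (t i + ε * x : ℝ) ∈ closure B := by
    filter_upwards [hex] with i hi
    simp only [T, dif_pos hi]
    exact hi.choose_spec
  set τ : ι → ℝ := fun i => t i + ε * T i with hτ
  have hτfr : limMap 𝒰 h τ 0 ∈ frontier B :=
    isClosed_frontier.mem_of_tendsto (tendsto_limMap_zero 𝒰 h τ) (hT.mono fun i hi => hi.2.1)
  have hstrip : IsStripMap L g (limMap 𝒰 h τ) := hF.isStripMap_of_ne h0 (hfr _ hτfr)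
  -- If the exit times had a finite limit, the exit points would converge to a value of the limit
  -- re-centred at `t`. That limit is constant with value in `B`, which is disjoint from the
  -- frontier of `B`.
  have hlarge : ∀ x, ∀ᶠ i in (𝒰 : Filter ι), x < T i := by
    refine (Ultrafilter.tendsto_or_forall_lt 𝒰 (hT.mono fun i hi => hi.1)).resolve_left ?_
    rintro ⟨c, hc⟩
    have h1 : Tendsto (fun i => τ i - t i) 𝒰 (𝓝 (ε * c)) :=
      (hc.const_mul ε).congr fun i => by rw [hτ]; ring
    have h2 := hF.limMap_eq_of_tendsto h1 h0
    rw [hF.eq_of_fixed h0 htf (add_real_mem_strip h0 _)] at h2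
    rw [h2, hB.frontier_eq] at hτfr
    exact hτfr.2 htB
  -- Seen from the exit point, the part of the path that stays in the closure of `B` lies behind, in
  -- direction `-ε`, and its length tends to infinity.
  refine ⟨τ, -ε, ?_, hstrip, hτfr, fun x hx => ?_⟩
  · rcases hε with rfl | rfl
    · exact Or.inr rfl
    · exact Or.inl (by norm_num)
  · refine isClosed_closure.mem_of_tendsto (tendsto_limMap 𝒰 h τ _) ?_
    filter_upwards [hT, hlarge x] with i h1 h2
    have h3 := h1.2.2 (T i - x) ⟨by linarith, by linarith⟩
    convert h3 using 2
    rw [hτ]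
    push_cast
    ring

/-- Disjoint open sets separating the limit set cannot cover the connected central lines. Points of
the lines outside both converge to a point of the limit set outside both. -/
theorem isPreconnected_limSet (hF : StripFamily L 𝒰 f g h) (hcl : IsClosed (limSet 𝒰 h)) :
    IsPreconnected (limSet 𝒰 h) := by
  rw [isPreconnected_iff_subset_of_fully_disjoint_closed hcl]
  intro A B hA hB hsub hdis
  by_contra hcon
  push Not at hcon
  obtain ⟨hnA, hnB⟩ := hcon
  obtain ⟨y, ⟨t, rfl⟩, hyA⟩ := not_subset.1 hnA
  obtain ⟨y', ⟨s, rfl⟩, hyB⟩ := not_subset.1 hnB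
  simp only at hyA hyB
  have htB : limMap 𝒰 h t 0 ∈ B := (hsub ⟨t, rfl⟩).resolve_left hyA
  have hsA : limMap 𝒰 h s 0 ∈ A := (hsub ⟨s, rfl⟩).resolve_right hyB
  obtain ⟨U, W, hU, hW, hAU, hBW, hUW⟩ := normal_separation hA hB hdis
  have hex : ∀ᶠ i in (𝒰 : Filter ι), ∃ x : ℝ, h i x ∉ U ∪ W := by
    filter_upwards [(tendsto_limMap_zero 𝒰 h t) (hW.mem_nhds (hBW htB)),
      (tendsto_limMap_zero 𝒰 h s) (hU.mem_nhds (hAU hsA))] with i h1 h2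
    by_contra! hall
    have hc := (hF.strip i).continuous_real hF.pos
    have hpre := isPreconnected_univ.image _ (hc.continuousOn (s := univ))
    obtain ⟨y, -, hy⟩ := hpre U W hU hW (by
      rintro _ ⟨x, -, rfl⟩
      exact hall x) ⟨_, ⟨s i, mem_univ _, rfl⟩, h2⟩ ⟨_, ⟨t i, mem_univ _, rfl⟩, h1⟩
    exact disjoint_left.1 hUW hy.1 hy.2
  classical
  let τ : ι → ℝ := fun i => if h' : ∃ x : ℝ, h i x ∉ U ∪ W then h'.choose else 0
  have hτ : ∀ᶠ i in (𝒰 : Filter ι), h i (τ i) ∈ (U ∪ W)ᶜ := by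
    filter_upwards [hex] with i hi
    simp only [τ, dif_pos hi]
    exact hi.choose_spec
  have h1 : limMap 𝒰 h τ 0 ∈ (U ∪ W)ᶜ :=
    (hU.union hW).isClosed_compl.mem_of_tendsto (tendsto_limMap_zero 𝒰 h τ) hτ
  exact h1 ((hsub ⟨τ, rfl⟩).imp (fun h => hAU h) fun h => hBW h)

end StripFamily

/-! ### The edges and vertices of the limit -/

section

variable {L : ℝ} {g : Sphere → Sphere} {H : ℂ → Sphere} {p : Sphere}

theorem IsEnd.multiplier_eq_one (hL : 0 < L) (hg : IsTameMap g) (hH : IsStripMap L g H) {σ : ℝ}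
    (hp : IsEnd L H σ p) (hnorm : ‖multiplier g p‖ = 1) : multiplier g p = 1 :=
  multiplier_eq_one_of_ends (f := fun _ => g) (h := fun _ => H) (p := fun _ => p)
    (𝒰 := hyperfilter ℕ) (Nat.hyperfilter_le_atTop) hL hg (fun _ => hg.isHolSelf)
    (fun _ => cconvAt_const hg.isHolSelf.continuous.continuousAt) (fun _ => hH) (fun _ => hp.isOrbitEnd)
    tendsto_const_nhds hnorm

theorem IsEnd.multiplier_forward (hL : 0 < L) (hg : IsTameMap g) (hH : IsStripMap L g H)
    (hp : IsEnd L H (-1) p) : ‖multiplier g p‖ < 1 ∨ multiplier g p = 1 := by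
  have h1 := norm_multiplier_le_one_of_ends (𝒰 := (pure () : Filter Unit)) (f := fun _ => g)
    (h := fun _ => H) (p := fun _ => p) hL (fun _ => hg.isHolSelf)
    (fun _ => cconvAt_const hg.isHolSelf.continuous.continuousAt) (fun _ => hH) (fun _ => hp.isOrbitEnd)
    tendsto_const_nhds
  exact h1.lt_or_eq.imp_right (hp.multiplier_eq_one hL hg hH)

theorem IsEnd.multiplier_backward (hL : 0 < L) (hg : IsTameMap g) (hH : IsStripMap L g H)
    (hp : IsEnd L H 1 p) : 1 < ‖multiplier g p‖ ∨ multiplier g p = 1 := by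
  have h1 := one_le_norm_multiplier_of_ends (𝒰 := (pure () : Filter Unit)) (f := fun _ => g)
    (h := fun _ => H) (p := fun _ => p) hL (fun _ => hg.isHolSelf)
    (fun _ => cconvAt_const hg.isHolSelf.continuous.continuousAt) (fun _ => hH) (fun _ => hp.isOrbitEnd)
    tendsto_const_nhds
  exact h1.lt_or_eq.imp_right fun h => hp.multiplier_eq_one hL hg hH h.symm

/-- Strips that pass close to an end of a strip end there as well. -/
theorem IsEnd.exists_nhds (hL : 0 < L) (hg : IsTameMap g) (ho : HasOmittedPair g)
    (hH : IsStripMap L g H) {σ : ℝ} (hσ : σ = 1 ∨ σ = -1) (hp : IsEnd L H σ p) :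
    ∃ N ∈ 𝓝 p, ∀ K, IsStripMap L g K → K 0 ∈ N → IsEnd L K (-1) p ∨ IsEnd L K 1 p := by
  have hfix : g p = p := hp.map_eq hL hg.isHolSelf.continuous hH
  have hm : ‖multiplier g p‖ < 1 ∨ 1 < ‖multiplier g p‖ ∨ multiplier g p = 1 := by
    rcases hσ with rfl | rfl
    · exact Or.inr (hp.multiplier_backward hL hg hH)
    · exact (hp.multiplier_forward hL hg hH).imp_right Or.inr
  rcases hm with h1 | h1 | h1
  · obtain ⟨N, hN, h2⟩ := isEnd_of_attracting hL hg ho hfix h1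
    exact ⟨N, hN, fun K hK hK0 => Or.inl (h2 K hK hK0)⟩
  · obtain ⟨N, hN, h2⟩ := isEnd_of_repelling hL hg ho hfix h1
    exact ⟨N, hN, fun K hK hK0 => Or.inr (h2 K hK hK0)⟩
  · exact isEnd_of_parabolic hL hg hfix h1

theorem IsEnd.mem_of_forall_real (hL : 0 < L) {σ : ℝ} (hp : IsEnd L H σ p) {K : Set Sphere}
    (hK : IsClosed K) (h : ∀ x : ℝ, 0 ≤ x → H ((σ * x : ℝ) : ℂ) ∈ K) : p ∈ K :=
  hp.mem_of_forall hL hK fun m => h m m.cast_nonneg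

end

namespace StripFamily

variable {ι : Type*} {L : ℝ} {𝒰 : Ultrafilter ι} {f : ι → Sphere → Sphere}
  {g : Sphere → Sphere} {h : ι → ℂ → Sphere}

theorem hasOmittedPair (hF : StripFamily L 𝒰 f g h) : HasOmittedPair g := by
  obtain ⟨p, q, p₀, q₀, hne, hp, hq, hp', hq'⟩ := hF.omits
  have key : ∀ {p : ι → Sphere} {p₀ : Sphere}, Tendsto p 𝒰 (𝓝 p₀) →
      (∀ᶠ i in (𝒰 : Filter ι), f i (f i (p i)) = f i (p i)) → g (g p₀) = g p₀ := by
    intro p p₀ hp hp'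
    have h1 := (hF.conv p₀).tendsto_comp hp
    exact tendsto_nhds_unique (((hF.conv _).tendsto_comp h1).congr' hp') h1
  exact ⟨p₀, q₀, hne, key hp hp', key hq hq'⟩

theorem exists_isEnd (hF : StripFamily L 𝒰 f g h) (hg : IsTameMap g) {H : ℂ → Sphere}
    (hH : IsStripMap L g H) {σ : ℝ} (hσ : σ = 1 ∨ σ = -1) : ∃ v, g v = v ∧ IsEnd L H σ v :=
  hH.exists_isEnd hF.pos hg.isHolSelf.continuous hF.hasOmittedPair hg.finite_fixed
    (by rcases hσ with rfl | rfl <;> norm_num)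

theorem isEnd_mem_limSet (hF : StripFamily L 𝒰 f g h) (hcl : IsClosed (limSet 𝒰 h))
    {t : ι → ℝ} {σ : ℝ} {v : Sphere} (hv : IsEnd L (limMap 𝒰 h t) σ v) : v ∈ limSet 𝒰 h :=
  hv.mem_of_forall_real hF.pos hcl fun _ _ => limMap_real_mem t _

/-- Choose a ball about `v` whose closed version contains neither `y` nor another fixed point. The
crossing strip keeps one half in the closure of the ball, so its end on that side can only be `v`.
-/
theorem exists_edge_at (hF : StripFamily L 𝒰 f g h) (hg : IsTameMap g) {v y : Sphere}
    (hv : v ∈ limSet 𝒰 h) (hvf : g v = v) (hy : y ∈ limSet 𝒰 h) (hyv : y ≠ v) :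
    ∃ (t : ι → ℝ) (σ : ℝ), (σ = 1 ∨ σ = -1) ∧ IsStripMap L g (limMap 𝒰 h t) ∧
      IsEnd L (limMap 𝒰 h t) σ v := by
  obtain ⟨t, rfl⟩ := hv
  obtain ⟨s, rfl⟩ := hy
  simp only at hvf hyv ⊢
  set v := limMap 𝒰 h t 0 with hv
  have hfin : ({x | g x = x} ∪ {limMap 𝒰 h s 0} : Set Sphere).Finite :=
    hg.finite_fixed.union (finite_singleton _)
  obtain ⟨ε, hε, hball⟩ : ∃ ε > 0, ∀ x ∈ Metric.closedBall v ε,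
      x ∈ ({x | g x = x} ∪ {limMap 𝒰 h s 0} : Set Sphere) → x = v := by
    have h1 : (({x | g x = x} ∪ {limMap 𝒰 h s 0}) \ {v} : Set Sphere)ᶜ ∈ 𝓝 v :=
      (hfin.subset sdiff_subset).isClosed.isOpen_compl.mem_nhds fun h => h.2 rfl
    obtain ⟨ε, hε, h2⟩ := Metric.nhds_basis_closedBall.mem_iff.1 h1
    refine ⟨ε, hε, fun x hx hx' => ?_⟩
    by_contra hne
    exact h2 hx ⟨hx', hne⟩
  have hcl : closure (Metric.ball v ε) ⊆ Metric.closedBall v ε := Metric.closure_ball_subset_closedBall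
  have hfr : ∀ y ∈ frontier (Metric.ball v ε), g y ≠ y := fun y hy hgy => by
    rw [Metric.isOpen_ball.frontier_eq] at hy
    rw [hball y (hcl hy.1) (Or.inl hgy)] at hy
    exact hy.2 (Metric.mem_ball_self hε)
  have hsB : ∀ᶠ i in (𝒰 : Filter ι), h i (s i) ∉ Metric.ball v ε := by
    have h1 : limMap 𝒰 h s 0 ∉ Metric.closedBall v ε := fun h => hyv (hball _ h (Or.inr rfl))
    filter_upwards [tendsto_limMap_zero 𝒰 h s (Metric.isClosed_closedBall.isOpen_compl.mem_nhds h1)]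
      with i hi h2
    exact hi (Metric.ball_subset_closedBall h2)
  obtain ⟨τ, σ, hσ, hstrip, -, hmem⟩ := hF.exists_crossing Metric.isOpen_ball hfr
    (t := t) (Metric.mem_ball_self hε) hvf hsB
  obtain ⟨w, hw, hwe⟩ := hF.exists_isEnd hg hstrip hσ
  have h1 := hwe.mem_of_forall_real hF.pos isClosed_closure hmem
  refine ⟨τ, σ, hσ, hstrip, ?_⟩
  rwa [← hball w (hcl h1) (Or.inl hw)]

/-- Two vertices are related if an edge runs from the first to the second. -/
def EdgeRel (L : ℝ) (𝒰 : Ultrafilter ι) (g : Sphere → Sphere) (h : ι → ℂ → Sphere)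
    (x y : Sphere) : Prop :=
  ∃ t : ι → ℝ, IsStripMap L g (limMap 𝒰 h t) ∧ IsEnd L (limMap 𝒰 h t) 1 x ∧
    IsEnd L (limMap 𝒰 h t) (-1) y

/-- Suppose the class `C` of `v` misses `w`. Surround each point of `C` by a closed neighbourhood
that contains no fixed point outside `C` and in which every passing strip ends at that point. Going
from `w` into the union `A` of these neighbourhoods yields a strip through the frontier of `A`. One
end of it lies in `C`; the other lies in the closure of the complement of `A`, hence outside `C`,
although an edge joins the two. -/
theorem eqvGen_edgeRel (hF : StripFamily L 𝒰 f g h) (hg : IsTameMap g)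
    (hcl : IsClosed (limSet 𝒰 h)) {v w : Sphere} (hv : v ∈ limSet 𝒰 h) (hvf : g v = v)
    (hw : w ∈ limSet 𝒰 h) (hwf : g w = w) : Relation.EqvGen (EdgeRel L 𝒰 g h) v w := by
  by_contra hnot
  have hvw : v ≠ w := fun he => hnot (he ▸ Relation.EqvGen.refl v)
  set C : Set Sphere := {x | (x ∈ limSet 𝒰 h ∧ g x = x) ∧ Relation.EqvGen (EdgeRel L 𝒰 g h) v x}
    with hC
  have hCfin : C.Finite := hg.finite_fixed.subset fun x hx => hx.1.2
  have hvC : v ∈ C := ⟨⟨hv, hvf⟩, Relation.EqvGen.refl v⟩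
  have hwC : w ∉ C := fun h => hnot h.2
  have hnb : ∀ p ∈ C, ∃ N ∈ 𝓝 p, ∀ K, IsStripMap L g K → K 0 ∈ N →
      IsEnd L K (-1) p ∨ IsEnd L K 1 p := by
    intro p hp
    obtain ⟨y, hy, hyp⟩ : ∃ y ∈ limSet 𝒰 h, y ≠ p := by
      rcases eq_or_ne v p with he | he
      · exact ⟨w, hw, fun h => hvw (he.trans h.symm)⟩
      · exact ⟨v, hv, he⟩
    obtain ⟨t, σ, hσ, ht, hte⟩ := hF.exists_edge_at hg hp.1.1 hp.1.2 hy hyp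
    exact hte.exists_nhds hF.pos hg hF.hasOmittedPair ht hσ
  choose! N hN hNe using hnb
  have hDfin : ({x | g x = x} \ C : Set Sphere).Finite := hg.finite_fixed.subset sdiff_subset
  obtain ⟨M, hM, hMc, hMsub⟩ : ∃ M : Sphere → Set Sphere, (∀ p ∈ C, M p ∈ 𝓝 p) ∧
      (∀ p ∈ C, IsClosed (M p)) ∧ ∀ p ∈ C, M p ⊆ N p ∩ ({x | g x = x} \ C)ᶜ := by
    have h1 : ∀ p ∈ C, ∃ M ∈ 𝓝 p, IsClosed M ∧ M ⊆ N p ∩ ({x | g x = x} \ C)ᶜ := by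
      intro p hp
      obtain ⟨M, ⟨h2, h3⟩, h4⟩ := (closed_nhds_basis p).mem_iff.1
        (inter_mem (hN p hp) (hDfin.isClosed.isOpen_compl.mem_nhds fun h => h.2 hp))
      exact ⟨M, h2, h3, h4⟩
    choose! M h2 h3 h4 using h1
    exact ⟨M, h2, h3, h4⟩
  set A : Set Sphere := ⋃ p ∈ C, M p with hA
  have hAcl : IsClosed A := hCfin.isClosed_biUnion hMc
  have hAint : ∀ p ∈ C, A ∈ 𝓝 p := fun p hp => mem_of_superset (hM p hp) (subset_biUnion_of_mem hp)
  have hclos : ∀ p ∈ C, p ∉ closure Aᶜ := by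
    intro p hp hp'
    rw [closure_compl] at hp'
    exact hp' (mem_interior_iff_mem_nhds.2 (hAint p hp))
  obtain ⟨t, rfl⟩ := hw
  obtain ⟨s, hs⟩ := hv
  have hwA : limMap 𝒰 h t 0 ∈ Aᶜ := by
    intro h1
    obtain ⟨p, hp, h2⟩ := mem_iUnion₂.1 h1
    exact (hMsub p hp h2).2 ⟨hwf, hwC⟩
  have hfr : ∀ y ∈ frontier Aᶜ, g y ≠ y := fun y hy hgy => by
    rw [hAcl.isOpen_compl.frontier_eq] at hy
    obtain ⟨p, hp, h2⟩ := mem_iUnion₂.1 (not_not.1 hy.2)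
    have hyC : y ∈ C := by
      by_contra h3
      exact (hMsub p hp h2).2 ⟨hgy, h3⟩
    exact hclos y hyC hy.1
  have hsB : ∀ᶠ i in (𝒰 : Filter ι), h i (s i) ∉ Aᶜ := by
    have h1 := tendsto_limMap_zero 𝒰 h s
    simp only at hs
    rw [hs] at h1
    filter_upwards [h1 (hAint v hvC)] with i hi
    exact not_not.2 hi
  obtain ⟨τ, σ, hσ, hstrip, hτ, hmem⟩ := hF.exists_crossing hAcl.isOpen_compl hfr hwA hwf hsB
  have h1 : limMap 𝒰 h τ 0 ∈ A := by
    rw [hAcl.isOpen_compl.frontier_eq] at hτ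
    exact not_not.1 hτ.2
  obtain ⟨p, hp, h2⟩ := mem_iUnion₂.1 h1
  have hpe := hNe p hp _ hstrip (hMsub p hp h2).1
  obtain ⟨x, hx, hxe⟩ := hF.exists_isEnd hg hstrip hσ
  have h3 := hxe.mem_of_forall_real hF.pos isClosed_closure hmem
  have hxC : x ∉ C := fun h => hclos x h h3
  have hxp : x ≠ p := fun h => hxC (h ▸ hp)
  have hrel : EdgeRel L 𝒰 g h p x ∨ EdgeRel L 𝒰 g h x p := by
    rcases hσ with rfl | rfl
    · refine Or.inr ⟨τ, hstrip, hxe, hpe.resolve_right fun h4 => ?_⟩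
      exact hxp (hxe.unique hF.pos h4)
    · refine Or.inl ⟨τ, hstrip, hpe.resolve_left fun h4 => ?_, hxe⟩
      exact hxp (hxe.unique hF.pos h4)
  refine hxC ⟨⟨hF.isEnd_mem_limSet hcl hxe, hx⟩, hp.2.trans _ _ _ ?_⟩
  exact hrel.elim (Relation.EqvGen.rel _ _) fun h4 => (Relation.EqvGen.rel _ _ h4).symm

/-- If strips that end at `v` in the direction `σ` are trapped near `v`, and none ends at `v` in
the other direction, then there is at most one of them. -/
theorem exists_tendsto_sub_of_trapped (hF : StripFamily L 𝒰 f g h) (hg : IsTameMap g)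
    {σ : ℝ} (hσ : σ = 1 ∨ σ = -1) {v : Sphere} {K : Set Sphere} (hK : IsClosed K)
    (hKf : ∀ y ∈ K, g y = y → y = v)
    (htrap : ∀ t : ι → ℝ, IsStripMap L g (limMap 𝒰 h t) → IsEnd L (limMap 𝒰 h t) σ v →
      ∃ M : ℝ, ∀ᶠ i in (𝒰 : Filter ι), ∀ x : ℝ, M ≤ x → h i ((t i + σ * x : ℝ) : ℂ) ∈ K)
    (hno : ∀ t : ι → ℝ, IsStripMap L g (limMap 𝒰 h t) → ¬ IsEnd L (limMap 𝒰 h t) (-σ) v)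
    {t s : ι → ℝ} (ht : IsStripMap L g (limMap 𝒰 h t)) (hte : IsEnd L (limMap 𝒰 h t) σ v)
    (hs : IsStripMap L g (limMap 𝒰 h s)) (hse : IsEnd L (limMap 𝒰 h s) σ v) :
    ∃ c : ℝ, Tendsto (fun i => s i - t i) 𝒰 (𝓝 c) := by
  have hσσ : σ * σ = 1 := by rcases hσ with rfl | rfl <;> norm_num
  have key : ∀ {t s : ι → ℝ}, IsStripMap L g (limMap 𝒰 h t) → IsStripMap L g (limMap 𝒰 h s) →
      IsEnd L (limMap 𝒰 h s) σ v → (∀ᶠ i in (𝒰 : Filter ι), 0 ≤ σ * (t i - s i)) →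
      ∃ c : ℝ, Tendsto (fun i => t i - s i) 𝒰 (𝓝 c) := by
    intro t s ht hs hse hd
    rcases Ultrafilter.tendsto_or_forall_lt 𝒰 hd with ⟨c, hc⟩ | hlarge
    · refine ⟨σ * c, (hc.const_mul σ).congr fun i => ?_⟩
      rw [← mul_assoc, hσσ, one_mul]
    · exfalso
      obtain ⟨M, hM⟩ := htrap s hs hse
      -- If the centres `t i` run infinitely far ahead of `s i` in direction `σ`, the trap contains
      -- the whole line re-centred at `t`. Its opposite end would then be `v` too, which `hno`
      -- forbids.
      have hall : ∀ x : ℝ, limMap 𝒰 h t x ∈ K := by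
        intro x
        refine hK.mem_of_tendsto (tendsto_limMap 𝒰 h t x) ?_
        filter_upwards [hM, hlarge (M - σ * x)] with i h1 h2
        have h3 := h1 (σ * (t i - s i) + σ * x) (by linarith)
        convert h3 using 2
        have h4 : s i + σ * (σ * (t i - s i) + σ * x) = x + t i := by
          linear_combination (t i - s i + x) * hσσ
        rw [h4]
        push_cast
        rfl
      obtain ⟨w, hw, hwe⟩ := hF.exists_isEnd hg ht (σ := -σ) (by
        rcases hσ with rfl | rfl
        · exact Or.inr rfl
        · exact Or.inl (by norm_num))
      have h1 := hwe.mem_of_forall_real hF.pos hK fun x _ => hall _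
      rw [hKf w h1 hw] at hwe
      exact hno t ht hwe
  rcases Ultrafilter.em 𝒰 (fun i => 0 ≤ σ * (s i - t i)) with h1 | h1
  · exact key hs ht hte h1
  · obtain ⟨c, hc⟩ := key ht hs hse (h1.mono fun i hi => by
      have := not_le.1 hi
      linarith)
    exact ⟨-c, hc.neg.congr fun i => by ring⟩

/-- A unit segment of the strips close to the end `v` of a limiting strip. -/
theorem exists_segment (hF : StripFamily L 𝒰 f g h) {t : ι → ℝ}
    {σ : ℝ} {v : Sphere} (hte : IsEnd L (limMap 𝒰 h t) σ v) {K : Set Sphere} (hK : K ∈ 𝓝 v) :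
    ∃ M : ℝ, ∀ᶠ i in (𝒰 : Filter ι), ∀ x ∈ Icc M (M + 1), h i ((t i + σ * x : ℝ) : ℂ) ∈ K := by
  obtain ⟨M, hM⟩ := eventually_atTop.1
    ((hte.tendsto_real hF.pos).eventually (isOpen_interior.mem_nhds (mem_interior_iff_mem_nhds.2 hK)))
  have h1 := CConvAt.eventually_forall_mem (𝒰 := (𝒰 : Filter ι))
    (φ := fun i w => h i (w + t i)) (Φ := limMap 𝒰 h t)
    (isCompact_Icc.image (show Continuous fun x : ℝ => ((σ * x : ℝ) : ℂ) by fun_prop) :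
      IsCompact ((fun x : ℝ => ((σ * x : ℝ) : ℂ)) '' Icc M (M + 1))) isOpen_interior
    (fun z hz => hF.cconvAt t (by
      obtain ⟨x, -, rfl⟩ := hz
      exact real_mem_strip hF.pos _)) (fun z hz => by
      obtain ⟨x, hx, rfl⟩ := hz
      exact hM x hx.1)
  refine ⟨M, h1.mono fun i hi x hx => interior_subset ?_⟩
  have := hi _ ⟨x, hx, rfl⟩
  convert this using 2
  push_cast
  ring

theorem trapped_of_attracting (hF : StripFamily L 𝒰 f g h) {K : Set Sphere}
    (hKm : ∀ᶠ i in (𝒰 : Filter ι), MapsTo (f i) K K) {v : Sphere} (hKv : K ∈ 𝓝 v) {t : ι → ℝ}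
    (hte : IsEnd L (limMap 𝒰 h t) (-1) v) :
    ∃ M : ℝ, ∀ᶠ i in (𝒰 : Filter ι), ∀ x : ℝ, M ≤ x → h i ((t i + (-1) * x : ℝ) : ℂ) ∈ K := by
  obtain ⟨M, hM⟩ := hF.exists_segment hte hKv
  refine ⟨M, ?_⟩
  filter_upwards [hM, hKm] with i h1 h2 x hx
  have key : ∀ (m : ℕ) (y : ℝ), y ∈ Icc M (M + 1) → h i ((t i + (-1) * (y + m) : ℝ) : ℂ) ∈ K := by
    intro m
    induction m with
    | zero => intro y hy; simpa using h1 y hy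
    | succ m ih =>
      intro y hy
      have h3 := h2 (ih y hy)
      rw [(hF.strip i).map_eq _ (real_mem_strip hF.pos _)] at h3
      convert h3 using 2
      push_cast
      ring
  have h3 := Nat.floor_le (sub_nonneg.2 hx)
  have h4 := Nat.lt_floor_add_one (x - M)
  have := key ⌊x - M⌋₊ (x - ⌊x - M⌋₊) ⟨by linarith, by linarith⟩
  rwa [sub_add_cancel] at this

theorem trapped_of_repelling (hF : StripFamily L 𝒰 f g h) {K O : Set Sphere} (hK : IsClosed K)
    (hO : IsOpen O) (hKO : K ⊆ O)
    (hKm : ∀ᶠ i in (𝒰 : Filter ι), ∀ y ∈ O, f i y ∈ K → y ∈ K) {v : Sphere} (hKv : K ∈ 𝓝 v)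
    {t : ι → ℝ} (hte : IsEnd L (limMap 𝒰 h t) 1 v) :
    ∃ M : ℝ, ∀ᶠ i in (𝒰 : Filter ι), ∀ x : ℝ, M ≤ x → h i ((t i + 1 * x : ℝ) : ℂ) ∈ K := by
  obtain ⟨M, hM⟩ := hF.exists_segment hte hKv
  refine ⟨M, ?_⟩
  filter_upwards [hM, hKm] with i h1 h2 x hx
  have hpath := path_trap (y := fun x : ℝ => h i ((t i + 1 * (M + x) : ℝ) : ℂ))
    (((hF.strip i).continuous_real hF.pos).comp (by fun_prop)) hK hO hKO
    (fun x hx => h1 _ ⟨by linarith [hx.1], by linarith [hx.2]⟩) (fun x _ h3 h4 => h2 _ h4 (by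
      rw [(hF.strip i).map_eq _ (real_mem_strip hF.pos _)]
      convert h3 using 2
      push_cast
      ring)) (x - M) (by linarith)
  simpa using hpath

end StripFamily

/-! ### Parabolic basins -/

instance : LocallyConnectedSpace Sphere :=
  locallyConnectedSpace_of_connected_bases (fun x r => param x '' Metric.ball (0 : ℂ) r)
    (fun _ r => 0 < r)
    (fun x => by
      have := (Metric.nhds_basis_ball (x := (0 : ℂ))).map (param x)
      rwa [map_param_nhds, param_zero] at this)
    fun x r _ => (convex_ball (0 : ℂ) r).isPreconnected.image _ (continuous_param x).continuousOn

/-- Joint convergence controls the tail of the sequence, and continuity the finitely many remaining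
maps. -/
theorem CConvAt.equicontinuousAt {X Y : Type*} [TopologicalSpace X] [UniformSpace Y]
    {φ : ℕ → X → Y} {Φ : X → Y} {x : X} (hc : ∀ m, ContinuousAt (φ m) x)
    (h : CConvAt atTop φ Φ x) : EquicontinuousAt φ x := by
  intro U hU
  obtain ⟨V, hV, hVs, hVU⟩ := comp_symm_mem_uniformity_sets hU
  obtain ⟨A, hA, W, hW, hAW⟩ := mem_prod_iff.1 (h (UniformSpace.ball_mem_nhds (Φ x) hV))
  obtain ⟨M, hM⟩ := mem_atTop_sets.1 hA
  have h1 : ∀ᶠ y in 𝓝 x, ∀ m ∈ Finset.range M, (φ m x, φ m y) ∈ U :=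
    (Filter.eventually_all_finset _).2 fun m _ => hc m (UniformSpace.ball_mem_nhds _ hU)
  filter_upwards [h1, hW] with y hy hyW m
  rcases lt_or_ge m M with hm | hm
  · exact hy m (Finset.mem_range.2 hm)
  · have h2 : (Φ x, φ m x) ∈ V := hAW (show (m, x) ∈ A ×ˢ W from ⟨hM m hm, mem_of_mem_nhds hW⟩)
    have h3 : (Φ x, φ m y) ∈ V := hAW (show (m, y) ∈ A ×ˢ W from ⟨hM m hm, hyW⟩)
    exact hVU ⟨Φ x, hVs.symm _ _ h2, h3⟩

theorem EquicontinuousAt.cconvAt {ι X Y : Type*} [TopologicalSpace X] [UniformSpace Y]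
    {𝒰 : Filter ι} {φ : ι → X → Y} {Φ : X → Y} {x : X} (he : EquicontinuousAt φ x)
    (h : Tendsto (fun i => φ i x) 𝒰 (𝓝 (Φ x))) : CConvAt 𝒰 φ Φ x := by
  rw [CConvAt, Uniform.tendsto_nhds_right]
  intro U hU
  obtain ⟨V, hV, hVU⟩ := comp_mem_uniformity_sets hU
  have h1 : ∀ᶠ i in 𝒰, (Φ x, φ i x) ∈ V := h (UniformSpace.ball_mem_nhds (Φ x) hV)
  rw [mem_map]
  filter_upwards [h1.prod_mk (he V hV)] with q hq
  exact hVU ⟨φ q.1 x, hq.1, hq.2 q.1⟩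

theorem IsTameMap.isOpenMap {g : Sphere → Sphere} (hg : IsTameMap g) : IsOpenMap g := by
  refine IsOpenMap.of_nhds_le fun x => ?_
  intro s hs
  have hs' : param x ⁻¹' (g ⁻¹' s) ∈ 𝓝 (0 : ℂ) :=
    (continuous_param x).continuousAt (by rw [param_zero]; exact hs)
  obtain ⟨r, hr, hrs⟩ := Metric.mem_nhds_iff.1 hs'
  have hc : Continuous fun w => g (param x w) := hg.isHolSelf.continuous.comp (continuous_param x)
  have h := CConvAt.eventually_exists_eq (𝒰 := 𝓝 (g x)) (φ := fun _ w => g (param x w))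
    (Φ := fun w => g (param x w)) isOpen_univ (mem_univ (0 : ℂ))
    (Eventually.of_forall fun _ => hg.isHolSelf.holomorphicOn_param x)
    (fun w _ => cconvAt_const hc.continuousAt)
    (hg.not_eventually_param x 0 _) (y := id) (by rw [param_zero]; exact tendsto_id) hr
  filter_upwards [h] with y hy
  obtain ⟨w, hw, -, hwy⟩ := hy
  rw [id] at hwy
  rw [← hwy]
  exact hrs hw

/-! ### Fatou components and the basin of a strip -/

section Fatou

variable {g : Sphere → Sphere}

theorem isOpen_fatouSet (g : Sphere → Sphere) : IsOpen (fatouSet g) := by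
  rw [isOpen_iff_mem_nhds]
  rintro z ⟨U, hU, hE⟩
  filter_upwards [eventually_mem_nhds_iff.2 hU] with y hy
  exact ⟨U, hy, hE⟩

theorem equicontinuousAt_of_mem_fatouSet {z : Sphere} (hz : z ∈ fatouSet g) :
    EquicontinuousAt (fun m : ℕ => g^[m]) z := by
  obtain ⟨U, hU, hE⟩ := hz
  intro V hV
  have := hE z (mem_of_mem_nhds hU) V hV
  rwa [nhdsWithin_eq_nhds.2 hU] at this

theorem mem_fatouSet_of_eventually {z : Sphere}
    (h : ∀ᶠ y in 𝓝 z, EquicontinuousAt (fun m : ℕ => g^[m]) y) : z ∈ fatouSet g :=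
  ⟨_, h, fun _ hy => EquicontinuousAt.equicontinuousWithinAt hy _⟩

theorem map_mem_fatouSet (hg : IsOpenMap g) {z : Sphere} (hz : z ∈ fatouSet g) :
    g z ∈ fatouSet g := by
  refine mem_fatouSet_of_eventually ?_
  filter_upwards [hg.image_mem_nhds ((isOpen_fatouSet g).mem_nhds hz)]
  rintro _ ⟨y, hy, rfl⟩ V hV
  filter_upwards [hg.image_mem_nhds (equicontinuousAt_of_mem_fatouSet hy V hV)]
  rintro _ ⟨x, hx, rfl⟩ m
  exact hx (m + 1)

theorem mem_fatouSet_of_map (hg : Continuous g) {z : Sphere} (hz : g z ∈ fatouSet g) :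
    z ∈ fatouSet g := by
  refine mem_fatouSet_of_eventually ?_
  filter_upwards [hg.continuousAt ((isOpen_fatouSet g).mem_nhds hz)] with y hy V hV
  filter_upwards [hg.continuousAt (equicontinuousAt_of_mem_fatouSet hy V hV),
    UniformSpace.ball_mem_nhds y hV] with x hx hx' m
  cases m with
  | zero => exact hx'
  | succ m => exact hx m

theorem mem_connectedComponentIn_of_mem_closure {X : Type*} [TopologicalSpace X]
    [LocallyConnectedSpace X] {F : Set X} (hF : IsOpen F) {z x : X} (hx : x ∈ F)
    (hcl : x ∈ closure (connectedComponentIn F z)) : x ∈ connectedComponentIn F z := by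
  obtain ⟨y, hy, hy'⟩ := mem_closure_iff.1 hcl _ hF.connectedComponentIn
    (mem_connectedComponentIn hx)
  rw [connectedComponentIn_eq hy', ← connectedComponentIn_eq hy]
  exact mem_connectedComponentIn hx

/-- On a Fatou component, the convergence of the iterates to a constant propagates. -/
theorem tendsto_iterate_of_component (hg : IsHolSelf g) {z v : Sphere} (hz : z ∈ fatouSet g)
    (hzv : ∀ᶠ y in 𝓝 z, Tendsto (fun m : ℕ => g^[m] y) atTop (𝓝 v)) {y : Sphere}
    (hy : y ∈ connectedComponentIn (fatouSet g) z) : Tendsto (fun m : ℕ => g^[m] y) atTop (𝓝 v) := by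
  rw [tendsto_iff_ultrafilter]
  intro 𝒱 h𝒱
  set Φ : Sphere → Sphere := fun x => (Ultrafilter.map (fun m : ℕ => g^[m] x) 𝒱).lim with hΦ
  have hlim : ∀ x, Tendsto (fun m : ℕ => g^[m] x) 𝒱 (𝓝 (Φ x)) := fun x =>
    Ultrafilter.le_nhds_lim (Ultrafilter.map (fun m : ℕ => g^[m] x) 𝒱)
  have hcc : ∀ x ∈ fatouSet g, CConvAt (𝒱 : Filter ℕ) (fun m : ℕ => g^[m]) Φ x := fun x hx =>
    EquicontinuousAt.cconvAt (equicontinuousAt_of_mem_fatouSet hx) (hlim x)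
  have hO : IsOpen {x | ∀ᶠ x' in 𝓝 x, Φ x' = v} := isOpen_setOfPred_eventually_nhds
  -- The set where the ultralimit `Φ` is locally equal to `v` is open, and closed in the component
  -- by the identity theorem on a chart disk. Equicontinuity makes `Φ` holomorphic on the Fatou set.
  have hsub : connectedComponentIn (fatouSet g) z ⊆ {x | ∀ᶠ x' in 𝓝 x, Φ x' = v} := by
    refine isPreconnected_connectedComponentIn.subset_of_closure_inter_subset hO
      ⟨z, mem_connectedComponentIn hz, ?_⟩ ?_
    · filter_upwards [hzv] with x hx
      exact tendsto_nhds_unique (hlim x) (hx.mono_left h𝒱)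
    · rintro x ⟨hxcl, hxΩ⟩
      have hxF := connectedComponentIn_subset _ _ hxΩ
      have h1 : param x ⁻¹' fatouSet g ∈ 𝓝 (0 : ℂ) :=
        (continuous_param x).continuousAt (by
          rw [param_zero]; exact (isOpen_fatouSet g).mem_nhds hxF)
      obtain ⟨r, hr, hrF⟩ := Metric.mem_nhds_iff.1 h1
      have hcc' : ∀ w ∈ Metric.ball (0 : ℂ) r, CConvAt (𝒱 : Filter ℕ)
          (fun m w => g^[m] (param x w)) (fun w => Φ (param x w)) w := fun w hw =>
        (hcc _ (hrF hw)).comp (φ := fun _ => param x)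
          (cconvAt_const (continuous_param x).continuousAt)
      have hhol := CConvAt.holomorphicOn Metric.isOpen_ball
        (Eventually.of_forall fun m => ((hg.iterate m).holomorphicOn_param x).mono
          (subset_univ _)) hcc'
      have hnb : param x '' Metric.ball 0 r ∈ 𝓝 x := by
        have := (isOpenMap_param x).image_mem_nhds (Metric.ball_mem_nhds (0 : ℂ) hr)
        rwa [param_zero] at this
      obtain ⟨_, ⟨w, hw, rfl⟩, hw'⟩ := mem_closure_iff_nhds.1 hxcl _ hnb
      have h2 := hhol.eqOn_const Metric.isOpen_ball (convex_ball _ _).isPreconnected hw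
        (c := v) ((continuous_param x).continuousAt.eventually hw')
      filter_upwards [hnb]
      rintro _ ⟨w', hw', rfl⟩
      exact h2 w' hw'
  have h1 := hlim y
  rwa [(hsub hy).self_of_nhds] at h1

theorem hasDerivAt_iterate_chart (hg : IsHolSelf g) {v : Sphere} (hv : g v = v)
    (hmul : multiplier g v = 1) (m : ℕ) :
    HasDerivAt (fun w => chart v (g^[m] (param v w))) 1 0 := by
  have hG : HasDerivAt (fun w => chart v (g (param v w))) 1 0 := by
    rw [← hmul, multiplier_eq]
    refine ((hg.holomorphicOn_param v).differentiableAt_chart (mem_univ 0) ?_).hasDerivAt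
    rw [param_zero, hv]
    exact ⟨0, param_zero v⟩
  induction m with
  | zero => simpa using hasDerivAt_id' (0 : ℂ)
  | succ m ih =>
    have h0 : chart v (g^[m] (param v 0)) = 0 := by
      rw [param_zero, Function.iterate_fixed hv, chart_self]
    have h1 : HasDerivAt (fun w => chart v (g (param v (chart v (g^[m] (param v w)))))) (1 * 1) 0 :=
      HasDerivAt.comp (h₂ := fun w => chart v (g (param v w))) 0 (by rw [h0]; exact hG) ih
    rw [one_mul] at h1
    refine h1.congr_of_eventuallyEq ?_
    have hc : Continuous fun w => g^[m] (param v w) :=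
      (hg.continuous.iterate m).comp (continuous_param v)
    have h2 : ∀ᶠ w in 𝓝 (0 : ℂ), param v (chart v (g^[m] (param v w))) = g^[m] (param v w) := by
      refine (hc.tendsto 0).eventually (p := fun y => param v (chart v y) = y) ?_
      rw [param_zero, Function.iterate_fixed hv]
      exact eventually_param_chart v
    filter_upwards [h2] with w hw
    rw [hw, Function.iterate_succ_apply']

/-- The iterates do not converge to a constant near a fixed point of multiplier `1`. -/
theorem not_cconvAt_iterate_of_parabolic (hg : IsHolSelf g) {v : Sphere} (hv : g v = v)
    (hmul : multiplier g v = 1) :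
    ¬ ∀ᶠ y in 𝓝 v, CConvAt atTop (fun m : ℕ => g^[m]) (fun _ => v) y := by
  intro h
  have h1 : ∀ᶠ w in 𝓝 (0 : ℂ), CConvAt atTop (fun m : ℕ => g^[m]) (fun _ => v) (param v w) :=
    ((continuous_param v).tendsto 0).eventually (by rwa [param_zero])
  obtain ⟨ρ, hρ, hball⟩ := Metric.mem_nhds_iff.1 h1
  obtain ⟨r, hr, -, -, -, hd, hcc⟩ := exists_ball_chart (𝒰 := atTop) (Φ := fun _ => v)
    (φ := fun (m : ℕ) w => g^[m] (param v w)) Metric.isOpen_ball (Metric.mem_ball_self hρ)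
    (Eventually.of_forall fun m => ((hg.iterate m).holomorphicOn_param v).mono (subset_univ _))
    (fun w hw => CConvAt.comp (ψ := fun m : ℕ => g^[m]) (Ψ := fun _ => v) (hball hw)
      (φ := fun _ => param v)
      (cconvAt_const (continuous_param v).continuousAt))
  -- Every iterate has derivative `1` at `v` in the chart, whereas the derivatives would have to
  -- converge to that of a constant.
  have h2 := ((CConvAt.tendstoLocallyUniformlyOn Metric.isOpen_ball hcc).deriv hd
    Metric.isOpen_ball).tendsto_at (Metric.mem_ball_self hr)
  simp only [Function.comp_def, (hasDerivAt_iterate_chart hg hv hmul _).deriv, deriv_const] at h2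
  exact one_ne_zero (tendsto_nhds_unique tendsto_const_nhds h2)

variable {L : ℝ} {H : ℂ → Sphere} {v : Sphere}

/-- The definition of an end gives pointwise limits only. For an ultrafilter on pairs `(m, z)`, the
normality of the strips re-centred at `-m` upgrades them to joint convergence. -/
theorem IsEnd.cconvAt (hL : 0 < L) (hg : Continuous g) (ho : HasOmittedPair g)
    (hH : IsStripMap L g H) (hv : IsEnd L H (-1) v) {w : ℂ} (hw : w ∈ standardStrip L) :
    CConvAt atTop (fun (m : ℕ) z => H (z - m)) (fun _ => v) w := by
  rw [CConvAt, tendsto_iff_ultrafilter]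
  intro 𝒲 h𝒲
  have hF : StripFamily L (𝒲 : Filter (ℕ × ℂ)) (fun _ => g) g (fun _ => H) :=
    stripFamily_const hL _ hg ho fun _ => hH
  have h1 : Tendsto (fun q : ℕ × ℂ => q.2) 𝒲 (𝓝 w) := tendsto_snd.mono_left h𝒲
  have h2 : Tendsto (fun q : ℕ × ℂ => q.1) 𝒲 atTop := tendsto_fst.mono_left h𝒲
  have h3 := (hF.cconvAt (fun q => -(q.1 : ℝ)) hw).tendsto_comp h1
  have h4 := (hv w hw).comp (tendsto_natCast_atTop_atTop.comp h2)
  have h5 := tendsto_limMap 𝒲 (fun _ => H) (fun q => -(q.1 : ℝ)) w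
  have h6 : limMap 𝒲 (fun _ => H) (fun q => -(q.1 : ℝ)) w = v :=
    tendsto_nhds_unique h5 (h4.congr fun q => by simp)
  rw [h6] at h3
  refine h3.congr fun q => ?_
  push_cast
  rw [sub_eq_add_neg]

theorem IsEnd.cconvAt_iterate (hL : 0 < L) (hg : Continuous g) (ho : HasOmittedPair g)
    (hH : IsStripMap L g H) (hv : IsEnd L H (-1) v) {w : ℂ} (hw : w ∈ standardStrip L) :
    CConvAt atTop (fun m : ℕ => g^[m]) (fun _ => v) (H w) := by
  have h1 := hv.cconvAt hL hg ho hH hw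
  have hmap : 𝓝 (H w) ≤ map H (𝓝 w) := by
    intro s hs
    obtain ⟨U, hU, hUo, hwU⟩ := mem_nhds_iff.1 (inter_mem hs (isOpen_strip.mem_nhds hw))
    exact mem_of_superset (((hH.holomorphicOn.mono fun z hz => (hU hz).2).isOpen_image hUo
      (hH.injOn.mono fun z hz => (hU hz).2)).mem_nhds ⟨w, hwU, rfl⟩)
      (image_subset_iff.2 fun z hz => (hU hz).1)
  have h2 : Tendsto (fun q : ℕ × Sphere => g^[q.1] q.2) (atTop ×ˢ map H (𝓝 w)) (𝓝 v) := by
    rw [← Filter.map_id (f := (atTop : Filter ℕ)), Filter.prod_map_map_eq, tendsto_map'_iff]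
    refine h1.congr' ?_
    have h3 : ∀ᶠ q : ℕ × ℂ in atTop ×ˢ 𝓝 w, q.2 ∈ standardStrip L :=
      tendsto_snd.eventually (isOpen_strip.mem_nhds hw)
    filter_upwards [h3] with q hq
    exact (hH.iterate_eq q.1 hq).symm
  exact h2.mono_left (prod_mono_right _ hmap)

/-- The iterates converge to `v` locally uniformly on the strip, so it lies in a Fatou component
`Ω`, to all of which the convergence propagates. The end `v` is in the closure of `Ω`, but not in
`Ω`, because the iterates have derivative `1` there. -/
theorem exists_parabolic_basin (hL : 0 < L) (hg : IsTameMap g) (ho : HasOmittedPair g)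
    (hH : IsStripMap L g H) (hv : IsEnd L H (-1) v) (hmul : multiplier g v = 1) :
    ∃ Ω, IsFixedParabolicBasin g Ω ∧ H '' standardStrip L ⊆ Ω := by
  have hc := hg.isHolSelf.continuous
  have h0 := zero_mem_strip hL
  have hvf : g v = v := hv.map_eq hL hc hH
  have hopen : IsOpen (H '' standardStrip L) := 
    hH.holomorphicOn.isOpen_image isOpen_strip hH.injOn
  have hcc : ∀ y ∈ H '' standardStrip L, CConvAt atTop (fun m : ℕ => g^[m]) (fun _ => v) y := by
    rintro _ ⟨w, hw, rfl⟩
    exact hv.cconvAt_iterate hL hc ho hH hw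
  have hF : H '' standardStrip L ⊆ fatouSet g := fun y hy => by
    refine mem_fatouSet_of_eventually ?_
    filter_upwards [hopen.mem_nhds hy] with x hx
    exact CConvAt.equicontinuousAt (fun m => (hc.iterate m).continuousAt) (hcc x hx)
  have h0F : H 0 ∈ fatouSet g := hF ⟨0, h0, rfl⟩
  set Ω := connectedComponentIn (fatouSet g) (H 0) with hΩ
  have hFo := isOpen_fatouSet g
  have hΩo : IsOpen Ω := hFo.connectedComponentIn
  have hSΩ : H '' standardStrip L ⊆ Ω :=
    (isPreconnected_strip.image _ hH.holomorphicOn.1).subset_connectedComponentIn ⟨0, h0, rfl⟩ hF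
  have hΩF : Ω ⊆ fatouSet g := connectedComponentIn_subset _ _
  have hconv : ∀ y ∈ Ω, CConvAt atTop (fun m : ℕ => g^[m]) (fun _ => v) y := fun y hy =>
    EquicontinuousAt.cconvAt (equicontinuousAt_of_mem_fatouSet (hΩF hy))
      (tendsto_iterate_of_component hg.isHolSelf h0F (by
        filter_upwards [hopen.mem_nhds ⟨0, h0, rfl⟩] with x hx
        exact (hcc x hx).tendsto) hy)
  have hvcl : v ∈ closure Ω := hv.mem_of_forall_real hL isClosed_closure fun x _ =>
    subset_closure (hSΩ ⟨_, real_mem_strip hL _, rfl⟩)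
  have hvΩ : v ∉ Ω := fun h => not_cconvAt_iterate_of_parabolic hg.isHolSelf hvf hmul (by
    filter_upwards [hΩo.mem_nhds h] with y hy using hconv y hy)
  refine ⟨Ω, ⟨⟨H 0, h0F, rfl⟩, ?_, v, ⟨hvf, 1, one_pos, by rw [hmul, one_pow]⟩, ?_, ?_⟩, hSΩ⟩
  · have h1 : H (0 - 1) ∈ g '' Ω :=
      ⟨H 0, mem_connectedComponentIn h0F, hH.map_eq 0 h0⟩
    have h1Ω : H (0 - 1) ∈ Ω := hSΩ ⟨_, sub_one_mem_strip h0, rfl⟩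
    refine Subset.antisymm ?_ ?_
    · have h2 : Ω = connectedComponentIn (fatouSet g) (H (0 - 1)) := connectedComponentIn_eq h1Ω
      rw [h2]
      refine IsPreconnected.subset_connectedComponentIn ?_ (h2 ▸ h1) ?_
      · exact isPreconnected_connectedComponentIn.image _ hc.continuousOn
      · rintro _ ⟨y, hy, rfl⟩
        exact map_mem_fatouSet hg.isOpenMap (connectedComponentIn_subset _ _ hy)
    -- Conversely, `g '' Ω` is open and meets `Ω`. It is closed in `Ω` because a point of the
    -- closure of `Ω` with image in the Fatou set is itself in the Fatou set, hence in `Ω`.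
    · refine isPreconnected_connectedComponentIn.subset_of_closure_inter_subset
        (hg.isOpenMap _ hΩo) ⟨_, h1Ω, h1⟩ ?_
      rintro y ⟨hycl, hyΩ⟩
      have h2 : closure (g '' Ω) ⊆ g '' closure Ω :=
        closure_minimal (image_mono subset_closure)
          (isClosed_closure.isCompact.image hc).isClosed
      obtain ⟨x, hx, rfl⟩ := h2 hycl
      exact ⟨x, mem_connectedComponentIn_of_mem_closure hFo
        (mem_fatouSet_of_map hc (hΩF hyΩ)) hx, rfl⟩
  · rw [hΩo.frontier_eq]
    exact ⟨hvcl, hvΩ⟩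
  · exact CConvAt.tendstoLocallyUniformlyOn hΩo hconv

end Fatou

/-! ### Central lines -/

/-- Zeros of the derivative are isolated unless the function is locally constant. Excluding them off
the base point is enough for the next lemma, where a removable singularity deals with that point. -/
theorem eventually_deriv_ne_zero_of_injOn {u : ℂ → ℂ} {a : ℂ} {W : Set ℂ} (hW : W ∈ 𝓝 a)
    (hu : AnalyticAt ℂ u a) (hinj : InjOn u W) : ∀ᶠ w in 𝓝[≠] a, deriv u w ≠ 0 := by
  refine (hu.deriv.eventually_eq_zero_or_eventually_ne_zero).resolve_left fun h0 => ?_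
  obtain ⟨r, hr, hball⟩ := Metric.mem_nhds_iff.1 ((h0.and hu.eventually_analyticAt).and hW)
  obtain ⟨b, hb, hba⟩ : ∃ b ∈ Metric.ball a r, b ≠ a := by
    refine ⟨a + (r / 2 : ℝ), ?_, fun h => ?_⟩
    · rw [Metric.mem_ball, dist_eq_norm, add_sub_cancel_left, Complex.norm_real,
        Real.norm_of_nonneg (by linarith)]
      linarith
    · have h1 : ((r / 2 : ℝ) : ℂ) = 0 := by simpa using h
      rw [Complex.ofReal_eq_zero] at h1
      linarith
  refine hba (hinj (hball hb).2 (mem_of_mem_nhds hW) ?_)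
  exact Metric.isOpen_ball.is_const_of_deriv_eq_zero (convex_ball a r).isPreconnected
    (fun w hw => (hball hw).1.2.differentiableAt.differentiableWithinAt) (fun w hw => (hball hw).1.1)
    hb (Metric.mem_ball_self hr)

/-- The transition map between two conformal parametrizations is holomorphic. -/
theorem IsConformalIso.exists_transition {φ ψ : ℂ → Sphere} {U V : Set ℂ} {A : Set Sphere}
    (hU : IsOpen U) (hV : IsOpen V) (hφ : IsConformalIso φ U A) (hψ : IsConformalIso ψ V A) :
    ∃ k : ℂ → ℂ, DifferentiableOn ℂ k U ∧ MapsTo k U V ∧ ∀ z ∈ U, ψ (k z) = φ z := by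
  have hex : ∀ z ∈ U, ∃ w ∈ V, ψ w = φ z := fun z hz => hψ.2.surjOn (hφ.2.mapsTo hz)
  choose! k hkV hk using hex
  have hcont : ∀ z ∈ U, ContinuousAt k z := by
    intro z hz N hN
    obtain ⟨W, hWN, hWo, hzW⟩ := mem_nhds_iff.1 (inter_mem hN (hV.mem_nhds (hkV z hz)))
    have h1 : ψ '' W ∈ 𝓝 (φ z) :=
      ((hψ.1.mono fun w hw => (hWN hw).2).isOpen_image hWo
        (hψ.2.injOn.mono fun w hw => (hWN hw).2)).mem_nhds ⟨k z, hzW, hk z hz⟩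
    rw [mem_map]
    filter_upwards [hφ.1.1.continuousAt (hU.mem_nhds hz) h1, hU.mem_nhds hz] with x hx hxU
    obtain ⟨w, hw, hwx⟩ := hx
    have : w = k x := hψ.2.injOn (hWN hw).2 (hkV x hxU) (hwx.trans (hk x hxU).symm)
    rw [mem_preimage, ← this]
    exact (hWN hw).1
  have hkinj : InjOn k U := fun x hx y hy hxy =>
    hφ.2.injOn hx hy (by rw [← hk x hx, ← hk y hy, hxy])
  refine ⟨k, fun z hz => ?_, hkV, hk⟩
  -- By continuity of `k` at `z` it suffices to differentiate on a punctured neighbourhood, where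
  -- the derivative of `u` does not vanish and a local inverse exists.
  refine (Complex.analyticAt_of_differentiable_on_punctured_nhds_of_continuousAt ?_
    (hcont z hz)).differentiableAt.differentiableWithinAt
  set p := φ z with hp
  set u : ℂ → ℂ := fun w => chart p (ψ w) with hu
  have hrange : range (param p) ∈ 𝓝 p := by
    have := range_param_mem_nhds p 0
    rwa [param_zero] at this
  have hψr : ∀ᶠ w in 𝓝 (k z), w ∈ V ∧ ψ w ∈ range (param p) := by
    filter_upwards [hV.mem_nhds (hkV z hz), hψ.1.1.continuousAt (hV.mem_nhds (hkV z hz))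
      (by rw [hk z hz]; exact hrange)] with w h1 h2 using ⟨h1, h2⟩
  have huan : ∀ᶠ w in 𝓝 (k z), AnalyticAt ℂ u w := by
    refine AnalyticAt.eventually_analyticAt ?_
    rw [Complex.analyticAt_iff_eventually_differentiableAt]
    filter_upwards [hψr] with w hw
    exact hψ.1.differentiableAt_chart hw.1 hw.2
  have huinj : InjOn u {w | w ∈ V ∧ ψ w ∈ range (param p)} := by
    intro x hx y hy hxy
    refine hψ.2.injOn hx.1 hy.1 ?_
    rw [← param_chart_of_mem hx.2, ← param_chart_of_mem hy.2]
    exact congrArg _ hxy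
  have hder := eventually_deriv_ne_zero_of_injOn hψr huan.self_of_nhds huinj
  have hk' : Tendsto k (𝓝[≠] z) (𝓝[≠] (k z)) := by
    rw [tendsto_nhdsWithin_iff]
    refine ⟨(hcont z hz).mono_left nhdsWithin_le_nhds, ?_⟩
    filter_upwards [self_mem_nhdsWithin, nhdsWithin_le_nhds (hU.mem_nhds hz)] with x hx hxU hxz
    exact hx (hkinj hxU hz hxz)
  have hφr : ∀ᶠ x in 𝓝 z, x ∈ U ∧ φ x ∈ range (param p) := by
    filter_upwards [hU.mem_nhds hz, hφ.1.1.continuousAt (hU.mem_nhds hz) hrange]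
      with x h1 h2 using ⟨h1, h2⟩
  filter_upwards [hk'.eventually (hder.and (huan.filter_mono nhdsWithin_le_nhds)),
    hφr.filter_mono nhdsWithin_le_nhds] with x hx hxr
  have hs := hx.2.hasStrictDerivAt
  have h1 : ∀ᶠ y in 𝓝 x, hs.localInverse u _ _ hx.1 (chart p (φ y)) = k y := by
    filter_upwards [(hcont x hxr.1).eventually (hs.eventually_left_inverse hx.1),
      hU.mem_nhds hxr.1] with y hy hyU
    rw [← hk y hyU]
    exact hy
  have h2 := (hs.to_localInverse hx.1).hasDerivAt.differentiableAt
  have h3 : DifferentiableAt ℂ (fun y => chart p (φ y)) x := hφ.1.differentiableAt_chart hxr.1 hxr.2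
  have h4 : u (k x) = chart p (φ x) := by rw [hu]; simp only; rw [hk x hxr.1]
  rw [h4] at h2
  exact (h2.comp x h3).congr_of_eventuallyEq (h1.mono fun y hy => hy.symm)

theorem norm_sub_lt_norm_sub_conj_iff {z w : ℂ} (hw : 0 < w.im) :
    ‖z - w‖ < ‖z - (starRingEnd ℂ) w‖ ↔ 0 < z.im := by
  rw [← sq_lt_sq₀ (norm_nonneg _) (norm_nonneg _), ← Complex.normSq_eq_norm_sq,
    ← Complex.normSq_eq_norm_sq, Complex.normSq_apply, Complex.normSq_apply]
  simp only [Complex.sub_re, Complex.sub_im, Complex.conj_re, Complex.conj_im]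
  constructor
  · intro h
    by_contra! h1
    nlinarith [mul_nonneg hw.le (neg_nonneg.2 h1)]
  · intro h
    nlinarith [mul_pos hw h]

theorem sub_conj_ne_zero {z w : ℂ} (hz : 0 < z.im) (hw : 0 < w.im) :
    z - (starRingEnd ℂ) w ≠ 0 := fun h => by
  have := congrArg Complex.im h
  simp at this
  linarith

/-- The Schwarz–Pick lemma for the upper half-plane. -/
theorem schwarz_pick {k : ℂ → ℂ} (hk : DifferentiableOn ℂ k {z | 0 < z.im})
    (hm : MapsTo k {z | 0 < z.im} {z | 0 < z.im}) {z w : ℂ} (hz : 0 < z.im) (hw : 0 < w.im) :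
    ‖(k z - k w) / (k z - (starRingEnd ℂ) (k w))‖ ≤ ‖(z - w) / (z - (starRingEnd ℂ) w)‖ := by
  set wc := (starRingEnd ℂ) w with hwc
  have hww : w - wc ≠ 0 := sub_conj_ne_zero hw hw
  have hkw : 0 < (k w).im := hm hw
  -- The Cayley map from the unit disk to the half-plane with `T 0 = w`; it reduces the claim to the
  -- Schwarz lemma.
  set T : ℂ → ℂ := fun ζ => (w - wc * ζ) / (1 - ζ) with hT
  have h1 : ∀ ζ ∈ Metric.ball (0 : ℂ) 1, 1 - ζ ≠ 0 := fun ζ hζ h => by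
    rw [sub_eq_zero] at h
    rw [← h] at hζ
    simp at hζ
  have hTw : ∀ ζ ∈ Metric.ball (0 : ℂ) 1, T ζ - w = ζ * (T ζ - wc) := fun ζ hζ => by
    have := h1 ζ hζ
    simp only [hT]
    field_simp
    ring
  have hTwc : ∀ ζ ∈ Metric.ball (0 : ℂ) 1, T ζ - wc ≠ 0 := fun ζ hζ => by
    have h2 := h1 ζ hζ
    have : T ζ - wc = (w - wc) / (1 - ζ) := by
      simp only [hT]
      field_simp
      ring
    rw [this]
    exact div_ne_zero hww h2
  have hTm : ∀ ζ ∈ Metric.ball (0 : ℂ) 1, 0 < (T ζ).im := fun ζ hζ => by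
    rw [← norm_sub_lt_norm_sub_conj_iff hw, ← hwc, hTw ζ hζ, norm_mul]
    have h2 := norm_pos_iff.2 (hTwc ζ hζ)
    rw [mem_ball_zero_iff] at hζ
    nlinarith
  have hTd : DifferentiableOn ℂ T (Metric.ball 0 1) := by
    refine DifferentiableOn.div (by fun_prop) (by fun_prop) h1
  set F : ℂ → ℂ := fun ζ => (k (T ζ) - k w) / (k (T ζ) - (starRingEnd ℂ) (k w)) with hF
  have hkT : DifferentiableOn ℂ (fun ζ => k (T ζ)) (Metric.ball 0 1) := hk.comp hTd hTm
  have hFd : DifferentiableOn ℂ F (Metric.ball 0 1) :=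
    (hkT.sub_const _).div (hkT.sub_const _) fun ζ hζ => sub_conj_ne_zero (hm (hTm ζ hζ)) hkw
  have hFm : MapsTo F (Metric.ball 0 1) (Metric.closedBall 0 1) := fun ζ hζ => by
    rw [mem_closedBall_zero_iff, hF, norm_div]
    exact div_le_one_of_le₀
      ((norm_sub_lt_norm_sub_conj_iff hkw).2 (hm (hTm ζ hζ))).le (norm_nonneg _)
  have hT0 : T 0 = w := by simp [hT]
  have hF0 : F 0 = 0 := by simp [hF, hT0]
  have hzc : z - wc ≠ 0 := sub_conj_ne_zero hz hw
  have hζ : ‖(z - w) / (z - wc)‖ < 1 := by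
    rw [norm_div, div_lt_one (norm_pos_iff.2 hzc)]
    exact (norm_sub_lt_norm_sub_conj_iff hw).2 hz
  have hTz : T ((z - w) / (z - wc)) = z := by
    have h2 : 1 - (z - w) / (z - wc) = (w - wc) / (z - wc) := by
      field_simp
      ring
    simp only [hT]
    rw [h2]
    field_simp
    ring
  have := Complex.norm_le_norm_of_mapsTo_ball hFd hFm hF0 hζ
  rw [hF] at this
  simp only [hTz] at this
  exact this

/-- A biholomorphic self-map of the upper half-plane preserves the hyperbolic metric. -/
theorem dist_eq_of_biholomorphic {k l : ℂ → ℂ} (hk : DifferentiableOn ℂ k {z | 0 < z.im})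
    (hkm : MapsTo k {z | 0 < z.im} {z | 0 < z.im}) (hl : DifferentiableOn ℂ l {z | 0 < z.im})
    (hlm : MapsTo l {z | 0 < z.im} {z | 0 < z.im}) (hlk : ∀ z, 0 < z.im → l (k z) = z) (z w : ℍ) :
    dist (⟨k z, hkm z.im_pos⟩ : ℍ) ⟨k w, hkm w.im_pos⟩ = dist z w := by
  have h1 := schwarz_pick hk hkm z.im_pos w.im_pos
  have h2 := schwarz_pick hl hlm (hkm z.im_pos) (hkm w.im_pos)
  rw [hlk _ z.im_pos, hlk _ w.im_pos] at h2
  have h3 := le_antisymm h1 h2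
  have h4 := UpperHalfPlane.tanh_half_dist (⟨k z, hkm z.im_pos⟩ : ℍ) ⟨k w, hkm w.im_pos⟩
  have h5 := UpperHalfPlane.tanh_half_dist z w
  rw [dist_eq_norm, dist_eq_norm, ← norm_div] at h4 h5
  have h6 := Real.tanh_injective (h4.trans (h3.trans h5.symm))
  linarith

/-! ### Uniformization of the strip by the upper half-plane -/

/-- The conformal isomorphism from the upper half-plane to the standard strip. -/
def stripCoord (L : ℝ) (w : ℂ) : ℂ := ((2 * L / Real.pi : ℝ) : ℂ) * Complex.log w - L * Complex.I

section

variable {L : ℝ}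

theorem isOpen_upper : IsOpen {z : ℂ | 0 < z.im} := isOpen_lt continuous_const Complex.continuous_im

theorem stripCoord_im (w : ℂ) : (stripCoord L w).im = 2 * L / Real.pi * w.arg - L := by
  simp [stripCoord, Complex.log_im]

theorem stripCoord_re (w : ℂ) : (stripCoord L w).re = 2 * L / Real.pi * Real.log ‖w‖ := by
  simp [stripCoord, Complex.log_re]

theorem arg_mem_Ioo {w : ℂ} (hw : 0 < w.im) : w.arg ∈ Ioo 0 Real.pi := by
  constructor
  · refine lt_of_le_of_ne (Complex.arg_nonneg_iff.2 hw.le) fun h => ?_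
    have := (Complex.arg_eq_zero_iff.1 h.symm).2
    linarith
  · refine lt_of_le_of_ne (Complex.arg_le_pi w) fun h => ?_
    have := (Complex.arg_eq_pi_iff.1 h).2
    linarith

theorem differentiableOn_stripCoord : DifferentiableOn ℂ (stripCoord L) {z | 0 < z.im} := by
  intro w hw
  have : w ∈ Complex.slitPlane := Or.inr (ne_of_gt hw)
  exact (((Complex.differentiableAt_log this).const_mul _).sub_const _).differentiableWithinAt

theorem bijOn_stripCoord (hL : 0 < L) :
    BijOn (stripCoord L) {z | 0 < z.im} (standardStrip L) := by
  have hπ := Real.pi_pos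
  have hc : (0 : ℝ) < 2 * L / Real.pi := by positivity
  refine ⟨fun w hw => ?_, fun w hw w' hw' he => ?_, fun z hz => ?_⟩
  · obtain ⟨h1, h2⟩ := arg_mem_Ioo hw
    have h3 : 2 * L / Real.pi * w.arg < 2 * L / Real.pi * Real.pi := by gcongr
    have h4 : 0 < 2 * L / Real.pi * w.arg := by positivity
    have h5 : 2 * L / Real.pi * Real.pi = 2 * L := by field_simp
    change |(stripCoord L w).im| < L
    rw [stripCoord_im, abs_lt]
    constructor <;> linarith
  · have h1 : ((2 * L / Real.pi : ℝ) : ℂ) ≠ 0 := Complex.ofReal_ne_zero.2 hc.ne'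
    have h2 : Complex.log w = Complex.log w' := by
      simpa [stripCoord, h1, -Complex.ofReal_div, -Complex.ofReal_mul] using he
    have hne : ∀ {w : ℂ}, 0 < w.im → w ≠ 0 := by
      rintro w hw rfl
      simp at hw
    rw [← Complex.exp_log (hne hw), ← Complex.exp_log (hne hw'), h2]
  · set ζ : ℂ := ((Real.pi / (2 * L) : ℝ) : ℂ) * (z + L * Complex.I) with hζ
    have hζim : ζ.im = Real.pi / (2 * L) * (z.im + L) := by
      rw [hζ, Complex.im_ofReal_mul]
      simp
    obtain ⟨h1, h2⟩ := abs_lt.1 (show |z.im| < L from hz)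
    have h3 : 0 < ζ.im := by
      rw [hζim]
      exact mul_pos (by positivity) (by linarith)
    have h4 : ζ.im < Real.pi := by
      rw [hζim]
      have : Real.pi / (2 * L) * (z.im + L) < Real.pi / (2 * L) * (2 * L) := by
        gcongr
        linarith
      have h5 : Real.pi / (2 * L) * (2 * L) = Real.pi := by field_simp
      linarith
    refine ⟨Complex.exp ζ, ?_, ?_⟩
    · change 0 < (Complex.exp ζ).im
      rw [Complex.exp_im]
      exact mul_pos (Real.exp_pos _) (Real.sin_pos_of_pos_of_lt_pi h3 h4)
    · rw [stripCoord, Complex.log_exp (by linarith) h4.le, hζ, ← mul_assoc, ← Complex.ofReal_mul,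
        show 2 * L / Real.pi * (Real.pi / (2 * L)) = 1 by field_simp]
      simp

theorem stripCoord_mul (hL : 0 < L) {w : ℂ} (hw : 0 < w.im) :
    stripCoord L ((Real.exp (-(Real.pi / (2 * L))) : ℝ) * w) = stripCoord L w - 1 := by
  have hw0 : w ≠ 0 := by
    rintro rfl
    simp at hw
  rw [stripCoord, Complex.log_ofReal_mul (Real.exp_pos _) hw0, Real.log_exp, stripCoord, mul_add,
    ← Complex.ofReal_mul]
  have hπ := Real.pi_pos
  have : 2 * L / Real.pi * -(Real.pi / (2 * L)) = -1 := by field_simp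
  rw [this]
  push_cast
  ring

theorem stripCoord_of_re_eq_zero {w : ℂ} (hw : 0 < w.im) (hre : w.re = 0) :
    stripCoord L w = ((2 * L / Real.pi * Real.log w.im : ℝ) : ℂ) := by
  have hw' : w = w.im * Complex.I := by
    apply Complex.ext <;> simp [hre]
  have harg : w.arg = Real.pi / 2 := by
    rw [hw', Complex.arg_real_mul _ hw, Complex.arg_I]
  have hn : ‖w‖ = w.im := by
    conv_lhs => rw [hw']
    simp [abs_of_pos hw]
  apply Complex.ext
  · rw [stripCoord_re, hn, Complex.ofReal_re]
  · rw [stripCoord_im, harg, Complex.ofReal_im]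
    have := Real.pi_pos
    field_simp
    ring

theorem IsConformalIso.comp_stripCoord (hL : 0 < L) {h : ℂ → Sphere} {A : Set Sphere}
    (hh : IsConformalIso h (standardStrip L) A) :
    IsConformalIso (fun w => h (stripCoord L w)) {z | 0 < z.im} A :=
  ⟨hh.1.comp_differentiableOn isOpen_upper differentiableOn_stripCoord (bijOn_stripCoord hL).mapsTo,
    hh.2.comp (bijOn_stripCoord hL)⟩

/-- Points at which the distance is additive along the dilation `w ↦ c w` lie on the imaginary
axis. -/
theorem re_eq_zero_of_dist_eq {w w₁ w₂ : ℍ} {c : ℝ} (hc : 0 < c) (hc1 : c ≠ 1)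
    (h₁ : (w₁ : ℂ) = c * w) (h₂ : (w₂ : ℂ) = c * w₁) (hd : dist w w₂ = 2 * dist w w₁) :
    w.re = 0 := by
  have him₁ : w₁.im = c * w.im := by
    have := congrArg Complex.im h₁
    rwa [Complex.im_ofReal_mul] at this
  have hre₁ : w₁.re = c * w.re := by
    have := congrArg Complex.re h₁
    rwa [Complex.re_ofReal_mul] at this
  have him₂ : w₂.im = c * w₁.im := by
    have := congrArg Complex.im h₂
    rwa [Complex.im_ofReal_mul] at this
  have hre₂ : w₂.re = c * w₁.re := by
    have := congrArg Complex.re h₂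
    rwa [Complex.re_ofReal_mul] at this
  have h3 := UpperHalfPlane.cosh_dist' w w₂
  have h4 := UpperHalfPlane.cosh_dist' w w₁
  rw [hd, Real.cosh_two_mul, Real.sinh_sq, h4, him₂, hre₂, him₁, hre₁] at h3
  have hy := w.im_pos
  set x := w.re
  set y := w.im
  have h5 : (1 - c) ≠ 0 := sub_ne_zero.2 hc1.symm
  have hy' : y ≠ 0 := hy.ne'
  have hc' : c ≠ 0 := hc.ne'
  field_simp at h3
  have h6 : x ^ 2 * ((1 - c) ^ 4 * (x ^ 2 + y ^ 2)) = 0 := by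
    linear_combination h3 / 2
  have h7 : (1 - c) ^ 4 * (x ^ 2 + y ^ 2) ≠ 0 := by positivity
  simpa using (mul_eq_zero.1 h6).resolve_right h7

end

section

variable {L : ℝ} {f : Sphere → Sphere} {h : ℂ → Sphere} {A γ : Set Sphere}

theorem surjective_of_isometry_real {s : ℝ → ℝ} (hs : Isometry s) : Function.Surjective s :=
  (hs.affineIsometryOfStrictConvexSpace.toAffineIsometryEquiv rfl).surjective

/-- In the half-plane the translation becomes the dilation by `κ`, and the geodesic an isometric
curve `C` invariant under it. For each point the distance to its image equals the distance from
there to the second image. On an isometric line this makes distances additive, which forces `C` onto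
the imaginary axis. Then `log` of the imaginary part is an isometry of the real line, hence onto,
and `C` is the whole axis. -/
theorem IsCentralLine.eq_range (hL : 0 < L) (hh : IsConformalIso h (standardStrip L) A)
    (hmap : ∀ z ∈ standardStrip L, f (h z) = h (z - 1)) (hγ : IsCentralLine f A γ) :
    γ = range fun x : ℝ => h x := by
  obtain ⟨⟨φ, hφ, c, hc, rfl⟩, hinv⟩ := hγ
  have hh' := hh.comp_stripCoord hL
  set h' : ℂ → Sphere := fun w => h (stripCoord L w) with hh'def
  obtain ⟨k, hk, hkm, hkφ⟩ := hφ.exists_transition isOpen_upper isOpen_upper hh'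
  obtain ⟨l, hl, hlm, hlφ⟩ := hh'.exists_transition isOpen_upper isOpen_upper hφ
  have hlk : ∀ z : ℂ, 0 < z.im → l (k z) = z := fun z hz =>
    hφ.2.injOn (hlm (hkm hz)) hz ((hlφ _ (hkm hz)).trans (hkφ _ hz))
  let C : ℝ → ℍ := fun t => ⟨k (c t), hkm (c t).im_pos⟩
  have hCdist : ∀ t s, dist (C t) (C s) = |t - s| := fun t s => by
    rw [dist_eq_of_biholomorphic hk hkm hl hlm hlk (c t) (c s), hc.dist_eq, Real.dist_eq]
  have hCφ : ∀ t, φ (c t) = h' (C t) := fun t => (hkφ _ (c t).im_pos).symm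
  set κ : ℝ := Real.exp (-(Real.pi / (2 * L))) with hκ
  have hκ0 : 0 < κ := Real.exp_pos _
  have hκ1 : κ < 1 := by
    rw [hκ, Real.exp_lt_one_iff, neg_lt_zero]
    have := Real.pi_pos
    positivity
  have hstep : ∀ t, ∃ t', (C t' : ℂ) = κ * C t := by
    intro t
    have h1 : f (φ (c t)) ∈ range fun t => φ (c t) := by
      rw [← hinv]
      exact ⟨_, ⟨t, rfl⟩, rfl⟩
    obtain ⟨t', ht'⟩ := h1
    refine ⟨t', ?_⟩
    simp only [hCφ] at ht'
    have him : 0 < ((κ : ℂ) * C t).im := by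
      rw [Complex.im_ofReal_mul]
      exact mul_pos hκ0 (C t).im_pos
    refine hh'.2.injOn (C t').im_pos him (ht'.trans ?_)
    simp only [hh'def]
    rw [hmap _ ((bijOn_stripCoord hL).mapsTo (C t).im_pos), stripCoord_mul hL (C t).im_pos]
  have hre : ∀ t, (C t).re = 0 := by
    intro t
    obtain ⟨t₁, h₁⟩ := hstep t
    obtain ⟨t₂, h₂⟩ := hstep t₁
    refine re_eq_zero_of_dist_eq hκ0 hκ1.ne h₁ h₂ ?_
    have h3 : dist (C t₁) (C t₂) = dist (C t) (C t₁) := by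
      have h4 := (UpperHalfPlane.isometry_pos_mul ⟨κ, hκ0⟩).dist_eq (C t) (C t₁)
      rw [← h4]
      congr 1
      · exact UpperHalfPlane.ext h₁
      · exact UpperHalfPlane.ext h₂
    -- Of the two solutions of `|t₁ - t₂| = |t - t₁|`, the folded one `t₂ = t` is excluded by `κ * κ
    -- < 1`.
    have h5 : t₂ ≠ t := by
      rintro rfl
      rw [h₁, ← mul_assoc, ← Complex.ofReal_mul] at h₂
      have h6 := congrArg Complex.im h₂
      rw [Complex.im_ofReal_mul] at h6
      have h7 := (C t₂).im_pos
      rw [← UpperHalfPlane.coe_im] at h7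
      have h8 : κ * κ < 1 := by nlinarith
      nlinarith [mul_pos h7 (sub_pos.2 h8)]
    rw [hCdist, hCdist] at h3
    rw [hCdist, hCdist]
    rcases abs_eq_abs.1 h3 with h6 | h6
    · rw [show t - t₂ = 2 * (t - t₁) by linarith, abs_mul, abs_two]
    · exact absurd (by linarith) h5
  have hlog : Isometry fun t => Real.log (C t).im := Isometry.of_dist_eq fun t s => by
    rw [← UpperHalfPlane.dist_of_re_eq ((hre t).trans (hre s).symm), hCdist, Real.dist_eq]
  have hval : ∀ t, φ (c t) = h ((2 * L / Real.pi * Real.log (C t).im : ℝ) : ℂ) := fun t => by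
    rw [hCφ]
    simp only [hh'def]
    rw [stripCoord_of_re_eq_zero (C t).im_pos (hre t)]
    rfl
  have hπ := Real.pi_pos
  refine Subset.antisymm ?_ ?_
  · rintro _ ⟨t, rfl⟩
    exact ⟨_, (hval t).symm⟩
  · rintro _ ⟨x, rfl⟩
    obtain ⟨t, ht⟩ := surjective_of_isometry_real hlog (Real.pi / (2 * L) * x)
    refine ⟨t, ?_⟩
    simp only at ht ⊢
    rw [hval, ht]
    congr 2
    field_simp

theorem IsInvariantStrip.exists_isStripMap (hA : IsInvariantStrip L f A) :
    ∃ h, IsStripMap L f h ∧ IsConformalIso h (standardStrip L) A := by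
  obtain ⟨h, h1, h2⟩ := hA.conjugate
  exact ⟨h, ⟨h1.1, h1.2.injOn, h2⟩, h1⟩

theorem IsConformalIso.isOrbitEnd_forward (hh : IsStripMap L f h)
    (hA : IsConformalIso h (standardStrip L) A) {a : Sphere} (ha : IsForwardEnd f A a) :
    IsOrbitEnd L h (-1) a := fun z hz => by
  refine (ha (h z) (hA.2.mapsTo hz)).congr fun m => ?_
  rw [hh.iterate_eq m hz]
  congr 1
  push_cast
  ring

theorem IsConformalIso.isOrbitEnd_backward (hh : IsStripMap L f h)
    (hA : IsConformalIso h (standardStrip L) A) {u : Sphere} (hu : IsBackwardEnd f A u) :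
    IsOrbitEnd L h 1 u := fun z hz => by
  refine hu _ (fun m => hA.2.mapsTo (add_real_mem_strip hz _)) fun m => ?_
  rw [hh.map_eq _ (add_real_mem_strip hz _)]
  congr 1
  push_cast
  ring

namespace IsStripMap

theorem isConformalIso (hh : IsStripMap L f h) :
    IsConformalIso h (standardStrip L) (h '' standardStrip L) :=
  ⟨hh.holomorphicOn, hh.injOn.bijOn_image⟩

theorem isOpenEmbedding (hh : IsStripMap L f h) :
    IsOpenEmbedding fun z : standardStrip L => h z := by
  refine .of_continuous_injective_isOpenMap
    (continuousOn_iff_continuous_domRestrict.1 hh.holomorphicOn.1)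
    (injOn_iff_injective.1 hh.injOn) fun U hU => ?_
  have h1 : (fun z : standardStrip L => h z) '' U = h '' (Subtype.val '' U) := by
    rw [image_image]
  rw [h1]
  have h2 : Subtype.val '' U ⊆ standardStrip L := by
    rintro _ ⟨z, -, rfl⟩
    exact z.2
  exact (hh.holomorphicOn.mono h2).isOpen_image (isOpen_strip.isOpenMap_subtype_val U hU)
    (hh.injOn.mono h2)

theorem isInvariantStrip (hh : IsStripMap L f h) (hL : 0 < L) :
    IsInvariantStrip L f (h '' standardStrip L) where
  isOpen := hh.holomorphicOn.isOpen_image isOpen_strip hh.injOn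
  simplyConnected := by
    have h1 : h '' standardStrip L = range fun z : standardStrip L => h z := image_eq_range _ _
    rw [h1]
    have : ContractibleSpace (standardStrip L) :=
      (convex_strip (L := L)).contractibleSpace ⟨0, zero_mem_strip hL⟩
    have := hh.isOpenEmbedding.isEmbedding.toHomeomorph.symm.contractibleSpace
    exact SimplyConnectedSpace.ofContractible _
  conjugate := ⟨h, hh.isConformalIso, hh.map_eq⟩

theorem isCentralLine (hh : IsStripMap L f h) (hL : 0 < L) :
    IsCentralLine f (h '' standardStrip L) (range fun x : ℝ => h x) := by
  refine ⟨⟨_, hh.isConformalIso.comp_stripCoord hL, _, UpperHalfPlane.isometry_vertical_line 0, ?_⟩,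
    ?_⟩
  · have hπ := Real.pi_pos
    have key : ∀ y : ℝ, stripCoord L ((⟨⟨0, Real.exp y⟩, Real.exp_pos y⟩ : ℍ) : ℂ)
        = ((2 * L / Real.pi * y : ℝ) : ℂ) := fun y => by
      rw [stripCoord_of_re_eq_zero (UpperHalfPlane.im_pos _) rfl]
      congr 2
      exact Real.log_exp y
    refine Subset.antisymm ?_ ?_
    · rintro _ ⟨x, rfl⟩
      refine ⟨Real.pi / (2 * L) * x, ?_⟩
      simp only [key]
      congr 2
      field_simp
    · rintro _ ⟨y, rfl⟩
      exact ⟨2 * L / Real.pi * y, by simp only [key]⟩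
  · refine Subset.antisymm ?_ ?_
    · rintro _ ⟨_, ⟨x, rfl⟩, rfl⟩
      refine ⟨x - 1, ?_⟩
      simp only
      rw [hh.map_eq _ (real_mem_strip hL x)]
      push_cast
      rfl
    · rintro _ ⟨x, rfl⟩
      refine ⟨_, ⟨x + 1, rfl⟩, ?_⟩
      simp only
      rw [hh.map_eq _ (real_mem_strip hL _)]
      push_cast
      rw [add_sub_cancel_right]

theorem isForwardEnd (hh : IsStripMap L f h) {v : Sphere} (hv : IsEnd L h (-1) v) :
    IsForwardEnd f (h '' standardStrip L) v := by
  rintro _ ⟨z, hz, rfl⟩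
  refine (hv.isOrbitEnd z hz).congr fun m => ?_
  rw [hh.iterate_eq m hz]
  congr 1
  push_cast
  ring

theorem isBackwardEnd (hh : IsStripMap L f h) {v : Sphere} (hv : IsEnd L h 1 v) :
    IsBackwardEnd f (h '' standardStrip L) v := by
  intro z hz hzf
  choose w hw hwz using hz
  have hstep : ∀ m, w (m + 1) - 1 = w m := fun m =>
    hh.injOn (sub_one_mem_strip (hw _)) (hw m) (by
      rw [← hh.map_eq _ (hw _), hwz, hwz, hzf])
  have hsum : ∀ m : ℕ, w m = w 0 + m := fun m => by
    induction m with
    | zero => simp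
    | succ m ih =>
      push_cast
      linear_combination hstep m + ih
  refine (hv.isOrbitEnd (w 0) (hw 0)).congr fun m => ?_
  rw [← hwz m, hsum m]
  simp

/-- The central line, as an arc in the direction of the dynamics. -/
theorem exists_arc (hh : IsStripMap L f h) (hL : 0 < L) {u v : Sphere} (hu : IsEnd L h 1 u)
    (hv : IsEnd L h (-1) v) :
    ∃ c : ℝ → Sphere, IsEmbedding c ∧ range c = range (fun x : ℝ => h x) ∧
      Tendsto c atBot (𝓝 u) ∧ Tendsto c atTop (𝓝 v) ∧ ∀ t, f (c t) = c (t + 1) := by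
  refine ⟨fun t => h ((-t : ℝ) : ℂ), ?_, ?_, ?_, ?_, fun t => ?_⟩
  · have h1 : IsEmbedding fun t : ℝ => (⟨((-t : ℝ) : ℂ), real_mem_strip hL _⟩ : standardStrip L) := by
      refine IsEmbedding.of_comp (by fun_prop) continuous_subtype_val ?_
      exact Complex.isometry_ofReal.isEmbedding.comp (Homeomorph.neg ℝ).isEmbedding
    exact hh.isOpenEmbedding.isEmbedding.comp h1
  · exact (neg_surjective (G := ℝ)).range_comp fun x : ℝ => h x
  · have h1 := (hu.tendsto_real hL).comp tendsto_neg_atBot_atTop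
    exact h1.congr fun t => by simp
  · exact (hv.tendsto_real hL).congr fun t => by simp
  · simp only
    rw [hh.map_eq _ (real_mem_strip hL _)]
    congr 1
    push_cast
    ring

end IsStripMap

end

/-! ### Structure of the limit -/

theorem cconvAt_of_tendstoUniformly {ι X Y : Type*} [TopologicalSpace X] [UniformSpace Y]
    {𝒰 : Filter ι} {φ : ι → X → Y} {Φ : X → Y} (h : TendstoUniformly φ Φ 𝒰) {x : X}
    (hc : ContinuousAt Φ x) : CConvAt 𝒰 φ Φ x := by
  rw [CConvAt, Uniform.tendsto_nhds_right]
  intro U hU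
  obtain ⟨V, hV, hVU⟩ := comp_mem_uniformity_sets hU
  rw [mem_map]
  filter_upwards [(h V hV).prod_mk (hc (UniformSpace.ball_mem_nhds _ hV))] with q hq
  exact hVU ⟨Φ q.2, hq.2, hq.1 q.2⟩

/-- Limits of points of the lines are at distance zero from `Γ`; conversely, a point of `Γ` is
approximated within the Hausdorff distance plus `1 / (n + 1)`. Thus the limit set does not depend on
the ultrafilter. -/
theorem limSet_eq_of_hausdorffDist {h : ℕ → ℂ → Sphere} {𝒰 : Ultrafilter ℕ}
    (h𝒰 : (𝒰 : Filter ℕ) ≤ atTop) {Γ : Set Sphere} (hΓc : IsClosed Γ) (hΓn : Γ.Nonempty)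
    (hΓ : Tendsto (fun n => Metric.hausdorffDist (closure (range fun x : ℝ => h n x)) Γ)
      𝒰 (𝓝 0)) : limSet 𝒰 h = Γ := by
  have hfin : ∀ n, Metric.hausdorffEDist (closure (range fun x : ℝ => h n x)) Γ ≠ ⊤ := fun n =>
    Metric.hausdorffEDist_ne_top_of_nonempty_of_bounded (range_nonempty _).closure hΓn
      (isClosed_closure.isCompact.isBounded) hΓc.isCompact.isBounded
  refine Subset.antisymm ?_ fun y hy => ?_
  · rintro _ ⟨t, rfl⟩
    have h1 : Tendsto (fun n => Metric.infDist (h n (t n)) Γ) 𝒰 (𝓝 0) :=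
      squeeze_zero (fun _ => Metric.infDist_nonneg) (fun n =>
        Metric.infDist_le_hausdorffDist_of_mem
          (subset_closure (mem_range_self (f := fun x : ℝ => h n x) (t n))) (hfin n)) hΓ
    have h2 := ((Metric.continuous_infDist_pt Γ).tendsto _).comp (tendsto_limMap_zero 𝒰 h t)
    exact (hΓc.mem_iff_infDist_zero hΓn).2 (tendsto_nhds_unique h2 h1)
  · have hex : ∀ n, ∃ t : ℝ, dist (h n t) y <
        Metric.hausdorffDist (closure (range fun x : ℝ => h n x)) Γ + 1 / ((n : ℝ) + 1) := by
      intro n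
      have h1 : Metric.infDist y (closure (range fun x : ℝ => h n x)) ≤
          Metric.hausdorffDist (closure (range fun x : ℝ => h n x)) Γ := by
        rw [Metric.hausdorffDist_comm]
        exact Metric.infDist_le_hausdorffDist_of_mem hy
          (by rw [Metric.hausdorffEDist_comm]; exact hfin n)
      rw [Metric.infDist_closure] at h1
      obtain ⟨_, ⟨t, rfl⟩, ht⟩ := (Metric.infDist_lt_iff (range_nonempty _)).1
        (h1.trans_lt (lt_add_of_pos_right _ (Nat.one_div_pos_of_nat (α := ℝ) (n := n))))
      exact ⟨t, by rwa [dist_comm]⟩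
    choose t ht using hex
    refine ⟨t, tendsto_nhds_unique (tendsto_limMap_zero 𝒰 h t) ?_⟩
    rw [tendsto_iff_dist_tendsto_zero]
    have h1 := hΓ.add (tendsto_one_div_add_atTop_nhds_zero_nat.mono_left h𝒰)
    rw [add_zero] at h1
    exact squeeze_zero (fun _ => dist_nonneg) (fun n => (ht n).le) h1

theorem IsEnd.congr_add {L : ℝ} {H K : ℂ → Sphere} {c : ℝ}
    (hHK : ∀ z ∈ standardStrip L, K z = H (z + c)) {σ : ℝ} {v : Sphere} (hv : IsEnd L H σ v) :
    IsEnd L K σ v := fun z hz => by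
  refine (hv (z + c) (add_real_mem_strip hz c)).congr fun x => ?_
  rw [hHK _ (add_real_mem_strip hz _)]
  congr 1
  ring

/-! ### Ends of the approximating strips -/

section Ends

variable {L : ℝ} {f : ℕ → Sphere → Sphere} {g : Sphere → Sphere} {h : ℕ → ℂ → Sphere}
  {a u : ℕ → Sphere} {aInf uInf : Sphere} {𝒰 : Ultrafilter ℕ}

theorem multiplier_of_forward_ends (h𝒰 : (𝒰 : Filter ℕ) ≤ atTop) (hL : 0 < L) (hg : IsTameMap g)
    (hf : ∀ i, IsHolSelf (f i)) (hfg : ∀ x, CConvAt (𝒰 : Filter ℕ) f g x)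
    (hh : ∀ i, IsStripMap L (f i) (h i)) (ha : ∀ i, IsOrbitEnd L (h i) (-1) (a i))
    (haInf : Tendsto a 𝒰 (𝓝 aInf)) : ‖multiplier g aInf‖ < 1 ∨ multiplier g aInf = 1 :=
  (norm_multiplier_le_one_of_ends hL hf hfg hh ha haInf).lt_or_eq.imp_right
    (multiplier_eq_one_of_ends h𝒰 hL hg hf hfg hh ha haInf)

theorem multiplier_of_backward_ends (h𝒰 : (𝒰 : Filter ℕ) ≤ atTop) (hL : 0 < L) (hg : IsTameMap g)
    (hf : ∀ i, IsHolSelf (f i)) (hfg : ∀ x, CConvAt (𝒰 : Filter ℕ) f g x)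
    (hh : ∀ i, IsStripMap L (f i) (h i)) (hu : ∀ i, IsOrbitEnd L (h i) 1 (u i))
    (huInf : Tendsto u 𝒰 (𝓝 uInf)) : 1 < ‖multiplier g uInf‖ ∨ multiplier g uInf = 1 :=
  (one_le_norm_multiplier_of_ends hL hf hfg hh hu huInf).lt_or_eq.imp_right fun he =>
    multiplier_eq_one_of_ends h𝒰 hL hg hf hfg hh hu huInf he.symm

/-- Two omitted sequences are needed. If the ends have distinct limits they serve themselves.
Otherwise the common limit is a limit of backward ends, so its multiplier is non-zero, and the
second sequence consists of preimages of `a i`. -/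
theorem stripFamily_of_ends (hL : 0 < L) (hg : IsTameMap g)
    (hf : ∀ i, IsHolSelf (f i)) (hfg : ∀ x, CConvAt (𝒰 : Filter ℕ) f g x)
    (hh : ∀ i, IsStripMap L (f i) (h i)) (ha : ∀ i, IsOrbitEnd L (h i) (-1) (a i))
    (hu : ∀ i, IsOrbitEnd L (h i) 1 (u i)) (haInf : Tendsto a 𝒰 (𝓝 aInf))
    (huInf : Tendsto u 𝒰 (𝓝 uInf)) : StripFamily L 𝒰 f g h := by
  have hafix : ∀ i, f i (a i) = a i := fun i => (ha i).map_eq hL (hf i).continuous (hh i)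
  have hufix : ∀ i, f i (u i) = u i := fun i => (hu i).map_eq hL (hf i).continuous (hh i)
  refine ⟨hL, hfg, hh, ?_⟩
  by_cases hne : aInf = uInf
  · have hmul : multiplier g aInf ≠ 0 := by
      have h1 := one_le_norm_multiplier_of_ends hL hf hfg hh hu huInf
      rw [← hne] at h1
      exact norm_pos_iff.1 (one_pos.trans_le h1)
    obtain ⟨q, q₀, h1, h2, h3⟩ := exists_omitted hg (Eventually.of_forall hf) hfg haInf
      (fixed_of_tendsto hfg haInf (Eventually.of_forall hafix)) hmul
    refine ⟨a, q, aInf, q₀, h1, haInf, h2, Eventually.of_forall fun i => by rw [hafix, hafix], ?_⟩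
    filter_upwards [h3] with i hi
    rw [hi, hafix]
  · exact ⟨a, u, aInf, uInf, hne, haInf, huInf,
      Eventually.of_forall fun i => by rw [hafix, hafix],
      Eventually.of_forall fun i => by rw [hufix, hufix]⟩

end Ends

/-! ### The set of edges and its uniqueness properties -/

namespace StripFamily

variable {ι : Type*} {L : ℝ} {𝒰 : Ultrafilter ι} {f : ι → Sphere → Sphere}
  {g : Sphere → Sphere} {h : ι → ℂ → Sphere}

theorem isEnd_of_tendsto_sub (hF : StripFamily L 𝒰 f g h) {t s : ι → ℝ} {c : ℝ}
    (hc : Tendsto (fun i => s i - t i) 𝒰 (𝓝 c)) {σ : ℝ} {v : Sphere}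
    (hv : IsEnd L (limMap 𝒰 h t) σ v) : IsEnd L (limMap 𝒰 h s) σ v :=
  IsEnd.congr_add (fun _ hz => hF.limMap_eq_of_tendsto hc hz) hv

/-- All strips that end at an attracting fixed point agree. -/
theorem exists_tendsto_sub_of_attracting (hF : StripFamily L 𝒰 f g h) (hg : IsTameMap g)
    (hf : ∀ i, IsHolSelf (f i)) {v : Sphere} (hv : g v = v) (hmul : ‖multiplier g v‖ < 1)
    {t s : ι → ℝ} (ht : IsStripMap L g (limMap 𝒰 h t)) (hte : IsEnd L (limMap 𝒰 h t) (-1) v)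
    (hs : IsStripMap L g (limMap 𝒰 h s)) (hse : IsEnd L (limMap 𝒰 h s) (-1) v) :
    ∃ c : ℝ, Tendsto (fun i => s i - t i) 𝒰 (𝓝 c) := by
  obtain ⟨K, hKv, hKc, hKm, hKf⟩ := exists_attracting_trap hg.isHolSelf hf hF.conv hv hmul
  refine hF.exists_tendsto_sub_of_trapped hg (Or.inr rfl) hKc.isClosed hKf
    (fun t _ hte => hF.trapped_of_attracting hKm hKv hte) (fun t ht hte => ?_) ht hte hs hse
  rw [neg_neg] at hte
  rcases hte.multiplier_backward hF.pos hg ht with h1 | h1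
  · linarith
  · rw [h1, norm_one] at hmul
    exact lt_irrefl _ hmul

/-- All strips that start at a repelling fixed point agree. -/
theorem exists_tendsto_sub_of_repelling (hF : StripFamily L 𝒰 f g h) (hg : IsTameMap g)
    (hf : ∀ i, IsHolSelf (f i)) {v : Sphere} (hv : g v = v) (hmul : 1 < ‖multiplier g v‖)
    {t s : ι → ℝ} (ht : IsStripMap L g (limMap 𝒰 h t)) (hte : IsEnd L (limMap 𝒰 h t) 1 v)
    (hs : IsStripMap L g (limMap 𝒰 h s)) (hse : IsEnd L (limMap 𝒰 h s) 1 v) :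
    ∃ c : ℝ, Tendsto (fun i => s i - t i) 𝒰 (𝓝 c) := by
  obtain ⟨K, hKv, O, hKc, hO, hKO, hKm, hKf⟩ :=
    exists_repelling_trap hg.isHolSelf hf hF.conv hv hmul
  refine hF.exists_tendsto_sub_of_trapped hg (Or.inl rfl) hKc.isClosed hKf
    (fun t _ hte => hF.trapped_of_repelling hKc.isClosed hO hKO hKm hKv hte)
    (fun t ht hte => ?_) ht hte hs hse
  rcases hte.multiplier_forward hF.pos hg ht with h1 | h1
  · linarith
  · rw [h1, norm_one] at hmul
    exact lt_irrefl _ hmul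

/-- An edge whose forward end is attracting points to the limit of the forward ends. -/
theorem eq_of_attracting (hF : StripFamily L 𝒰 f g h) (hg : IsTameMap g)
    (hf : ∀ i, IsHolSelf (f i)) {v : Sphere} (hv : g v = v) (hmul : ‖multiplier g v‖ < 1)
    {t : ι → ℝ} (hte : IsEnd L (limMap 𝒰 h t) (-1) v) {a : ι → Sphere} {aInf : Sphere}
    (ha : ∀ i, IsOrbitEnd L (h i) (-1) (a i)) (haInf : Tendsto a 𝒰 (𝓝 aInf))
    (hfix : g aInf = aInf) : aInf = v := by
  obtain ⟨K, hKv, hKc, hKm, hKf⟩ := exists_attracting_trap hg.isHolSelf hf hF.conv hv hmul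
  refine hKf _ (hKc.isClosed.mem_of_tendsto haInf ?_) hfix
  obtain ⟨M, hM⟩ := hF.trapped_of_attracting hKm hKv hte
  filter_upwards [hM] with i hi
  refine hKc.isClosed.mem_of_tendsto (ha i (t i) (real_mem_strip hF.pos _)) ?_
  filter_upwards [tendsto_natCast_atTop_atTop.eventually_ge_atTop M] with m hm
  have := hi m hm
  push_cast at this ⊢
  exact this

/-- The strips in the limit. -/
def Edge (L : ℝ) (𝒰 : Ultrafilter ι) (g : Sphere → Sphere) (h : ι → ℂ → Sphere) : Type :=
  {S : Set Sphere // ∃ t, IsStripMap L g (limMap 𝒰 h t) ∧ S = limMap 𝒰 h t '' standardStrip L}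

namespace Edge

/-- The base points of a strip in the limit. -/
def base (e : Edge L 𝒰 g h) : ι → ℝ := e.2.choose

theorem isStripMap (e : Edge L 𝒰 g h) : IsStripMap L g (limMap 𝒰 h e.base) := e.2.choose_spec.1

theorem eq_image (e : Edge L 𝒰 g h) : e.1 = limMap 𝒰 h e.base '' standardStrip L :=
  e.2.choose_spec.2

end Edge

/-- The centre `e.base` is a choice that may differ from `t`, but a common point of the two strips
bounds the difference and makes it converge. -/
theorem exists_edge_of_isStripMap (hF : StripFamily L 𝒰 f g h) {t : ι → ℝ}
    (ht : IsStripMap L g (limMap 𝒰 h t)) : ∃ e : Edge L 𝒰 g h,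
      e.1 = limMap 𝒰 h t '' standardStrip L ∧
      ∃ c : ℝ, Tendsto (fun i => e.base i - t i) 𝒰 (𝓝 c) := by
  let e : Edge L 𝒰 g h := ⟨_, t, ht, rfl⟩
  refine ⟨e, rfl, ?_⟩
  have h0 := zero_mem_strip hF.pos
  have h1 : limMap 𝒰 h e.base 0 ∈ limMap 𝒰 h t '' standardStrip L :=
    (e.eq_image.symm ▸ mem_image_of_mem _ h0 : limMap 𝒰 h e.base 0 ∈ e.1)
  obtain ⟨w, hw, hwe⟩ := h1
  exact hF.exists_shift_of_eq ht hw h0 hwe.symm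

theorem edge_eq_of_tendsto (hF : StripFamily L 𝒰 f g h) {e e' : Edge L 𝒰 g h} {c : ℝ}
    (hc : Tendsto (fun i => e'.base i - e.base i) 𝒰 (𝓝 c)) : e' = e :=
  Subtype.ext (by rw [e.eq_image, e'.eq_image, hF.image_eq_of_tendsto hc])

theorem pairwise_disjoint_edge (hF : StripFamily L 𝒰 f g h) :
    Pairwise fun e e' : Edge L 𝒰 g h => Disjoint e.1 e'.1 := by
  intro e e' hne
  rw [disjoint_left]
  intro y hy hy'
  rw [e.eq_image] at hy
  rw [e'.eq_image] at hy'
  obtain ⟨w, hw, rfl⟩ := hy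
  obtain ⟨w', hw', he⟩ := hy'
  obtain ⟨c, hc⟩ := hF.exists_shift_of_eq e.isStripMap hw hw' he
  exact hne (hF.edge_eq_of_tendsto hc).symm

/-- Disjoint non-empty open subsets of a separable space. -/
theorem countable_edge (hF : StripFamily L 𝒰 f g h) : Countable (Edge L 𝒰 g h) := by
  refine Pairwise.countable_of_isOpen_disjoint (s := fun e : Edge L 𝒰 g h => e.1)
    hF.pairwise_disjoint_edge (fun e => ?_) fun e => ?_
  · rw [e.eq_image]
    exact e.isStripMap.holomorphicOn.isOpen_image isOpen_strip e.isStripMap.injOn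
  · rw [e.eq_image]
    exact ⟨_, mem_image_of_mem _ (zero_mem_strip hF.pos)⟩

theorem edge_inter_limSet (hF : StripFamily L 𝒰 f g h) (e : Edge L 𝒰 g h) :
    e.1 ∩ limSet 𝒰 h = range fun x : ℝ => limMap 𝒰 h e.base x := by
  refine Subset.antisymm ?_ ?_
  · rintro y ⟨hy, hyΓ⟩
    rw [e.eq_image] at hy
    obtain ⟨w, hw, rfl⟩ := hy
    obtain ⟨x, rfl⟩ := hF.exists_real_of_mem e.isStripMap hw hyΓ
    exact ⟨x, rfl⟩
  · rintro _ ⟨x, rfl⟩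
    refine ⟨?_, limMap_real_mem _ _⟩
    rw [e.eq_image]
    exact mem_image_of_mem _ (real_mem_strip hF.pos x)

theorem limSet_diff_fixed (hF : StripFamily L 𝒰 f g h) :
    limSet 𝒰 h \ (limSet 𝒰 h ∩ {z | g z = z}) =
      ⋃ e : Edge L 𝒰 g h, range fun x : ℝ => limMap 𝒰 h e.base x := by
  ext y
  constructor
  · rintro ⟨hy, hyV⟩
    obtain ⟨t, rfl⟩ := hy
    have h0 := zero_mem_strip hF.pos
    obtain ⟨e, he, -⟩ := hF.exists_edge_of_isStripMap
      (hF.isStripMap_of_ne h0 fun h1 => hyV ⟨⟨t, rfl⟩, h1⟩)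
    refine mem_iUnion.2 ⟨e, ?_⟩
    rw [← hF.edge_inter_limSet, he]
    exact ⟨mem_image_of_mem _ h0, ⟨t, rfl⟩⟩
  · intro hy
    obtain ⟨e, x, rfl⟩ := mem_iUnion.1 hy
    exact ⟨limMap_real_mem _ _, fun h1 => e.isStripMap.map_ne (real_mem_strip hF.pos x) h1.2⟩

end StripFamily

end

end InvariantStrips

theorem mainTheorem8 (L : ℝ) (hL : 0 < L)
    (f : ℕ → RatFunc ℂ) (g : RatFunc ℂ) (hg : 2 ≤ ratDegree g)
    (hfg : TendstoUniformly (fun n => ratMap (f n)) (ratMap g) atTop)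
    (A γ : ℕ → Set Sphere)
    (hA : ∀ n, IsInvariantStrip L (ratMap (f n)) (A n))
    (hγ : ∀ n, IsCentralLine (ratMap (f n)) (A n) (γ n))
    (Γ : TopologicalSpace.NonemptyCompacts Sphere)
    (hΓ : Tendsto (fun n => Metric.hausdorffDist (closure (γ n)) (Γ : Set Sphere)) atTop (𝓝 0))
    (a u : ℕ → Sphere)
    (ha : ∀ n, IsForwardEnd (ratMap (f n)) (A n) (a n))
    (hu : ∀ n, IsBackwardEnd (ratMap (f n)) (A n) (u n))
    (aInf uInf : Sphere)
    (haInf : Tendsto a atTop (𝓝 aInf)) (huInf : Tendsto u atTop (𝓝 uInf)) :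
    ∃ (V : Set Sphere) (E : Type) (_ : Countable E) (S edge : E → Set Sphere)
      (src tgt : E → Sphere),
      IsConnectedDirectedGraph (ratMap g) (Γ : Set Sphere) V edge src tgt ∧
      -- the vertices
      V = (Γ : Set Sphere) ∩ {z | ratMap g z = z} ∧ V.Nonempty ∧ V.Finite ∧
      aInf ∈ V ∧ uInf ∈ V ∧
      -- the edges are central lines of disjoint invariant strips
      (Γ : Set Sphere) \ V = ⋃ e, edge e ∧
      (∀ e, IsInvariantStrip L (ratMap g) (S e) ∧ IsCentralLine (ratMap g) (S e) (edge e) ∧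
        IsBackwardEnd (ratMap g) (S e) (src e) ∧ IsForwardEnd (ratMap g) (S e) (tgt e)) ∧
      (Pairwise fun e e' => Disjoint (S e) (S e')) ∧
      -- the edges are isolated
      (∀ e, S e ∩ (Γ : Set Sphere) = edge e) ∧
      -- unless the limit is a single point, every vertex is the end of an edge
      ((Γ : Set Sphere).Nontrivial → ∀ v ∈ V, ∃ e, src e = v ∨ tgt e = v) ∧
      -- the limit of the forward ends
      (IsAttractingFixed (ratMap g) aInf ∨ IsParabolicFixed (ratMap g) aInf) ∧
      (IsAttractingFixed (ratMap g) aInf →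
        uInf ≠ aInf ∧ (∃! e, tgt e = aInf) ∧ ∀ e, src e ≠ aInf) ∧
      -- the limit of the backward ends
      (IsRepellingFixed (ratMap g) uInf ∨ IsParabolicFixed (ratMap g) uInf) ∧
      (IsRepellingFixed (ratMap g) uInf →
        uInf ≠ aInf ∧ (∃! e, src e = uInf) ∧ ∀ e, tgt e ≠ uInf) ∧
      -- the edges that do not end at the limit of the forward ends
      (∀ e, tgt e ≠ aInf →
        ∃ Ω, IsFixedParabolicBasin (ratMap g) Ω ∧ S e ⊆ Ω ∧ edge e ⊆ Ω) := by
  -- Any ultrafilter finer than `atTop` would do: hypotheses on limits pass to it, and the set `Γ`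
  -- is unaffected.
  have h𝒰 : (hyperfilter ℕ : Filter ℕ) ≤ atTop := Nat.hyperfilter_le_atTop
  set 𝒰 : Ultrafilter ℕ := hyperfilter ℕ
  have hgt : IsTameMap (ratMap g) := isTameMap_ratMap hg
  have hf : ∀ n, IsHolSelf (ratMap (f n)) := fun n => isHolSelf_ratMap (f n)
  have hconv : ∀ x, CConvAt (𝒰 : Filter ℕ) (fun n => ratMap (f n)) (ratMap g) x := fun x =>
    (cconvAt_of_tendstoUniformly hfg hgt.isHolSelf.continuous.continuousAt).mono_left
      (prod_mono_left _ h𝒰)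
  choose h hh hhA using fun n => (hA n).exists_isStripMap
  have hae : ∀ n, IsOrbitEnd L (h n) (-1) (a n) := fun n => (hhA n).isOrbitEnd_forward (hh n) (ha n)
  have hue : ∀ n, IsOrbitEnd L (h n) 1 (u n) := fun n => (hhA n).isOrbitEnd_backward (hh n) (hu n)
  have haU := haInf.mono_left h𝒰
  have huU := huInf.mono_left h𝒰
  have hafix : ratMap g aInf = aInf := fixed_of_tendsto hconv haU
    (Eventually.of_forall fun n => (hae n).map_eq hL (hf n).continuous (hh n))
  have hufix : ratMap g uInf = uInf := fixed_of_tendsto hconv huU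
    (Eventually.of_forall fun n => (hue n).map_eq hL (hf n).continuous (hh n))
  have hamul := multiplier_of_forward_ends h𝒰 hL hgt hf hconv hh hae haU
  have humul := multiplier_of_backward_ends h𝒰 hL hgt hf hconv hh hue huU
  have hF : StripFamily L 𝒰 (fun n => ratMap (f n)) (ratMap g) h :=
    stripFamily_of_ends hL hgt hf hconv hh hae hue haU huU
  have hγ' : ∀ n, γ n = range fun x : ℝ => h n x := fun n =>
    (hγ n).eq_range hL (hhA n) (hh n).map_eq
  have hΓcl : IsClosed (Γ : Set Sphere) := Γ.isCompact.isClosed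
  have hlim : limSet 𝒰 h = Γ := limSet_eq_of_hausdorffDist h𝒰 hΓcl Γ.nonempty (by
    simp only [← hγ']
    exact hΓ.mono_left h𝒰)
  have hcl : IsClosed (limSet 𝒰 h) := hlim ▸ hΓcl
  have hends : ∀ {σ : ℝ} {p : ℕ → Sphere} {p₀ : Sphere}, (∀ n, IsOrbitEnd L (h n) σ (p n)) →
      Tendsto p 𝒰 (𝓝 p₀) → p₀ ∈ limSet 𝒰 h := fun hp hp₀ => by
    obtain ⟨t, ht⟩ := exists_tendsto_of_ends h𝒰 hL hp hp₀
    exact ⟨t, tendsto_nhds_unique (tendsto_limMap_zero 𝒰 h t) ht⟩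
  have haΓ : aInf ∈ limSet 𝒰 h := hends hae haU
  have huΓ : uInf ∈ limSet 𝒰 h := hends hue huU
  choose src hsrcf hsrc using fun e : StripFamily.Edge L 𝒰 (ratMap g) h =>
    hF.exists_isEnd hgt e.isStripMap (Or.inl rfl)
  choose tgt htgtf htgt using fun e : StripFamily.Edge L 𝒰 (ratMap g) h =>
    hF.exists_isEnd hgt e.isStripMap (Or.inr rfl)
  have hedge : ∀ t : ℕ → ℝ, IsStripMap L (ratMap g) (limMap 𝒰 h t) →
      ∃ e, (∀ v, IsEnd L (limMap 𝒰 h t) 1 v → src e = v) ∧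
        ∀ v, IsEnd L (limMap 𝒰 h t) (-1) v → tgt e = v := by
    intro t ht
    obtain ⟨e, -, c, hc⟩ := hF.exists_edge_of_isStripMap ht
    exact ⟨e, fun v hv => (hsrc e).unique hL (hF.isEnd_of_tendsto_sub hc hv),
      fun v hv => (htgt e).unique hL (hF.isEnd_of_tendsto_sub hc hv)⟩
  have hat : ∀ v y, v ∈ limSet 𝒰 h → ratMap g v = v → y ∈ limSet 𝒰 h → y ≠ v →
      ∃ e, src e = v ∨ tgt e = v := by
    intro v y hv hvf hy hyv
    obtain ⟨t, σ, hσ, ht, hte⟩ := hF.exists_edge_at hgt hv hvf hy hyv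
    obtain ⟨e, he1, he2⟩ := hedge t ht
    rcases hσ with rfl | rfl
    · exact ⟨e, Or.inl (he1 v hte)⟩
    · exact ⟨e, Or.inr (he2 v hte)⟩
  have hsrcΓ : ∀ e, src e ∈ limSet 𝒰 h := fun e => hF.isEnd_mem_limSet hcl (hsrc e)
  have htgtΓ : ∀ e, tgt e ∈ limSet 𝒰 h := fun e => hF.isEnd_mem_limSet hcl (htgt e)
  have hsub : (⋃ e : StripFamily.Edge L 𝒰 (ratMap g) h, range fun x : ℝ => limMap 𝒰 h e.base x) =
      limSet 𝒰 h \ (limSet 𝒰 h ∩ {z | ratMap g z = z}) := hF.limSet_diff_fixed.symm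
  have hdisj := hF.pairwise_disjoint_edge
  have hedgesub : ∀ e : StripFamily.Edge L 𝒰 (ratMap g) h,
      (range fun x : ℝ => limMap 𝒰 h e.base x) ⊆ e.1 := fun e => by
    rw [← hF.edge_inter_limSet]
    exact inter_subset_left
  rw [← hlim]
  refine ⟨limSet 𝒰 h ∩ {z | ratMap g z = z}, StripFamily.Edge L 𝒰 (ratMap g) h, hF.countable_edge,
    fun e => e.1, fun e => range fun x : ℝ => limMap 𝒰 h e.base x, src, tgt, ?_, rfl,
    ⟨aInf, haΓ, hafix⟩, hgt.finite_fixed.subset inter_subset_right, ⟨haΓ, hafix⟩, ⟨huΓ, hufix⟩,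
    hF.limSet_diff_fixed, fun e => ?_, hdisj, fun e => hF.edge_inter_limSet e, ?_, ?_, ?_, ?_, ?_,
    fun e he => ?_⟩
  · refine ⟨fun e => ⟨hsrcΓ e, hsrcf e⟩, fun e => ⟨htgtΓ e, htgtf e⟩, ?_, fun e => ?_,
      fun e e' hne => (hdisj hne).mono (hedgesub e) (hedgesub e'),
      fun e => e.isStripMap.exists_arc hL (hsrc e) (htgt e),
      ⟨⟨aInf, haΓ⟩, hF.isPreconnected_limSet hcl⟩, fun v hv w hw => ?_⟩
    · rw [hsub, union_sdiff_cancel inter_subset_left]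
    · refine disjoint_left.2 fun y hy hyV => ?_
      have : y ∈ limSet 𝒰 h \ (limSet 𝒰 h ∩ {z | ratMap g z = z}) := hsub ▸ mem_iUnion.2 ⟨e, hy⟩
      exact this.2 hyV
    · refine (hF.eqvGen_edgeRel hgt hcl hv.1 hv.2 hw.1 hw.2).mono fun x y hxy => ?_
      obtain ⟨t, ht, hx, hy⟩ := hxy
      obtain ⟨e, he1, he2⟩ := hedge t ht
      exact ⟨e, he1 x hx, he2 y hy⟩
  · have he := e.isStripMap
    simp only [e.eq_image]
    exact ⟨he.isInvariantStrip hL, he.isCentralLine hL, he.isBackwardEnd (hsrc e),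
      he.isForwardEnd (htgt e)⟩
  · intro hnt v hv
    obtain ⟨y, hy, hyv⟩ := hnt.exists_ne v
    exact hat v y hv.1 hv.2 hy hyv
  · exact hamul.imp (fun h1 => ⟨hafix, h1⟩) fun h1 => ⟨hafix, 1, one_pos, by rw [h1, one_pow]⟩
  · rintro ⟨-, hlt⟩
    have hne : uInf ≠ aInf := by
      rintro rfl
      rcases humul with h1 | h1
      · linarith
      · rw [h1, norm_one] at hlt
        exact lt_irrefl _ hlt
    have hnosrc : ∀ e, src e ≠ aInf := fun e he => by
      rcases (hsrc e).multiplier_backward hL hgt e.isStripMap with h1 | h1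
      · rw [he] at h1
        linarith
      · rw [he] at h1
        rw [h1, norm_one] at hlt
        exact lt_irrefl _ hlt
    refine ⟨hne, ?_, hnosrc⟩
    -- Since `uInf` is a second point of `Γ`, some edge has an end at `aInf`; it must point to it,
    -- as no backward end is attracting.
    obtain ⟨e, he⟩ := hat aInf uInf haΓ hafix huΓ hne
    refine ⟨e, he.resolve_left (hnosrc e), fun e' he' => ?_⟩
    have h1 := htgt e
    have h2 := htgt e'
    rw [he.resolve_left (hnosrc e)] at h1
    rw [he'] at h2
    obtain ⟨c, hc⟩ := hF.exists_tendsto_sub_of_attracting hgt hf hafix hlt e.isStripMap h1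
      e'.isStripMap h2
    exact hF.edge_eq_of_tendsto hc
  · exact humul.imp (fun h1 => ⟨hufix, h1⟩) fun h1 => ⟨hufix, 1, one_pos, by rw [h1, one_pow]⟩
  · rintro ⟨-, hlt⟩
    have hne : uInf ≠ aInf := by
      rintro rfl
      rcases hamul with h1 | h1
      · linarith
      · rw [h1, norm_one] at hlt
        exact lt_irrefl _ hlt
    have hnotgt : ∀ e, tgt e ≠ uInf := fun e he => by
      rcases (htgt e).multiplier_forward hL hgt e.isStripMap with h1 | h1
      · rw [he] at h1
        linarith
      · rw [he] at h1
        rw [h1, norm_one] at hlt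
        exact lt_irrefl _ hlt
    refine ⟨hne, ?_, hnotgt⟩
    obtain ⟨e, he⟩ := hat uInf aInf huΓ hufix haΓ hne.symm
    refine ⟨e, he.resolve_right (hnotgt e), fun e' he' => ?_⟩
    have h1 := hsrc e
    have h2 := hsrc e'
    rw [he.resolve_right (hnotgt e)] at h1
    rw [he'] at h2
    obtain ⟨c, hc⟩ := hF.exists_tendsto_sub_of_repelling hgt hf hufix hlt e.isStripMap h1
      e'.isStripMap h2
    exact hF.edge_eq_of_tendsto hc
  -- An attracting target would trap the ends `a n` and hence be `aInf`.
  · have hmul : multiplier (ratMap g) (tgt e) = 1 :=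
      ((htgt e).multiplier_forward hL hgt e.isStripMap).resolve_left fun h1 =>
        he (hF.eq_of_attracting hgt hf (htgtf e) h1 (htgt e) hae haU hafix).symm
    obtain ⟨Ω, hΩ, hsubΩ⟩ := exists_parabolic_basin hL hgt hF.hasOmittedPair e.isStripMap (htgt e)
      hmul
    rw [← e.eq_image] at hsubΩ
    exact ⟨Ω, hΩ, hsubΩ, (hedgesub e).trans hsubΩ⟩
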